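/- Let $\mathcal{O}=\mathbb{Z}[i]$, $\mathcal{O}^{\#}=\frac{i}{2}\mathcal{O}$, $N(r)=r\overline{r}$, $e(x)=e^{2\pi i x}$, and let $\mathcal{H}$ be the complex upper half-plane. For $k,m\in\mathbb{Z}$ and $\delta\in\{+,-\}$, a Hermitian Jacobi form of weight $k$, index $m$ and parity $\delta$ is a holomorphic function $\phi:\mathcal{H}\times\mathbb{C}^2\to\mathbb{C}$ such that for all $\begin{pmatrix}a&b\\c&d\end{pmatrix}\in SL_2(\mathbb{Z})$, $\epsilon\in\mathcal{O}^{\times}$ and $\lambda,\mu\in\mathcal{O}$, $$\sigma(\epsilon)\epsilon^{-k}(c\tau+d)^{-k}e^{\frac{-2\pi i m c z_1z_2}{c\tau+d}}\,\phi\left(\frac{a\tau+b}{c\tau+d},\frac{\epsilon z_1}{c\tau+d},\frac{\overline{\epsilon}z_2}{c\tau+d}\right)=\phi(\tau,z_1,z_2),$$ $$e^{2\pi i m(\lambda\overline{\lambda}\tau+\overline{\lambda}z_1+\lambda z_2)}\,\phi(\tau,z_1+\lambda\tau+\mu,z_2+\overline{\lambda}\tau+\overline{\mu})=\phi(\tau,z_1,z_2),$$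 where $\sigma(\epsilon)=1$ if $\delta=+$ and $\sigma(\epsilon)=\epsilon^2$ if $\delta=-$, and such that $\phi$ has a Fourier expansion $$\phi(\tau,z_1,z_2)=\sum_{\substack{n\in\mathbb{Z},\,n\ge 0,\ r\in\mathcal{O}^{\#}\\ N(r)\le mn}}c(\phi;n,r)\,e(n\tau+rz_1+\overline{r}z_2).$$ For a prime $p$ let $\mathbb{Z}_{(p)}$ be the localization of $\mathbb{Z}$ at $p$, and let $HJ^{\delta}_{k,m}(\mathbb{Z}_{(p)})$ be the set of all such $\phi$ with all $c(\phi;n,r)\in\mathbb{Z}_{(p)}$. For functions $\phi,\psi$ with a Fourier expansion of the above shape (over all $n\in\mathbb{Z}$, $r\in\mathcal{O}^{\#}$), $\phi\equiv\psi\pmod p$ means $c(\phi;n,r)-c(\psi;n,r)\in p\mathbb{Z}_{(p)}$ for all $n,r$. **Theorem.** Let $p\ge 5$ be a prime. (1) Let $\phi\in HJ^{\delta}_{k,m}(\mathbb{Z}_{(p)})$ and $\psi\in HJ^{\delta'}_{k',m'}(\mathbb{Z}_{(p)})$, with any weights $k,k'$, indices $m,m'$ and parities $\delta,\delta'$, be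 such that $\phi\not\equiv 0\pmod p$ and $\phi\equiv\psi\pmod p$. Then $m=m'$ and $k\equiv k'\pmod{p-1}$. (2) Let $m\in\mathbb{Z}$ be fixed, let $K$ be a finite set of weights, and for each $k\in K$ let $\phi_k\in HJ^{\delta_k}_{k,m}(\mathbb{Z}_{(p)})$ for some parity $\delta_k$. If $\sum_{k\in K}\phi_k\equiv 0\pmod p$, then for every $a\in\mathbb{Z}/(p-1)\mathbb{Z}$, $$\sum_{k\in K,\ k\in a+(p-1)\mathbb{Z}}\phi_k\equiv 0\pmod p.$$ -/

import Mathlib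

open scoped UpperHalfPlane MatrixGroups ComplexConjugate

namespace HermitianJacobi

/-- `e(x) = exp(2πix)`. -/
noncomputable def e (x : ℂ) : ℂ := Complex.exp (2 * Real.pi * Complex.I * x)

/-- The point `r = (i/2)s` of the inverse different `𝓞^# = (i/2)ℤ[i]`. The map
`ℤ[i] → 𝓞^#`, `s ↦ (i/2)s`, is a bijection, and sums over `𝓞^#` are written as sums over `s`. -/
noncomputable def dualPt (s : GaussianInt) : ℂ := Complex.I / 2 * GaussianInt.toComplex s

/-- The parity `δ ∈ {+, -}` of a Hermitian Jacobi form. -/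
inductive Parity
  | plus
  | minus

/-- `σ(ε) = 1` for parity `+`, and `σ(ε) = ε²` for parity `-`. -/
noncomputable def Parity.sigma (δ : Parity) (ε : GaussianIntˣ) : ℂ :=
  match δ with
  | .plus => 1
  | .minus => (GaussianInt.toComplex ε) ^ 2

/-- `φ(τ, z₁, z₂) = ∑_{n ∈ ℤ, r ∈ 𝓞^#} c(n, r) qⁿ ζ₁^r ζ₂^{conj r}` (absolutely convergent) on
`ℍ × ℂ²`, where `r = dualPt s`. -/
def HasFourierExpansion (φ : ℍ → ℂ → ℂ → ℂ) (c : ℤ → GaussianInt → ℂ) : Prop :=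
  ∀ (τ : ℍ) (z₁ z₂ : ℂ),
    HasSum (fun x : ℤ × GaussianInt =>
        c x.1 x.2 * e (x.1 * (τ : ℂ) + dualPt x.2 * z₁ + conj (dualPt x.2) * z₂))
      (φ τ z₁ z₂)

/-- The Fourier coefficients of a function on `ℍ × ℂ²` are unique. -/
theorem HasFourierExpansion.unique {φ : ℍ → ℂ → ℂ → ℂ} {c c' : ℤ → GaussianInt → ℂ}
    (h : HasFourierExpansion φ c) (h' : HasFourierExpansion φ c') : c = c' := by
  let E : (Fin 3 → ℤ) ≃ ℤ × GaussianInt :=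
    { toFun := fun v => (v 0, ⟨v 1, v 2⟩)
      invFun := fun x => ![x.1, x.2.re, x.2.im]
      left_inv := fun v => by
        ext i
        fin_cases i <;> rfl
      right_inv := fun x => rfl }
  let D : (Fin 3 → ℤ) → ℂ := fun v =>
    (c (E v).1 (E v).2 - c' (E v).1 (E v).2) * e ((E v).1 * Complex.I)
  have key : ∀ u : Fin 3 → ℝ,
      HasSum (fun v => D v * UnitAddTorus.mFourier v (fun i => (u i : UnitAddCircle))) 0 := by
    intro u
    have him : 0 < ((u 0 : ℂ) + Complex.I).im := by simp
    have H := (h ⟨(u 0 : ℂ) + Complex.I, him⟩ (-u 2 - Complex.I * u 1) (-u 2 + Complex.I * u 1)).sub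
      (h' ⟨(u 0 : ℂ) + Complex.I, him⟩ (-u 2 - Complex.I * u 1) (-u 2 + Complex.I * u 1))
    rw [sub_self, ← E.hasSum_iff] at H
    refine Eq.mpr (congrArg (fun f => HasSum f (0 : ℂ)) (funext fun v => ?_)) H
    simp only [Function.comp, D, ← sub_mul]
    rw [mul_assoc]
    congr 1
    simp only [UnitAddTorus.mFourier, ContinuousMap.coe_mk, fourier_coe_apply, Fin.prod_univ_three,
      e, ← Complex.exp_add, E, dualPt, GaussianInt.toComplex_def, map_mul,
      map_div₀, map_add, Complex.conj_I, map_ofNat,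
      Complex.ofReal_one, div_one, map_intCast]
    congr 1
    linear_combination (Real.pi * Complex.I * ((v 1) * u 1 * 2 + (v 2) * u 2 * 2)) * Complex.I_sq
  have hnorm : Summable fun v => ‖D v‖ := by
    have := (key 0).summable.norm
    refine this.congr fun v => ?_
    simp [UnitAddTorus.mFourier]
  have hC : Summable fun v => D v • (UnitAddTorus.mFourier v : C(UnitAddTorus (Fin 3), ℂ)) := by
    refine Summable.of_norm ?_
    refine hnorm.congr fun v => ?_
    rw [norm_smul, UnitAddTorus.mFourier_norm, mul_one]
  obtain ⟨g, hg⟩ := hC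
  have hg0 : g = 0 := by
    ext y
    obtain ⟨u, rfl⟩ : ∃ u : Fin 3 → ℝ, y = fun i => (u i : UnitAddCircle) := by
      choose u hu using fun i => QuotientAddGroup.mk_surjective (y i)
      exact ⟨u, funext fun i => (hu i).symm⟩
    have h1 := hg.mapL (ContinuousMap.evalCLM ℂ (fun i => (u i : UnitAddCircle)))
    exact h1.unique (by simpa using key u)
  have hD : ∀ w, D w = 0 := by
    intro w
    let _ : MeasureTheory.MeasureSpace UnitAddCircle := ⟨AddCircle.haarAddCircle⟩
    have _ : MeasureTheory.IsProbabilityMeasure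
        (MeasureTheory.volume : MeasureTheory.Measure UnitAddCircle) :=
      inferInstanceAs (MeasureTheory.IsProbabilityMeasure AddCircle.haarAddCircle)
    have ho := UnitAddTorus.orthonormal_mFourier (d := Fin 3)
    rw [hg0] at hg
    have h1 := (hg.mapL (ContinuousMap.toLp (E := ℂ) 2 _ ℂ)).mapL
      (innerSL ℂ (UnitAddTorus.mFourierLp (d := Fin 3) 2 w))
    rw [map_zero, map_zero] at h1
    refine HasSum.unique ?_ h1
    refine Eq.mpr (congrArg (fun f => HasSum f (D w)) (funext fun v => ?_)) (hasSum_ite_eq w (D w))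
    rw [map_smul, map_smul, innerSL_apply_apply, orthonormal_iff_ite.mp ho w v]
    by_cases hvw : v = w
    · simp [hvw]
    · simp [hvw, Ne.symm hvw]
  funext n s
  have := hD (E.symm (n, s))
  simp only [D, Equiv.apply_symm_apply, e, mul_eq_zero, Complex.exp_ne_zero, or_false] at this
  exact sub_eq_zero.mp this

open Classical in
/-- The Fourier coefficient `c(φ; n, r)` with `r = dualPt s`, for `φ` that has a Fourier expansion
(and `0` otherwise). -/
noncomputable def coeff (φ : ℍ → ℂ → ℂ → ℂ) (n : ℤ) (s : GaussianInt) : ℂ :=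
  if h : ∃ c, HasFourierExpansion φ c then h.choose n s else 0

theorem HasFourierExpansion.coeff_eq {φ : ℍ → ℂ → ℂ → ℂ} {c : ℤ → GaussianInt → ℂ}
    (h : HasFourierExpansion φ c) : coeff φ = c := by
  have hex : ∃ c, HasFourierExpansion φ c := ⟨c, h⟩
  have h1 : coeff φ = hex.choose := by
    funext n s
    simp only [coeff, dif_pos hex]
  rw [h1]
  exact hex.choose_spec.unique h

/-- `φ` is a Hermitian Jacobi form for `Γ^J(𝓞)`, `𝓞 = ℤ[i]`, of weight `k`, index `m` and
parity `δ`. -/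
structure IsHermitianJacobiForm (k m : ℤ) (δ : Parity) (φ : ℍ → ℂ → ℂ → ℂ) : Prop where
  /-- `φ` is holomorphic on `ℍ × ℂ²`. -/
  holomorphic : DifferentiableOn ℂ
    (fun w : ℂ × ℂ × ℂ => φ (UpperHalfPlane.ofComplex w.1) w.2.1 w.2.2) {w | 0 < w.1.im}
  /-- Invariance under `εM`, for `M ∈ SL₂(ℤ)` and `ε ∈ 𝓞ˣ`. -/
  modular : ∀ (M : SL(2, ℤ)) (ε : GaussianIntˣ) (τ : ℍ) (z₁ z₂ : ℂ),
    δ.sigma ε * (GaussianInt.toComplex ε) ^ (-k) * ((M 1 0 : ℂ) * τ + M 1 1) ^ (-k)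
        * Complex.exp (-2 * Real.pi * Complex.I * m * (M 1 0 : ℂ) * z₁ * z₂
            / ((M 1 0 : ℂ) * τ + M 1 1))
        * φ (M • τ) (GaussianInt.toComplex ε * z₁ / ((M 1 0 : ℂ) * τ + M 1 1))
            (conj (GaussianInt.toComplex ε) * z₂ / ((M 1 0 : ℂ) * τ + M 1 1))
      = φ τ z₁ z₂
  /-- Invariance under `[λ, μ] ∈ 𝓞²`. -/
  elliptic : ∀ (l μ : GaussianInt) (τ : ℍ) (z₁ z₂ : ℂ),
    Complex.exp (2 * Real.pi * Complex.I * m *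
          (GaussianInt.toComplex l * conj (GaussianInt.toComplex l) * τ
            + conj (GaussianInt.toComplex l) * z₁ + GaussianInt.toComplex l * z₂))
        * φ τ (z₁ + GaussianInt.toComplex l * τ + GaussianInt.toComplex μ)
            (z₂ + conj (GaussianInt.toComplex l) * τ + conj (GaussianInt.toComplex μ))
      = φ τ z₁ z₂
  /-- The Fourier expansion runs over `n ≥ 0` and `r ∈ 𝓞^#` with `N(r) ≤ mn`. For `m > 0` the
  condition `n ≥ 0` follows from `N(r) ≤ mn`; for `m = 0` it is holomorphy at the cusp. -/
  fourier : ∃ c : ℤ → GaussianInt → ℂ, HasFourierExpansion φ c ∧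
    ∀ n s, c n s ≠ 0 → 0 ≤ n ∧ Complex.normSq (dualPt s) ≤ (m : ℝ) * n

/-- `x` is a `p`-integral rational number, that is, `x ∈ ℤ_(p)`. -/
def IsPIntegral (p : ℕ) (x : ℂ) : Prop :=
  ∃ a b : ℤ, ¬ (p : ℤ) ∣ b ∧ x = (a : ℂ) / b

/-- `φ ∈ HJ^δ_{k, m}(Γ^J(𝓞), ℤ_(p))`: all the Fourier coefficients of `φ` are `p`-integral. -/
structure IsPIntegralForm (p : ℕ) (k m : ℤ) (δ : Parity) (φ : ℍ → ℂ → ℂ → ℂ) : Prop where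
  isForm : IsHermitianJacobiForm k m δ φ
  integral : ∀ n s, IsPIntegral p (coeff φ n s)

/-- `φ ≡ ψ (mod p)`: all the differences `c(φ; n, r) - c(ψ; n, r)` lie in `pℤ_(p)`. -/
def ModEq (p : ℕ) (φ ψ : ℍ → ℂ → ℂ → ℂ) : Prop :=
  ∀ n s, ∃ y : ℂ, IsPIntegral p y ∧ coeff φ n s - coeff ψ n s = p * y

end HermitianJacobi

/-! The theorem of Serre and Swinnerton-Dyer, that congruences between elliptic modular forms are
graded by the weight modulo p - 1, is transferred to Hermitian Jacobi forms by restricting them to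
lines and expanding in powers of a theta block.

Elliptic forms. For p ≥ 5 the p-integral forms of level one are p-integral polynomials in E₄ and E₆,
so the relations modulo p form the kernel of F_p[Q, R] → F_p⟦q⟧. This prime ideal is not maximal,
and it contains A - 1, where A is the Hasse invariant, a polynomial of weight p - 1 that expresses
E_{p-1} ≡ 1. As the ring has dimension 2, one prime G generates the kernel. The scalings Q ↦ t⁴Q, R
↦ t⁶R with t ∈ F_pˣ fix A - 1. If G did not divide its scaling, both would contribute to A - 1, and
the square of the top-weight part of G would divide A. But A is squarefree, because of the
differential equation D²A = -QA (D is `serreD`). So the kernel is stable under scaling, and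
averaging over t splits a relation by weights modulo p - 1 (`EisensteinData.sum_filter_eq_zero`,
`sum_map_red_filter_eq_zero`).

One variable. On the line (2(B + i)z, 2(B - i)z) a form of weight k satisfies a law under τ ↦ -1/τ
with a Gaussian factor, which is removed by dividing by a power of a theta block N of weight 0. The
Taylor coefficients in z involve powers of 2πi and factorials, so the expansion is made in powers of
a theta block t of weight -1 and index 0 with a simple zero at z = 0: subtract the constant term,
which is an elliptic modular form, divide by t, which raises the weight by 1, and repeat
(`coeff_sum_redd_filter_eq_zero`). Integrality and reduction are read in u = exp(2πiz) - 1, the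
transformation law in z; `zExp` connects the two.

Recovery. For fixed n and large B the finitely many r with N(r) ≤ mn restrict to distinct exponents,
and distinct powers of 1 + u are linearly independent over F_p, so the splitting holds for each
Fourier coefficient. This is (2), and (2) applied to φ and -ψ gives the weights in (1). For the
indices in (1), translation by [N, 0] moves a coefficient that is nonzero modulo p along a parabola;
the support condition of ψ for large N yields m² ≤ m'm, and symmetry gives m = m' (`sq_index_le`).
-/

namespace HJCongruence

open scoped ModularForm Manifold
open HermitianJacobi (IsPIntegral)

/-! ### The ring ℤ_(p) inside ℂ and its residue map. -/

section PIntegral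

variable (p : ℕ) [hp : Fact p.Prime]

theorem not_dvd_mul_of_prime {p : ℕ} [hp : Fact p.Prime] {b b' : ℤ} (hb : ¬ (p : ℤ) ∣ b)
    (hb' : ¬ (p : ℤ) ∣ b') : ¬ (p : ℤ) ∣ b * b' := fun h =>
  ((Nat.prime_iff_prime_int.mp hp.out).dvd_or_dvd h).elim hb hb'

theorem not_dvd_one_of_prime {p : ℕ} [hp : Fact p.Prime] : ¬ (p : ℤ) ∣ 1 := fun h =>
  (Nat.prime_iff_prime_int.mp hp.out).not_isUnit (isUnit_of_dvd_one h)

theorem intCast_zmod_ne_zero {p : ℕ} {b : ℤ} (hb : ¬ (p : ℤ) ∣ b) : (b : ZMod p) ≠ 0 := by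
  rwa [Ne, ZMod.intCast_zmod_eq_zero_iff_dvd]

theorem intCast_complex_ne_zero {p : ℕ} {b : ℤ} (hb : ¬ (p : ℤ) ∣ b) : (b : ℂ) ≠ 0 := by
  rintro h; exact hb (by simp [Int.cast_eq_zero.mp h])

/-- The `p`-integral rational numbers `ℤ_(p)`, as a subring of `ℂ`. -/
def integers : Subring ℂ where
  carrier := {x | IsPIntegral p x}
  mul_mem' := by
    rintro _ _ ⟨a, b, hb, rfl⟩ ⟨a', b', hb', rfl⟩
    exact ⟨a * a', b * b', not_dvd_mul_of_prime hb hb', by push_cast; rw [div_mul_div_comm]⟩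
  one_mem' := ⟨1, 1, not_dvd_one_of_prime, by simp⟩
  add_mem' := by
    rintro _ _ ⟨a, b, hb, rfl⟩ ⟨a', b', hb', rfl⟩
    refine ⟨a * b' + b * a', b * b', not_dvd_mul_of_prime hb hb', ?_⟩
    push_cast
    rw [div_add_div _ _ (intCast_complex_ne_zero hb) (intCast_complex_ne_zero hb')]
  zero_mem' := ⟨0, 1, not_dvd_one_of_prime, by simp⟩
  neg_mem' := by
    rintro _ ⟨a, b, hb, rfl⟩
    exact ⟨-a, b, hb, by push_cast; rw [neg_div]⟩

variable {p}

theorem exists_fraction (x : integers p) :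
    ∃ a b : ℤ, ¬ (p : ℤ) ∣ b ∧ (x : ℂ) = (a : ℂ) / b := x.2

/-- The reduction of a `p`-integral number, computed from a chosen fraction. -/
noncomputable def redFun (x : integers p) : ZMod p :=
  ((exists_fraction x).choose : ZMod p) / ((exists_fraction x).choose_spec.choose : ZMod p)

theorem redFun_eq (x : integers p) {a b : ℤ} (hb : ¬ (p : ℤ) ∣ b) (h : (x : ℂ) = a / b) :
    redFun x = (a : ZMod p) / b := by
  obtain ⟨h1, h2⟩ := (exists_fraction x).choose_spec.choose_spec
  rw [redFun, div_eq_div_iff (intCast_zmod_ne_zero h1) (intCast_zmod_ne_zero hb)]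
  have h2 := h.symm.trans h2
  rw [div_eq_div_iff (intCast_complex_ne_zero hb) (intCast_complex_ne_zero h1)] at h2
  have h3 : a * (exists_fraction x).choose_spec.choose = (exists_fraction x).choose * b := by
    exact_mod_cast h2
  simpa using (congrArg (Int.cast : ℤ → ZMod p) h3).symm

variable (p) in
/-- The reduction `ℤ_(p) → 𝔽_p`. -/
noncomputable def red : integers p →+* ZMod p where
  toFun := redFun
  map_one' := by
    rw [redFun_eq (a := 1) (b := 1) 1 not_dvd_one_of_prime (by simp)]
    simp
  map_zero' := by
    rw [redFun_eq (a := 0) (b := 1) 0 not_dvd_one_of_prime (by simp)]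
    simp
  map_mul' := by
    intro x y
    obtain ⟨a, b, hb, hx⟩ := exists_fraction x
    obtain ⟨a', b', hb', hy⟩ := exists_fraction y
    rw [redFun_eq (a := a) _ hb hx, redFun_eq (a := a') _ hb' hy,
      redFun_eq (a := a * a') _ (not_dvd_mul_of_prime hb hb') (by
        push_cast
        rw [hx, hy, div_mul_div_comm])]
    push_cast
    rw [div_mul_div_comm]
  map_add' := by
    intro x y
    obtain ⟨a, b, hb, hx⟩ := exists_fraction x
    obtain ⟨a', b', hb', hy⟩ := exists_fraction y
    rw [redFun_eq (a := a) _ hb hx, redFun_eq (a := a') _ hb' hy,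
      redFun_eq (a := a * b' + b * a') _ (not_dvd_mul_of_prime hb hb') (by
        push_cast
        rw [hx, hy, div_add_div _ _ (intCast_complex_ne_zero hb) (intCast_complex_ne_zero hb')])]
    push_cast
    rw [div_add_div _ _ (intCast_zmod_ne_zero hb) (intCast_zmod_ne_zero hb')]

theorem red_apply (x : integers p) {a b : ℤ} (hb : ¬ (p : ℤ) ∣ b) (h : (x : ℂ) = a / b) :
    red p x = (a : ZMod p) / b := redFun_eq x hb h

theorem red_eq_zero_iff (x : integers p) :
    red p x = 0 ↔ ∃ y : ℂ, IsPIntegral p y ∧ (x : ℂ) = p * y := by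
  obtain ⟨a, b, hb, hx⟩ := exists_fraction x
  rw [red_apply _ hb hx, div_eq_zero_iff, or_iff_left (intCast_zmod_ne_zero hb),
    ZMod.intCast_zmod_eq_zero_iff_dvd]
  constructor
  · rintro ⟨c, rfl⟩
    exact ⟨c / b, ⟨c, b, hb, rfl⟩, by rw [hx]; push_cast; rw [mul_div_assoc]⟩
  · rintro ⟨y, ⟨a', b', hb', rfl⟩, h⟩
    have e1 := intCast_complex_ne_zero hb
    have e2 := intCast_complex_ne_zero hb'
    simp only [hx, ← mul_div_assoc] at h
    rw [div_eq_div_iff e1 e2] at h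
    have h3 : a * b' = p * a' * b := by exact_mod_cast h
    refine ((Nat.prime_iff_prime_int.mp hp.out).dvd_or_dvd (b := b') ⟨a' * b, ?_⟩).resolve_right hb'
    rw [h3, mul_assoc]

theorem isUnit_integers_intCast {b : ℤ} (hb : ¬ (p : ℤ) ∣ b) : IsUnit (b : integers p) := by
  refine IsUnit.of_mul_eq_one ⟨(1 : ℤ) / b, 1, b, hb, rfl⟩ (Subtype.ext ?_)
  have := intCast_complex_ne_zero hb
  push_cast
  field_simp

end PIntegral

/-! ### Convergent q-series as functions on the upper half-plane. -/

section Convergent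

open PowerSeries UpperHalfPlane Function

/-- The power series that converge absolutely in the open unit disc. -/
def Conv : Subring ℂ⟦X⟧ where
  carrier := {f | ∀ r : ℝ, 0 ≤ r → r < 1 → Summable fun n => ‖coeff n f‖ * r ^ n}
  mul_mem' := by
    intro f g hf hg r h0 h1
    have e : ∀ h : ℂ⟦X⟧, (fun n => ‖coeff n h‖ * r ^ n) = fun n => ‖coeff n h * (r : ℂ) ^ n‖ := by
      intro h; ext n; simp [abs_of_nonneg h0]
    have hf' := hf r h0 h1
    have hg' := hg r h0 h1
    rw [e] at hf' hg' ⊢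
    refine (summable_norm_sum_mul_antidiagonal_of_summable_norm hf' hg').congr fun n => ?_
    rw [coeff_mul, Finset.sum_mul]
    congr 1
    refine Finset.sum_congr rfl fun x hx => ?_
    rw [← Finset.HasAntidiagonal.mem_antidiagonal.mp hx, pow_add]
    ring
  one_mem' := by
    intro r _ _
    refine summable_of_ne_finset_zero (s := {0}) fun n hn => ?_
    simp only [Finset.mem_singleton] at hn
    simp [coeff_one, hn]
  add_mem' := by
    intro f g hf hg r h0 h1
    refine Summable.of_nonneg_of_le (fun n => by positivity) (fun n => ?_)
      ((hf r h0 h1).add (hg r h0 h1))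
    rw [← add_mul, map_add]
    gcongr
    exact norm_add_le _ _
  zero_mem' := by
    intro r _ _
    simp
  neg_mem' := by
    intro f hf r h0 h1
    simpa using hf r h0 h1

/-- The sum of a power series at a point. -/
noncomputable def discSum (f : ℂ⟦X⟧) (q : ℂ) : ℂ := ∑' n, coeff n f * q ^ n

theorem summable_norm_discSum {f : ℂ⟦X⟧} (hf : f ∈ Conv) {q : ℂ} (hq : ‖q‖ < 1) :
    Summable fun n => ‖coeff n f * q ^ n‖ := by
  simpa using hf ‖q‖ (norm_nonneg q) hq

theorem hasSum_discSum {f : ℂ⟦X⟧} (hf : f ∈ Conv) {q : ℂ} (hq : ‖q‖ < 1) :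
    HasSum (fun n => coeff n f * q ^ n) (discSum f q) :=
  (summable_norm_discSum hf hq).of_norm.hasSum

theorem norm_qParam_lt_one (τ : ℍ) : ‖Periodic.qParam 1 (τ : ℂ)‖ < 1 :=
  Periodic.norm_qParam_lt_one one_pos τ.im_pos

theorem exists_qParam_eq {q : ℂ} (h0 : q ≠ 0) (h1 : ‖q‖ < 1) :
    ∃ τ : ℍ, Periodic.qParam 1 (τ : ℂ) = q :=
  ⟨⟨Periodic.invQParam 1 q, Periodic.im_invQParam_pos_of_norm_lt_one one_pos h1 h0⟩,
    Periodic.qParam_right_inv one_ne_zero h0⟩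

theorem mem_conv_of_summable {f : ℂ⟦X⟧}
    (h : ∀ τ : ℍ, Summable fun n => coeff n f * Periodic.qParam 1 (τ : ℂ) ^ n) : f ∈ Conv := by
  intro r h0 h1
  rcases h0.eq_or_lt with rfl | h0
  · refine summable_of_ne_finset_zero (s := {0}) fun n hn => ?_
    simp only [Finset.mem_singleton] at hn
    simp [hn]
  · obtain ⟨τ, hτ⟩ := exists_qParam_eq (q := (r : ℂ)) (by exact_mod_cast h0.ne')
      (by simpa [abs_of_pos h0] using h1)
    have := (h τ).norm
    rw [hτ] at this
    simpa [abs_of_pos h0] using this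

theorem hasFPowerSeriesOnBall_discSum {f : ℂ⟦X⟧} (hf : f ∈ Conv) :
    HasFPowerSeriesOnBall (discSum f) (.ofScalars ℂ fun n => coeff n f) 0 1 := by
  constructor
  · refine le_of_forall_lt_imp_le_of_dense fun r hr ↦ ?_
    lift r to NNReal using hr.ne_top
    apply FormalMultilinearSeries.le_radius_of_summable
    simpa using hf r r.2 (by exact_mod_cast hr)
  · simp
  · intro y hy
    rw [← ENNReal.coe_one, Metric.eball_coe, NNReal.coe_one, mem_ball_zero_iff] at hy
    simpa [mul_comm] using hasSum_discSum hf hy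

theorem differentiableOn_discSum {f : ℂ⟦X⟧} (hf : f ∈ Conv) :
    DifferentiableOn ℂ (discSum f) (Metric.ball 0 1) := by
  have := (hasFPowerSeriesOnBall_discSum hf).differentiableOn
  rwa [← ENNReal.coe_one, Metric.eball_coe, NNReal.coe_one] at this

/-- The nome of a point of ℍ is never 0, so values are only compared off 0; continuity supplies q =
0. -/
theorem conv_ext {f g : ℂ⟦X⟧} (hf : f ∈ Conv) (hg : g ∈ Conv)
    (h : ∀ q : ℂ, ‖q‖ < 1 → q ≠ 0 → discSum f q = discSum g q) : f = g := by
  have h1 := (hasFPowerSeriesOnBall_discSum hf).hasFPowerSeriesAt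
  have h2 := (hasFPowerSeriesOnBall_discSum hg).hasFPowerSeriesAt
  have h3 : discSum f =ᶠ[nhds 0] discSum g := by
    refine (h1.continuousAt.eventuallyEq_nhds_iff_eventuallyEq_nhdsNE h2.continuousAt).mp ?_
    filter_upwards [self_mem_nhdsWithin,
      mem_nhdsWithin_of_mem_nhds (Metric.ball_mem_nhds (0 : ℂ) one_pos)] with q hq hq'
    exact h q (by simpa using hq') hq
  have h4 := (h1.congr h3).eq_formalMultilinearSeries h2
  ext n
  simpa using congr_arg (FormalMultilinearSeries.coeff · n) h4

theorem exists_conv_of_differentiableOn {F : ℂ → ℂ} (hF : DifferentiableOn ℂ F (Metric.ball 0 1)) :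
    ∃ f ∈ Conv, ∀ q : ℂ, ‖q‖ < 1 → discSum f q = F q := by
  let f : ℂ⟦X⟧ := PowerSeries.mk fun n => (n.factorial : ℂ)⁻¹ * iteratedDeriv n F 0
  have h : ∀ q : ℂ, ‖q‖ < 1 → HasSum (fun n => coeff n f * q ^ n) (F q) := by
    intro q hq
    have := Complex.hasSum_taylorSeries_on_ball hF (z := q) (by simpa using hq)
    refine this.congr_fun fun n => ?_
    simp only [f, coeff_mk, smul_eq_mul, sub_zero]
    ring
  exact ⟨f, mem_conv_of_summable fun τ => (h _ (norm_qParam_lt_one τ)).summable,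
    fun q hq => (h q hq).tsum_eq⟩

/-- Evaluation of a convergent `q`-series at a point of the upper half-plane. -/
noncomputable def ev (τ : ℍ) : Conv →+* ℂ where
  toFun f := discSum f (Periodic.qParam 1 (τ : ℂ))
  map_one' := by
    rw [discSum, tsum_eq_single 0]
    · simp
    · intro n hn
      simp [coeff_one, hn]
  map_zero' := by simp [discSum]
  map_mul' f g := by
    have h := norm_qParam_lt_one τ
    rw [discSum, discSum, discSum, tsum_mul_tsum_eq_tsum_sum_antidiagonal_of_summable_norm
      (summable_norm_discSum f.2 h) (summable_norm_discSum g.2 h)]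
    refine tsum_congr fun n => ?_
    rw [Subring.coe_mul, coeff_mul, Finset.sum_mul]
    refine Finset.sum_congr rfl fun x hx => ?_
    rw [← Finset.HasAntidiagonal.mem_antidiagonal.mp hx, pow_add]
    ring
  map_add' f g := by
    have h := norm_qParam_lt_one τ
    rw [← ((hasSum_discSum f.2 h).add (hasSum_discSum g.2 h)).tsum_eq]
    simp [discSum, add_mul]

theorem ev_apply (τ : ℍ) (f : Conv) : ev τ f = discSum f (Periodic.qParam 1 (τ : ℂ)) := rfl

theorem hasSum_ev (τ : ℍ) (f : Conv) :
    HasSum (fun n => coeff n (f : ℂ⟦X⟧) * Periodic.qParam 1 (τ : ℂ) ^ n) (ev τ f) :=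
  hasSum_discSum f.2 (norm_qParam_lt_one τ)

theorem ev_injective {f g : Conv} (h : ∀ τ, ev τ f = ev τ g) : f = g := by
  refine Subtype.ext (conv_ext f.2 g.2 fun q hq h0 => ?_)
  obtain ⟨τ, rfl⟩ := exists_qParam_eq h0 hq
  exact h τ

/-- The reciprocal is holomorphic on the whole disc, the cusp q = 0 included, so its Taylor series
converges there. -/
theorem isUnit_conv {f : Conv} (h0 : coeff 0 (f : ℂ⟦X⟧) ≠ 0) (h : ∀ τ, ev τ f ≠ 0) :
    IsUnit f := by
  have hne : ∀ q : ℂ, ‖q‖ < 1 → discSum f q ≠ 0 := by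
    intro q hq
    by_cases h1 : q = 0
    · subst h1
      rw [discSum, tsum_eq_single 0]
      · simpa using h0
      · intro n hn
        simp [hn]
    · obtain ⟨τ, rfl⟩ := exists_qParam_eq h1 hq
      exact h τ
  obtain ⟨g, hg, hg'⟩ := exists_conv_of_differentiableOn
    ((differentiableOn_discSum f.2).inv fun q hq => hne q (by simpa using hq))
  refine IsUnit.of_mul_eq_one ⟨g, hg⟩ (ev_injective fun τ => ?_)
  rw [map_mul, map_one, ev_apply, ev_apply, hg' _ (norm_qParam_lt_one τ)]
  exact mul_inv_cancel₀ (h τ)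

theorem coe_S_smul (τ : ℍ) : ((ModularGroup.S • τ : ℍ) : ℂ) = -1 / (τ : ℂ) := by
  rw [UpperHalfPlane.modular_S_smul]
  rw [UpperHalfPlane.coe_mk, inv_neg, neg_div, one_div]

theorem qParam_T_smul (τ : ℍ) :
    Periodic.qParam 1 ((ModularGroup.T • τ : ℍ) : ℂ) = Periodic.qParam 1 (τ : ℂ) := by
  rw [UpperHalfPlane.modular_T_smul]
  rw [UpperHalfPlane.coe_vadd]
  simp [Periodic.qParam, mul_add, Complex.exp_add]

/-- A convergent `q`-series with the transformation law of weight `k` under `τ ↦ -1/τ` is the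
`q`-expansion of a modular form of level one. -/
theorem exists_modularForm {f : Conv} {k : ℤ}
    (hS : ∀ τ : ℍ, ev (ModularGroup.S • τ) f = (τ : ℂ) ^ k * ev τ f) :
    ∃ F : ModularForm 𝒮ℒ k, (∀ τ, F τ = ev τ f) ∧ qExpansion 1 F = (f : ℂ⟦X⟧) := by
  let F : ℍ → ℂ := fun τ => ev τ f
  -- S and T generate, and invariance under T is built into a series in q.
  have hsl : ∀ γ : SL(2, ℤ), F ∣[k] γ = F := by
    refine SlashInvariantForm.slash_action_generators_SL2Z ?_ ?_
    · ext τ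
      rw [ModularForm.SL_slash_apply, ModularGroup.denom_S]
      simp only [F, hS]
      have : (τ : ℂ) ^ k ≠ 0 := zpow_ne_zero _ (UpperHalfPlane.ne_zero τ)
      rw [zpow_neg]
      field_simp
    · ext τ
      rw [ModularForm.SL_slash_apply]
      have h1 : F (ModularGroup.T • τ) = F τ := congrArg (discSum f) (qParam_T_smul τ)
      have h2 : denom (ModularGroup.T : GL (Fin 2) ℝ) τ = 1 := by
        rw [denom, Matrix.SpecialLinearGroup.coe_GL_coe_matrix]
        simp [ModularGroup.coe_T]
      rw [h1, h2, one_zpow, mul_one]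
  have hsum : ∀ τ : ℍ, HasSum (fun n => coeff n (f : ℂ⟦X⟧) • Periodic.qParam 1 (τ : ℂ) ^ n) (F τ) :=
    fun τ => hasSum_ev τ f
  have hhol : MDiff F := by
    rw [UpperHalfPlane.mdifferentiable_iff]
    have : DifferentiableOn ℂ (discSum f ∘ Periodic.qParam 1) {z : ℂ | 0 < z.im} := by
      refine (differentiableOn_discSum f.2).comp
        (Periodic.differentiable_qParam (h := 1)).differentiableOn fun z hz => ?_
      simpa using Periodic.norm_qParam_lt_one one_pos hz
    refine this.congr fun z hz => ?_
    simp only [F, Function.comp, ev_apply, UpperHalfPlane.ofComplex_apply_of_im_pos hz]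
  have hbdd := isBoundedAtImInfty_of_hasSum_qExpansion one_pos hsum
  let G : ModularForm 𝒮ℒ k :=
    { toFun := F
      slash_action_eq' := fun _ ⟨γ, hγ⟩ => hγ ▸ hsl γ
      holo' := hhol
      bdd_at_cusps' {c} hc := by
        rw [Subgroup.IsArithmetic.isCusp_iff_isCusp_SL2Z] at hc
        rw [OnePoint.isBoundedAt_iff_forall_SL2Z hc]
        intro γ _
        rw [hsl γ]
        exact hbdd }
  refine ⟨G, fun _ => rfl, ?_⟩
  ext n
  exact (ModularFormClass.qExpansion_coeff_unique one_pos one_mem_strictPeriods_SL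
    (f := G) hsum n).symm

theorem qExpansion_mem_conv {k : ℤ} (F : ModularForm 𝒮ℒ k) : qExpansion 1 F ∈ Conv :=
  mem_conv_of_summable fun τ =>
    (ModularForm.hasSum_qExpansion F one_pos one_mem_strictPeriods_SL τ).summable

theorem ev_qExpansion {k : ℤ} (F : ModularForm 𝒮ℒ k) (τ : ℍ) :
    ev τ ⟨qExpansion 1 F, qExpansion_mem_conv F⟩ = F τ :=
  (ModularForm.hasSum_qExpansion F one_pos one_mem_strictPeriods_SL τ).tsum_eq

theorem modularForm_S_smul {k : ℤ} (F : ModularForm 𝒮ℒ k) (τ : ℍ) :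
    F (ModularGroup.S • τ) = (τ : ℂ) ^ k * F τ := by
  have h : (F : ℍ → ℂ) ∣[k] ModularGroup.S = F :=
    SlashInvariantForm.slash_action_eqn F _ ⟨ModularGroup.S, rfl⟩
  have h1 := congrFun h τ
  rw [ModularForm.SL_slash_apply, ModularGroup.denom_S] at h1
  have : (τ : ℂ) ^ k ≠ 0 := zpow_ne_zero _ (UpperHalfPlane.ne_zero τ)
  rw [← h1, zpow_neg]
  field_simp

end Convergent

/-! ### Weighted polynomials in Q and R, with the Serre and Euler derivations. -/

section Grading

open MvPolynomial

variable {F : Type*} [Field F]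

/-- The grading of `F[Q, R]` with `Q` in degree `4` and `R` in degree `6`, as the map
`P(Q, R) ↦ P(Q T⁴, R T⁶)`. -/
noncomputable def grade : MvPolynomial (Fin 2) F →ₐ[F] Polynomial (MvPolynomial (Fin 2) F) :=
  aeval ![Polynomial.C (X 0) * Polynomial.X ^ 4, Polynomial.C (X 1) * Polynomial.X ^ 6]

/-- Weighted homogeneity of degree `n`. -/
def IsHomog (n : ℕ) (P : MvPolynomial (Fin 2) F) : Prop :=
  grade P = Polynomial.C P * Polynomial.X ^ n

@[simp] theorem grade_X0 : grade (X 0 : MvPolynomial (Fin 2) F) =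
    Polynomial.C (X 0) * Polynomial.X ^ 4 := by simp [grade]

@[simp] theorem grade_X1 : grade (X 1 : MvPolynomial (Fin 2) F) =
    Polynomial.C (X 1) * Polynomial.X ^ 6 := by simp [grade]

@[simp] theorem grade_C (a : F) : grade (C a : MvPolynomial (Fin 2) F) =
    Polynomial.C (C a) := by
  simp [grade, algHom_C]

theorem isHomog_X0 : IsHomog 4 (X 0 : MvPolynomial (Fin 2) F) := grade_X0

theorem isHomog_X1 : IsHomog 6 (X 1 : MvPolynomial (Fin 2) F) := grade_X1

theorem isHomog_C (a : F) : IsHomog 0 (C a : MvPolynomial (Fin 2) F) := by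
  simp [IsHomog]

theorem isHomog_zero (n : ℕ) : IsHomog n (0 : MvPolynomial (Fin 2) F) := by
  simp [IsHomog]

variable {m n : ℕ} {P P' : MvPolynomial (Fin 2) F}

theorem IsHomog.mul (h : IsHomog m P) (h' : IsHomog n P') : IsHomog (m + n) (P * P') := by
  rw [IsHomog, map_mul, h, h', map_mul]; ring

theorem IsHomog.add (h : IsHomog n P) (h' : IsHomog n P') : IsHomog n (P + P') := by
  rw [IsHomog, map_add, h, h', map_add]; ring

theorem IsHomog.pow (h : IsHomog m P) (i : ℕ) : IsHomog (i * m) (P ^ i) := by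
  rw [IsHomog, map_pow, h, map_pow]; ring

theorem IsHomog.C_mul (h : IsHomog m P) (a : F) : IsHomog m (C a * P) := by
  simpa using (isHomog_C a).mul h

theorem eval_one_grade (P : MvPolynomial (Fin 2) F) : (grade P).eval 1 = P := by
  have : (((Polynomial.aeval (1 : MvPolynomial (Fin 2) F)).restrictScalars F).comp grade) =
      AlgHom.id F (MvPolynomial (Fin 2) F) := by
    ext i : 1
    fin_cases i <;> simp
  simpa [Polynomial.aeval_def] using DFunLike.congr_fun this P

theorem eval_zero_grade (P : MvPolynomial (Fin 2) F) :
    (grade P).eval 0 = C (constantCoeff P) := by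
  induction P using MvPolynomial.induction_on with
  | C a => simp
  | add p q hp hq => simp [hp, hq]
  | mul_X p i hp =>
    fin_cases i <;> simp

theorem map_constantCoeff_grade (P : MvPolynomial (Fin 2) F) :
    (grade P).map constantCoeff = Polynomial.C (constantCoeff P) := by
  induction P using MvPolynomial.induction_on with
  | C a => simp
  | add p q hp hq => simp [hp, hq]
  | mul_X p i hp =>
    fin_cases i <;> simp

theorem grade_ne_zero (h : P ≠ 0) : grade P ≠ 0 := fun h' => h <| by
  rw [← eval_one_grade P, h', Polynomial.eval_zero]

theorem IsHomog.of_grade_eq {Q : MvPolynomial (Fin 2) F}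
    (h : grade P = Polynomial.C Q * Polynomial.X ^ n) : IsHomog n P := by
  have h1 := eval_one_grade P
  rw [h] at h1
  simp only [Polynomial.eval_mul, Polynomial.eval_C, Polynomial.eval_pow, Polynomial.eval_X,
    one_pow, mul_one] at h1
  rw [IsHomog, h, h1]

/-- Factors of homogeneous polynomials are homogeneous. -/
theorem IsHomog.exists_of_dvd (h : IsHomog n P) (hP : P ≠ 0) (hd : P' ∣ P) :
    ∃ m ≤ n, IsHomog m P' := by
  obtain ⟨W, rfl⟩ := hd
  have h1 : P' ≠ 0 := left_ne_zero_of_mul hP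
  have h2 : W ≠ 0 := right_ne_zero_of_mul hP
  have hg : grade P' * grade W = Polynomial.C (P' * W) * Polynomial.X ^ n := by
    rw [← map_mul]; exact h
  -- Degree and trailing degree in T are additive over a domain; they agree on the product, hence on
  -- each factor.
  have e1 := Polynomial.natDegree_mul (grade_ne_zero h1) (grade_ne_zero h2)
  have e2 := Polynomial.natTrailingDegree_mul (grade_ne_zero h1) (grade_ne_zero h2)
  rw [hg, Polynomial.natDegree_C_mul_X_pow _ _ hP] at e1
  rw [hg, Polynomial.C_mul_X_pow_eq_monomial, Polynomial.natTrailingDegree_monomial hP] at e2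
  have e3 := Polynomial.natTrailingDegree_le_natDegree (grade P')
  have e4 := Polynomial.natTrailingDegree_le_natDegree (grade W)
  have e5 : (grade P').natTrailingDegree = (grade P').natDegree := by omega
  refine ⟨(grade P').natDegree, by omega, ?_⟩
  refine IsHomog.of_grade_eq (Q := (grade P').coeff (grade P').natDegree) ?_
  ext1 i
  rw [Polynomial.coeff_C_mul_X_pow]
  split_ifs with hi
  · rw [hi]
  · rcases lt_or_gt_of_ne hi with hi | hi
    · exact Polynomial.coeff_eq_zero_of_lt_natTrailingDegree (by omega)
    · exact Polynomial.coeff_eq_zero_of_natDegree_lt hi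

theorem IsHomog.constantCoeff_eq_zero (h : IsHomog n P) (hn : n ≠ 0) : constantCoeff P = 0 := by
  have := eval_zero_grade P
  rw [h] at this
  simpa [hn, eq_comm (a := (0 : MvPolynomial (Fin 2) F))] using this

theorem IsHomog.eq_C (h : IsHomog 0 P) : P = C (constantCoeff P) := by
  have := eval_zero_grade P
  rw [h] at this
  simpa using this

theorem grade_coeff_two (P : MvPolynomial (Fin 2) F) : (grade P).coeff 2 = 0 := by
  induction P using MvPolynomial.induction_on with
  | C a => simp
  | add p q hp hq => simp [hp, hq]
  | mul_X p i hp =>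
    fin_cases i
    · simp [← mul_assoc, Polynomial.coeff_mul_X_pow']
    · simp [← mul_assoc, Polynomial.coeff_mul_X_pow']

theorem IsHomog.eq_zero_of_two (h : IsHomog 2 P) : P = 0 := by
  have := grade_coeff_two P
  rw [h] at this
  simpa using this

/-- The derivation `12∂` of `F[Q, R]`, where `∂` is the Serre derivative. -/
noncomputable def serreD : Derivation F (MvPolynomial (Fin 2) F) (MvPolynomial (Fin 2) F) :=
  mkDerivation F ![-4 * X 1, -6 * X 0 ^ 2]

/-- The Euler derivation of `F[Q, R]`. -/
noncomputable def euler : Derivation F (MvPolynomial (Fin 2) F) (MvPolynomial (Fin 2) F) :=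
  mkDerivation F ![4 * X 0, 6 * X 1]

theorem serreD_eq (P : MvPolynomial (Fin 2) F) :
    serreD P = -4 * X 1 * pderiv 0 P - 6 * X 0 ^ 2 * pderiv 1 P := by
  have : serreD (F := F) = (-4 * X 1 : MvPolynomial (Fin 2) F) • pderiv 0
      - (6 * X 0 ^ 2 : MvPolynomial (Fin 2) F) • pderiv 1 := by
    refine MvPolynomial.derivation_ext fun i => ?_
    fin_cases i <;> simp [serreD, mkDerivation_X, pderiv_X]
  rw [this]; simp

theorem euler_eq (P : MvPolynomial (Fin 2) F) :
    euler P = 4 * X 0 * pderiv 0 P + 6 * X 1 * pderiv 1 P := by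
  have : euler (F := F) = (4 * X 0 : MvPolynomial (Fin 2) F) • pderiv 0
      + (6 * X 1 : MvPolynomial (Fin 2) F) • pderiv 1 := by
    refine MvPolynomial.derivation_ext fun i => ?_
    fin_cases i <;> simp [euler, mkDerivation_X, pderiv_X]
  rw [this]; simp

/-- In the grading variable the Euler derivation is T d/dT. -/
theorem X_mul_derivative_grade (P : MvPolynomial (Fin 2) F) :
    Polynomial.X * Polynomial.derivative (grade P) = grade (euler P) := by
  induction P using MvPolynomial.induction_on with
  | C a => simp
  | add p q hp hq => simp [hp, hq, mul_add]
  | mul_X p i hp =>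
    have h4 : grade (4 : MvPolynomial (Fin 2) F) = 4 := map_ofNat _ _
    have h6 : grade (6 : MvPolynomial (Fin 2) F) = 6 := map_ofNat _ _
    have c4 : (Polynomial.C 4 : Polynomial (MvPolynomial (Fin 2) F)) = 4 := map_ofNat _ _
    have c6 : (Polynomial.C 6 : Polynomial (MvPolynomial (Fin 2) F)) = 6 := map_ofNat _ _
    fin_cases i
    · simp only [Fin.zero_eta, map_mul, Polynomial.derivative_mul, Derivation.leibniz, map_add,
        smul_eq_mul, grade_X0, ← hp, Polynomial.derivative_C, Polynomial.derivative_X_pow]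
      simp [euler, mkDerivation_X, h4, c4]
      ring
    · simp only [Fin.mk_one, map_mul, Polynomial.derivative_mul, Derivation.leibniz, map_add,
        smul_eq_mul, grade_X1, ← hp, Polynomial.derivative_C, Polynomial.derivative_X_pow]
      simp [euler, mkDerivation_X, h6, c6]
      ring

theorem IsHomog.euler_eq (h : IsHomog n P) : euler P = n * P := by
  have h1 := X_mul_derivative_grade P
  have h2 := congrArg (Polynomial.eval 1) h1
  rw [eval_one_grade, h] at h2
  rw [← h2]
  simp [Polynomial.derivative_X_pow]
  ring

theorem grade_coeff_one (P : MvPolynomial (Fin 2) F) : (grade P).coeff 1 = 0 := by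
  induction P using MvPolynomial.induction_on with
  | C a => simp
  | add p q hp hq => simp [hp, hq]
  | mul_X p i hp =>
    fin_cases i
    · simp [← mul_assoc, Polynomial.coeff_mul_X_pow']
    · simp [← mul_assoc, Polynomial.coeff_mul_X_pow']

theorem grade_serreD_coeff_zero (P : MvPolynomial (Fin 2) F) :
    (grade (serreD P)).coeff 0 = 0 := by
  rw [Polynomial.coeff_zero_eq_eval_zero, eval_zero_grade, serreD_eq]
  simp

theorem serreD_X0 : serreD (X 0 : MvPolynomial (Fin 2) F) = -4 * X 1 := by
  simp [serreD, mkDerivation_X]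

theorem serreD_X1 : serreD (X 1 : MvPolynomial (Fin 2) F) = -6 * X 0 ^ 2 := by
  simp [serreD, mkDerivation_X]

theorem coeff_mul_C_mul_X_pow (f : Polynomial (MvPolynomial (Fin 2) F)) (a : MvPolynomial (Fin 2) F)
    (k j : ℕ) : (f * (Polynomial.C a * Polynomial.X ^ k)).coeff j =
      if k ≤ j then f.coeff (j - k) * a else 0 := by
  rw [← mul_assoc, Polynomial.coeff_mul_X_pow']
  simp only [Polynomial.coeff_mul_C]

theorem grade_serreD_coeff_mul {p Y : MvPolynomial (Fin 2) F} {d : ℕ} (hY : IsHomog d Y)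
    (hZ : IsHomog (d + 2) (serreD Y))
    (hp : ∀ i, (grade (serreD p)).coeff (i + 2) = serreD ((grade p).coeff i)) (i : ℕ) :
    (grade (serreD (p * Y))).coeff (i + 2) = serreD ((grade (p * Y)).coeff i) := by
  rw [Derivation.leibniz, smul_eq_mul, smul_eq_mul, map_add, map_mul, map_mul, mul_comm (grade Y),
    map_mul, hZ, hY, Polynomial.coeff_add, coeff_mul_C_mul_X_pow, coeff_mul_C_mul_X_pow,
    coeff_mul_C_mul_X_pow]
  by_cases hi : d ≤ i
  · rw [if_pos (by omega), if_pos (by omega), if_pos hi, Derivation.leibniz, smul_eq_mul,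
      smul_eq_mul, show i + 2 - (d + 2) = i - d by omega, show i + 2 - d = (i - d) + 2 by omega, hp,
      mul_comm Y]
  · rw [if_neg (by omega), if_neg hi, map_zero, zero_add]
    split_ifs with h
    · obtain h0 | h0 : i + 2 - d = 0 ∨ i + 2 - d = 1 := by omega
      · rw [h0, grade_serreD_coeff_zero, zero_mul]
      · rw [h0, grade_coeff_one, zero_mul]
    · rfl

/-- The derivation raises the weight by 2 on both generators. Phrasing this through the coefficients
of `grade` permits induction over inhomogeneous polynomials. -/
theorem grade_serreD_coeff (P : MvPolynomial (Fin 2) F) (i : ℕ) :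
    (grade (serreD P)).coeff (i + 2) = serreD ((grade P).coeff i) := by
  induction P using MvPolynomial.induction_on generalizing i with
  | C a =>
    have h1 : serreD (C a : MvPolynomial (Fin 2) F) = 0 := by
      rw [← algebraMap_eq]; exact Derivation.map_algebraMap _ _
    rw [grade_C, h1, Polynomial.coeff_C]
    split_ifs <;> simp [h1]
  | add p q hp hq => simp [hp, hq]
  | mul_X p j hp =>
    fin_cases j
    · refine grade_serreD_coeff_mul isHomog_X0 ?_ hp i
      rw [serreD_X0]
      have e : (C (-4 : F) : MvPolynomial (Fin 2) F) = -4 := by rw [map_neg, map_ofNat]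
      simpa only [e] using isHomog_X1.C_mul (-4 : F)
    · refine grade_serreD_coeff_mul isHomog_X1 ?_ hp i
      rw [serreD_X1]
      have e : (C (-6 : F) : MvPolynomial (Fin 2) F) = -6 := by rw [map_neg, map_ofNat]
      simpa only [e] using (isHomog_X0.pow 2).C_mul (-6 : F)

theorem IsHomog.serreD (h : IsHomog n P) : IsHomog (n + 2) (serreD P) := by
  refine IsHomog.of_grade_eq (Q := HJCongruence.serreD P) ?_
  ext1 i
  match i with
  | 0 => rw [grade_serreD_coeff_zero]; simp
  | 1 => rw [grade_coeff_one]; simp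
  | i + 2 =>
    rw [grade_serreD_coeff, h, Polynomial.coeff_C_mul_X_pow, Polynomial.coeff_C_mul_X_pow]
    by_cases hi : i = n
    · simp [hi]
    · simp [hi]

/-- The automorphism `Q ↦ t⁴Q, R ↦ t⁶R`. -/
noncomputable def scale (t : F) : MvPolynomial (Fin 2) F →+* MvPolynomial (Fin 2) F :=
  (Polynomial.evalRingHom (C t)).comp (grade (F := F)).toRingHom

theorem scale_apply (t : F) : scale t P = (grade P).eval (C t) := rfl

theorem IsHomog.scale_eq (h : IsHomog n P) (t : F) : scale t P = C (t ^ n) * P := by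
  rw [scale_apply, h, Polynomial.eval_mul, Polynomial.eval_C, Polynomial.eval_pow,
    Polynomial.eval_X, map_pow, mul_comm]

theorem grade_scale (t : F) (P : MvPolynomial (Fin 2) F) :
    grade (scale t P) = (grade P).comp (Polynomial.C (C t) * Polynomial.X) := by
  induction P using MvPolynomial.induction_on with
  | C a => simp [scale_apply]
  | add p q hp hq => simp [hp, hq]
  | mul_X p i hp =>
    rw [map_mul, map_mul, hp]
    fin_cases i
    · simp only [Fin.zero_eta, scale_apply, grade_X0, map_mul, map_pow,
        grade_C, Polynomial.eval_mul, Polynomial.eval_C, Polynomial.eval_pow, Polynomial.eval_X,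
        Polynomial.mul_comp, Polynomial.C_comp, Polynomial.pow_comp, Polynomial.X_comp]
      ring
    · simp only [Fin.mk_one, scale_apply, grade_X1, map_mul, map_pow,
        grade_C, Polynomial.eval_mul, Polynomial.eval_C, Polynomial.eval_pow, Polynomial.eval_X,
        Polynomial.mul_comp, Polynomial.C_comp, Polynomial.pow_comp, Polynomial.X_comp]
      ring

theorem leadingCoeff_grade_scale {t : F} (ht : t ≠ 0) (P : MvPolynomial (Fin 2) F) :
    (grade (scale t P)).leadingCoeff = (grade P).leadingCoeff * C (t ^ (grade P).natDegree) := by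
  have h : (C t : MvPolynomial (Fin 2) F) ≠ 0 := by simpa using ht
  rw [grade_scale, Polynomial.leadingCoeff_comp, Polynomial.leadingCoeff_C_mul_X, map_pow]
  rw [Polynomial.natDegree_C_mul_X _ h]
  exact one_ne_zero

/-- Only the T⁰ coefficient of `grade P` can have a nonzero constant term. A top coefficient that is
a unit therefore sits in degree 0, where it equals P. -/
theorem isUnit_of_isUnit_leadingCoeff_grade (h : IsUnit (grade P).leadingCoeff) : IsUnit P := by
  have h1 : constantCoeff (grade P).leadingCoeff ≠ 0 := (h.map constantCoeff).ne_zero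
  have h2 := congrArg (Polynomial.coeff · (grade P).natDegree) (map_constantCoeff_grade P)
  simp only [Polynomial.coeff_map, Polynomial.coeff_C] at h2
  have h3 : (grade P).natDegree = 0 := by
    by_contra h3
    rw [if_neg h3] at h2
    exact h1 h2
  have h4 : grade P = Polynomial.C P * Polynomial.X ^ 0 := by
    have := Polynomial.eq_C_of_natDegree_eq_zero h3
    exact IsHomog.of_grade_eq (this.trans (by rw [pow_zero, mul_one]))
  rw [h4] at h
  simpa using h

end Grading

/-! ### Relations modulo p between polynomials in E₄ and E₆. -/

section ModPForms

open MvPolynomial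

variable {p : ℕ} [hp : Fact p.Prime]

/-- The reductions of `E₂, E₄, E₆` modulo `p`, with Ramanujan's identities, and the Hasse
invariant, a polynomial in `E₄, E₆` of weight `p - 1` that reduces to `1`. -/
structure EisensteinData (p : ℕ) [Fact p.Prime] where
  /-- `E₂`. -/
  e2 : PowerSeries (ZMod p)
  /-- `E₄`. -/
  e4 : PowerSeries (ZMod p)
  /-- `E₆`. -/
  e6 : PowerSeries (ZMod p)
  const4 : PowerSeries.constantCoeff e4 = 1
  const6 : PowerSeries.constantCoeff e6 = 1
  disc_ne_zero : e4 ^ 3 - e6 ^ 2 ≠ 0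
  ramanujan2 : 12 * (PowerSeries.X * PowerSeries.derivative (ZMod p) e2) = e2 ^ 2 - e4
  ramanujan4 : 12 * (PowerSeries.X * PowerSeries.derivative (ZMod p) e4) = 4 * (e2 * e4 - e6)
  ramanujan6 : 12 * (PowerSeries.X * PowerSeries.derivative (ZMod p) e6) = 6 * (e2 * e6 - e4 ^ 2)
  /-- The Hasse invariant. -/
  hasse : MvPolynomial (Fin 2) (ZMod p)
  hasse_homog : IsHomog (p - 1) hasse
  hasse_eq_one : aeval ![e4, e6] hasse = 1

namespace EisensteinData

variable (E : EisensteinData p)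

/-- The `q`-expansion of a polynomial in `E₄, E₆` modulo `p`. -/
noncomputable def qexp : MvPolynomial (Fin 2) (ZMod p) →ₐ[ZMod p] PowerSeries (ZMod p) :=
  aeval ![E.e4, E.e6]

@[simp] theorem qexp_X0 : E.qexp (X 0) = E.e4 := by simp [qexp]
@[simp] theorem qexp_X1 : E.qexp (X 1) = E.e6 := by simp [qexp]

theorem qexp_hasse : E.qexp E.hasse = 1 := E.hasse_eq_one

/-- Both sides are derivations along `qexp`, so Ramanujan's identities on the two generators
suffice. -/
theorem theta_qexp (P : MvPolynomial (Fin 2) (ZMod p)) :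
    12 * (PowerSeries.X * PowerSeries.derivative (ZMod p) (E.qexp P)) =
      E.qexp (serreD P) + E.e2 * E.qexp (euler P) := by
  induction P using MvPolynomial.induction_on with
  | C a =>
    have h : E.qexp (C a) = algebraMap _ _ a := E.qexp.commutes a
    have h1 : serreD (C a : MvPolynomial (Fin 2) (ZMod p)) = 0 := Derivation.map_algebraMap _ a
    have h2 : euler (C a : MvPolynomial (Fin 2) (ZMod p)) = 0 := Derivation.map_algebraMap _ a
    rw [h, h1, h2, Derivation.map_algebraMap]
    simp
  | add f g hf hg =>
    simp only [map_add, mul_add, hf, hg]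
    ring
  | mul_X f i hf =>
    have h4 : E.qexp (4 : MvPolynomial (Fin 2) (ZMod p)) = 4 := map_ofNat _ _
    have h6 : E.qexp (6 : MvPolynomial (Fin 2) (ZMod p)) = 6 := map_ofNat _ _
    have k0 : euler (X 0 : MvPolynomial (Fin 2) (ZMod p)) = 4 * X 0 := by
      simp [euler, mkDerivation_X]
    have k1 : euler (X 1 : MvPolynomial (Fin 2) (ZMod p)) = 6 * X 1 := by
      simp [euler, mkDerivation_X]
    fin_cases i
    · simp only [Fin.zero_eta, map_mul, Derivation.leibniz, smul_eq_mul, map_add, qexp_X0,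
        serreD_X0, k0, h4, map_neg, qexp_X1]
      linear_combination E.e4 * hf + E.qexp f * E.ramanujan4
    · simp only [Fin.mk_one, map_mul, Derivation.leibniz, smul_eq_mul, map_add, qexp_X0,
        serreD_X1, k1, h6, map_neg, map_pow, qexp_X1]
      linear_combination E.e6 * hf + E.qexp f * E.ramanujan6

theorem constantCoeff_qexp_disc :
    PowerSeries.constantCoeff (E.qexp (X 0 ^ 3 - X 1 ^ 2)) = 0 := by
  simp [E.const4, E.const6]

/-- The kernel of the `q`-expansion map. -/
noncomputable def ker : Ideal (MvPolynomial (Fin 2) (ZMod p)) := RingHom.ker E.qexp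

theorem mem_ker {P : MvPolynomial (Fin 2) (ZMod p)} : P ∈ E.ker ↔ E.qexp P = 0 := RingHom.mem_ker

instance : E.ker.IsPrime := RingHom.ker_isPrime _

/-- An inverse of Q³ - R² modulo the kernel would make a q-series without constant term a divisor of
1. -/
theorem not_isMaximal_ker : ¬ E.ker.IsMaximal := by
  intro h
  have h1 : X 0 ^ 3 - X 1 ^ 2 ∉ E.ker := by
    rw [mem_ker]
    simpa using E.disc_ne_zero
  obtain ⟨y, i, hi, h2⟩ := h.exists_inv h1
  have h3 := congrArg (fun x => PowerSeries.constantCoeff (E.qexp x)) h2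
  simp only [map_add, map_mul, E.constantCoeff_qexp_disc, E.mem_ker.mp hi] at h3
  simp at h3

theorem hasse_sub_one_mem : E.hasse - 1 ∈ E.ker := by
  rw [mem_ker, map_sub, qexp_hasse, map_one, sub_self]

theorem hasse_sub_one_ne_zero (hp5 : 5 ≤ p) : E.hasse - 1 ≠ 0 := by
  intro h
  have := congrArg constantCoeff h
  rw [map_sub, E.hasse_homog.constantCoeff_eq_zero (by omega)] at this
  simp at this

theorem hasse_ne_zero : E.hasse ≠ 0 := by
  intro h
  have := E.qexp_hasse
  rw [h, map_zero] at this
  exact zero_ne_one this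

theorem ringKrullDim_eq : ringKrullDim (MvPolynomial (Fin 2) (ZMod p)) = 2 := by
  rw [MvPolynomial.ringKrullDim_of_isNoetherianRing, ringKrullDim_eq_zero_of_field]
  simp

/-- Factoriality gives a prime element G of the kernel. Were (G) smaller than the kernel, the chain
0, (G), kernel, maximal ideal would have length 3 in a ring of dimension 2. -/
theorem exists_generator (hp5 : 5 ≤ p) :
    ∃ G : MvPolynomial (Fin 2) (ZMod p), Prime G ∧ G ∈ E.ker ∧ ∀ f ∈ E.ker, G ∣ f := by
  have hne : E.ker ≠ ⊥ := by
    intro h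
    have := E.hasse_sub_one_mem
    rw [h, Ideal.mem_bot] at this
    exact E.hasse_sub_one_ne_zero hp5 this
  obtain ⟨G, hG, hGp⟩ := Ideal.IsPrime.exists_mem_prime_of_ne_bot (I := E.ker) inferInstance hne
  refine ⟨G, hGp, hG, ?_⟩
  by_contra! hcon
  obtain ⟨f, hf, hfG⟩ := hcon
  have hGI : Ideal.span {G} < E.ker := by
    refine lt_of_le_of_ne ((Ideal.span_singleton_le_iff_mem _).mpr hG) fun h => hfG ?_
    rw [← h] at hf
    exact Ideal.mem_span_singleton.mp hf
  have hG0 : (⊥ : Ideal (MvPolynomial (Fin 2) (ZMod p))) < Ideal.span {G} := by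
    rw [bot_lt_iff_ne_bot, Ne, Ideal.span_singleton_eq_bot]
    exact hGp.ne_zero
  obtain ⟨M, hM, hIM⟩ := Ideal.exists_le_maximal E.ker (Ideal.IsPrime.ne_top inferInstance)
  have hIM' : E.ker < M := lt_of_le_of_ne hIM fun h => E.not_isMaximal_ker (h ▸ hM)
  have hGprime : (Ideal.span {G}).IsPrime := (Ideal.span_singleton_prime hGp.ne_zero).mpr hGp
  let s : LTSeries (PrimeSpectrum (MvPolynomial (Fin 2) (ZMod p))) :=
    { length := 3
      toFun := ![⟨⊥, Ideal.isPrime_bot⟩, ⟨Ideal.span {G}, hGprime⟩, ⟨E.ker, inferInstance⟩,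
        ⟨M, hM.isPrime⟩]
      step := by
        intro i
        fin_cases i
        · exact hG0
        · exact hGI
        · exact hIM' }
  have h3 : (3 : WithBot ℕ∞) ≤ ringKrullDim (MvPolynomial (Fin 2) (ZMod p)) :=
    Order.LTSeries.length_le_krullDim s
  rw [ringKrullDim_eq] at h3
  exact absurd h3 (by decide)

/-- A nonzero homogeneous f in the kernel would make its divisor G homogeneous. But G divides A - 1,
so its constant term is nonzero and its weight must be 0, which makes it a unit. -/
theorem eq_zero_of_isHomog (hp5 : 5 ≤ p) {n : ℕ} {f : MvPolynomial (Fin 2) (ZMod p)}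
    (hf : IsHomog n f) (h0 : E.qexp f = 0) : f = 0 := by
  by_contra hne
  obtain ⟨G, hG, -, hdvd⟩ := E.exists_generator hp5
  obtain ⟨d, -, hd⟩ := hf.exists_of_dvd hne (hdvd f (E.mem_ker.mpr h0))
  have h1 : constantCoeff G ≠ 0 := by
    intro h
    have := map_dvd constantCoeff (hdvd _ E.hasse_sub_one_mem)
    rw [h, map_sub, E.hasse_homog.constantCoeff_eq_zero (by omega)] at this
    simp at this
  have h2 : d = 0 := by
    by_contra hd0
    exact h1 (hd.constantCoeff_eq_zero hd0)
  subst h2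
  refine hG.not_isUnit ?_
  rw [hd.eq_C]
  exact (IsUnit.mk0 _ h1).map C

/-- Since A has q-expansion 1 and weight -1 modulo p, its `serreD` has q-expansion E₂ and weight 1
modulo p. Ramanujan's identity for E₂ then gives `serreD (serreD A)` the q-expansion -E₄, and
homogeneous polynomials are determined by their q-expansions. -/
theorem serreD_serreD_hasse (hp5 : 5 ≤ p) :
    serreD (serreD E.hasse) = -(X 0 * E.hasse) := by
  have hpp : ((p - 1 : ℕ) : MvPolynomial (Fin 2) (ZMod p)) = -1 := by
    rw [Nat.cast_sub (by omega)]
    simp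
  have h1 := E.theta_qexp E.hasse
  rw [qexp_hasse, E.hasse_homog.euler_eq, hpp] at h1
  have hD : E.qexp (serreD E.hasse) = E.e2 := by
    have h10 : PowerSeries.derivative (ZMod p) (1 : PowerSeries (ZMod p)) = 0 :=
      Derivation.map_one_eq_zero _
    rw [h10] at h1
    simp only [map_mul, map_neg, map_one, qexp_hasse] at h1
    linear_combination -h1
  have h2 := E.theta_qexp (serreD E.hasse)
  have hpp' : ((p - 1 + 2 : ℕ) : MvPolynomial (Fin 2) (ZMod p)) = 1 := by
    rw [Nat.cast_add, hpp]; norm_num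
  rw [hD, E.hasse_homog.serreD.euler_eq, hpp', one_mul, hD, E.ramanujan2] at h2
  have h3 : E.qexp (serreD (serreD E.hasse) + X 0 * E.hasse) = 0 := by
    rw [map_add, map_mul, qexp_hasse, qexp_X0]
    linear_combination -h2
  have h4 : IsHomog (p - 1 + 2 + 2) (serreD (serreD E.hasse) + X 0 * E.hasse) := by
    refine E.hasse_homog.serreD.serreD.add ?_
    have := isHomog_X0.mul E.hasse_homog
    rwa [show 4 + (p - 1) = p - 1 + 2 + 2 by ring] at this
  exact eq_neg_of_add_eq_zero_left (E.eq_zero_of_isHomog hp5 h4 h3)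

/-- At a factor u of multiplicity n ≥ 2, the lowest-order term n(n-1)uⁿ⁻²(Du)²v of D²A must be
divisible by uⁿ⁻¹, because D²A = -QA. This forces u ∣ Du, then Du = 0, which is incompatible with
the Euler relation. -/
theorem squarefree_hasse (hp5 : 5 ≤ p) {u : MvPolynomial (Fin 2) (ZMod p)} (hu : Prime u) :
    ¬ u * u ∣ E.hasse := by
  intro huu
  have hA0 := E.hasse_ne_zero
  obtain ⟨d, hdp, hd⟩ := E.hasse_homog.exists_of_dvd hA0 (dvd_of_mul_left_dvd huu)
  have hd0 : d ≠ 0 := by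
    rintro rfl
    refine hu.not_isUnit ?_
    have h1 : constantCoeff u ≠ 0 := by
      intro h
      rw [hd.eq_C, h, map_zero] at hu
      exact hu.ne_zero rfl
    rw [hd.eq_C]
    exact (IsUnit.mk0 _ h1).map C
  have hcast : ∀ i : ℕ, i ≠ 0 → i ≤ p - 1 → (i : ZMod p) ≠ 0 := by
    intro i h0 h1 h
    rw [ZMod.natCast_eq_zero_iff] at h
    have := Nat.le_of_dvd (by omega) h
    omega
  have hfin : FiniteMultiplicity u E.hasse :=
    FiniteMultiplicity.of_not_isUnit hu.not_isUnit hA0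
  obtain ⟨v, hv, huv⟩ := hfin.exists_eq_pow_mul_and_not_dvd
  set n := multiplicity u E.hasse with hn
  have hn2 : 2 ≤ n := hfin.le_multiplicity_of_pow_dvd (by rwa [sq])
  -- The factor uⁿ has weight nd ≤ p - 1 with d ≥ 1; hence n and n - 1 are invertible modulo p.
  have hnp : n ≤ p - 1 := by
    obtain ⟨d', hd'p, hd'⟩ := E.hasse_homog.exists_of_dvd hA0 (Dvd.intro _ hv.symm)
    have h0 : u ^ n ≠ 0 := pow_ne_zero _ hu.ne_zero
    have h1 := (hd.pow n)
    rw [IsHomog, hd'] at h1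
    have h2 := congrArg Polynomial.natDegree h1
    rw [Polynomial.natDegree_C_mul_X_pow _ _ h0, Polynomial.natDegree_C_mul_X_pow _ _ h0] at h2
    have : n * 1 ≤ n * d := Nat.mul_le_mul_left n (Nat.one_le_iff_ne_zero.mpr hd0)
    omega
  have hDu : u ∣ serreD u := by
    obtain ⟨k, hk⟩ : ∃ k, n = k + 2 := ⟨n - 2, by omega⟩
    have h1 : serreD E.hasse = u ^ (k + 1) * (((k + 2 : ℕ) : MvPolynomial (Fin 2) (ZMod p)) *
        serreD u * v + u * serreD v) := by
      rw [hv, hk, Derivation.leibniz, Derivation.leibniz_pow]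
      simp only [smul_eq_mul, nsmul_eq_mul, show k + 2 - 1 = k + 1 by rfl]
      ring
    have h2 : serreD (serreD E.hasse) = u ^ k * (((k + 1 : ℕ) : MvPolynomial (Fin 2) (ZMod p)) *
        ((k + 2 : ℕ) : MvPolynomial (Fin 2) (ZMod p)) * serreD u ^ 2 * v) + u ^ (k + 1) *
        (((k + 1 : ℕ) : MvPolynomial (Fin 2) (ZMod p)) * serreD u * serreD v + serreD
        (((k + 2 : ℕ) : MvPolynomial (Fin 2) (ZMod p)) * serreD u * v + u * serreD v)) := by
      rw [h1, Derivation.leibniz (D := serreD) (u ^ (k + 1)), Derivation.leibniz_pow]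
      simp only [smul_eq_mul, nsmul_eq_mul, show k + 1 - 1 = k by rfl]
      ring
    have h3 : u ^ (k + 1) ∣ serreD (serreD E.hasse) := by
      rw [E.serreD_serreD_hasse hp5, hv, hk]
      exact (Dvd.intro (u * v * X 0) (by ring)).neg_right
    rw [h2] at h3
    have h4 := (dvd_add_left (Dvd.intro _ rfl)).mp h3
    rw [pow_succ] at h4
    have h5 := (mul_dvd_mul_iff_left (pow_ne_zero k hu.ne_zero)).mp h4
    have hunit : ∀ i : ℕ, i ≠ 0 → i ≤ p - 1 → ¬ u ∣ (i : MvPolynomial (Fin 2) (ZMod p)) := by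
      intro i h0 h1 h
      refine hu.not_isUnit (isUnit_of_dvd_unit h ?_)
      have := (IsUnit.mk0 _ (hcast i h0 h1)).map (C (σ := Fin 2))
      simpa using this
    rcases hu.dvd_or_dvd h5 with h6 | h6
    · rcases hu.dvd_or_dvd h6 with h7 | h7
      · rcases hu.dvd_or_dvd h7 with h8 | h8
        · exact absurd h8 (hunit _ (by omega) (by omega))
        · exact absurd h8 (hunit _ (by omega) (by omega))
      · exact hu.dvd_of_dvd_pow h7
    · exact absurd h6 huv
  -- The quotient Du / u would be homogeneous of weight 2, and there is nothing nonzero of that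
  -- weight.
  have hDu0 : serreD u = 0 := by
    by_contra hne
    obtain ⟨w, hw⟩ := hDu
    have hD := hd.serreD
    obtain ⟨e, -, he⟩ := hD.exists_of_dvd hne (Dvd.intro_left _ hw.symm)
    have h1 := hd.mul he
    rw [← hw, IsHomog, hD] at h1
    have h2 := congrArg Polynomial.natDegree h1
    rw [Polynomial.natDegree_C_mul_X_pow _ _ hne, Polynomial.natDegree_C_mul_X_pow _ _ hne] at h2
    have he2 : e = 2 := by omega
    subst he2
    exact hne (by rw [hw, he.eq_zero_of_two, mul_zero])
  have h1 := hd.euler_eq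
  rw [euler_eq] at h1
  rw [serreD_eq] at hDu0
  -- Eliminating ∂u/∂Q between Du = 0 and Euler's relation leaves a multiple of Q³ - R², which has
  -- no constant term in q. The constant terms of R and of u, a divisor of A, are nonzero.
  have h2 : X 1 * ((d : MvPolynomial (Fin 2) (ZMod p)) * u) =
      -6 * (X 0 ^ 3 - X 1 ^ 2) * pderiv 1 u := by
    linear_combination -X 1 * h1 - X 0 * hDu0
  have h3 := congrArg (fun x => PowerSeries.constantCoeff (E.qexp x)) h2
  simp only [map_mul, E.constantCoeff_qexp_disc, mul_zero, zero_mul, qexp_X1, E.const6, one_mul,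
    map_natCast] at h3
  have h4 : PowerSeries.constantCoeff (E.qexp u) ≠ 0 := by
    obtain ⟨w, hw⟩ := dvd_of_mul_left_dvd huu
    intro h
    have := congrArg (fun x => PowerSeries.constantCoeff (E.qexp x)) hw
    simp only [map_mul, qexp_hasse, h, zero_mul, map_one] at this
    exact one_ne_zero this
  exact mul_ne_zero (hcast d hd0 hdp) h4 h3

/-- The scaling fixes A - 1. If G did not divide its image, A - 1 would be divisible by the product
of the two, whose top-weight coefficients agree up to a scalar; so a square of a nonunit would
divide the top-weight part A of A - 1. -/
theorem scale_mem_ker (hp5 : 5 ≤ p) {t : ZMod p} (ht : t ≠ 0)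
    {f : MvPolynomial (Fin 2) (ZMod p)} (hf : f ∈ E.ker) : scale t f ∈ E.ker := by
  obtain ⟨G, hG, hGk, hdvd⟩ := E.exists_generator hp5
  suffices h : G ∣ scale t G by
    refine E.ker.mem_of_dvd ((h.trans (map_dvd (scale t) (hdvd f hf)))) hGk
  by_contra hcon
  obtain ⟨H, hH⟩ := map_dvd (scale t) (hdvd _ E.hasse_sub_one_mem)
  have hp1 : t ^ (p - 1) = 1 := ZMod.pow_card_sub_one_eq_one ht
  rw [map_sub, map_one, E.hasse_homog.scale_eq, hp1, map_one, one_mul] at hH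
  have h1 : G ∣ H := (hG.dvd_or_dvd (hH ▸ hdvd _ E.hasse_sub_one_mem)).resolve_left hcon
  obtain ⟨W, rfl⟩ := h1
  have h2 : (grade (E.hasse - 1)).leadingCoeff = E.hasse := by
    have hdeg : (Polynomial.C E.hasse * Polynomial.X ^ (p - 1)).degree = ((p -
        1 : ℕ) : WithBot ℕ) :=
      Polynomial.degree_C_mul_X_pow _ E.hasse_ne_zero
    rw [map_sub, map_one, E.hasse_homog, Polynomial.leadingCoeff_sub_of_degree_lt,
      Polynomial.leadingCoeff_C_mul_X_pow]
    rw [hdeg, Polynomial.degree_one]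
    exact_mod_cast (by omega : 0 < p - 1)
  rw [hH, map_mul, map_mul, Polynomial.leadingCoeff_mul, Polynomial.leadingCoeff_mul,
    leadingCoeff_grade_scale ht] at h2
  have hlc : ¬ IsUnit (grade G).leadingCoeff := fun h =>
    hG.not_isUnit (isUnit_of_isUnit_leadingCoeff_grade h)
  have hlc0 : (grade G).leadingCoeff ≠ 0 :=
    Polynomial.leadingCoeff_ne_zero.mpr (grade_ne_zero hG.ne_zero)
  obtain ⟨u, hu, huG⟩ := WfDvdMonoid.exists_irreducible_factor hlc hlc0
  refine E.squarefree_hasse hp5 hu.prime ((mul_dvd_mul huG huG).trans ?_)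
  rw [← h2]
  exact Dvd.intro (C (t ^ (grade G).natDegree) * (grade W).leadingCoeff) (by ring)

/-- The relations between modular forms modulo `p` are graded by weights modulo `p - 1`. -/
theorem sum_filter_eq_zero (hp5 : 5 ≤ p) {ι : Type*} (s : Finset ι)
    (P : ι → MvPolynomial (Fin 2) (ZMod p)) (w : ι → ℕ) (hw : ∀ i ∈ s, IsHomog (w i) (P i))
    (h0 : ∑ i ∈ s, E.qexp (P i) = 0) (a : ZMod (p - 1)) :
    ∑ i ∈ s with (w i : ZMod (p - 1)) = a, E.qexp (P i) = 0 := by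
  have : NeZero (p - 1) := ⟨by omega⟩
  have h1 : ∑ i ∈ s, P i ∈ E.ker := by rwa [mem_ker, map_sum]
  -- Twisting by t^b selects the weights congruent to a: the sum of t^(w + b) over F_pˣ is -1 if p -
  -- 1 divides w + b and 0 otherwise.
  obtain ⟨b, hb⟩ : ∃ b : ℕ, (b : ZMod (p - 1)) = -a := ⟨(-a).val, ZMod.natCast_zmod_val _⟩
  have h2 : ∀ t : (ZMod p)ˣ, ∑ i ∈ s, ((t : ZMod p) ^ (w i + b)) • E.qexp (P i) = 0 := by
    intro t
    have h3 := E.mem_ker.mp (E.scale_mem_ker hp5 t.ne_zero h1)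
    rw [map_sum, map_sum] at h3
    have h4 : ∑ i ∈ s, ((t : ZMod p) ^ w i) • E.qexp (P i) = 0 := by
      rw [← h3]
      refine Finset.sum_congr rfl fun i hi => ?_
      rw [(hw i hi).scale_eq, ← smul_eq_C_mul, map_smul]
    rw [← smul_zero ((t : ZMod p) ^ b), ← h4, Finset.smul_sum]
    refine Finset.sum_congr rfl fun i _ => ?_
    rw [smul_smul, ← pow_add, add_comm]
  have h5 : ∑ i ∈ s, (∑ t : (ZMod p)ˣ, (t : ZMod p) ^ (w i + b)) • E.qexp (P i) = 0 := by
    simp_rw [Finset.sum_smul]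
    rw [Finset.sum_comm]
    exact Finset.sum_eq_zero fun t _ => h2 t
  have h6 : ∀ i, (∑ t : (ZMod p)ˣ, (t : ZMod p) ^ (w i + b)) =
      if (w i : ZMod (p - 1)) = a then -1 else 0 := by
    intro i
    have := FiniteField.sum_pow_units (ZMod p) (w i + b)
    simp only [ZMod.card] at this
    rw [this]
    refine if_congr ?_ rfl rfl
    rw [← ZMod.natCast_eq_zero_iff, Nat.cast_add, hb, ← sub_eq_add_neg, sub_eq_zero]
  simp_rw [h6] at h5
  refine neg_eq_zero.mp (Eq.trans ?_ h5)
  rw [Finset.sum_filter, ← Finset.sum_neg_distrib]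
  refine Finset.sum_congr rfl fun i _ => ?_
  split_ifs <;> simp

end EisensteinData

end ModPForms

/-! ### Vanishing theorems in level one, and differentiation of q-series. -/

section Weight

open PowerSeries UpperHalfPlane Function

/-- The transformation law of weight `k` under `τ ↦ -1/τ`. -/
def HasWeight (k : ℤ) (f : Conv) : Prop :=
  ∀ τ : ℍ, ev (ModularGroup.S • τ) f = (τ : ℂ) ^ k * ev τ f

namespace HasWeight

variable {k l : ℤ} {f g : Conv}

theorem mul (hf : HasWeight k f) (hg : HasWeight l g) : HasWeight (k + l) (f * g) := by
  intro τ
  rw [map_mul, map_mul, hf, hg, zpow_add₀ (UpperHalfPlane.ne_zero τ)]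
  ring

theorem sub (hf : HasWeight k f) (hg : HasWeight k g) : HasWeight k (f - g) := by
  intro τ
  rw [map_sub, map_sub, hf, hg, mul_sub]

theorem one : HasWeight 0 1 := fun τ => by simp

theorem pow (hf : HasWeight k f) : ∀ n : ℕ, HasWeight (n * k) (f ^ n)
  | 0 => by simpa using one
  | n + 1 => by
    rw [pow_succ]
    simpa [add_mul] using (hf.pow n).mul hf

theorem exists_form (hf : HasWeight k f) :
    ∃ F : ModularForm 𝒮ℒ k, (∀ τ, F τ = ev τ f) ∧ qExpansion 1 F = (f : ℂ⟦X⟧) :=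
  exists_modularForm hf

theorem eq_zero_of_form_eq_zero (hf : HasWeight k f) (h : ∀ F : ModularForm 𝒮ℒ k, 
    qExpansion 1 F = (f : ℂ⟦X⟧) → ⇑F = 0) : f = 0 := by
  obtain ⟨F, h1, h2⟩ := hf.exists_form
  exact ev_injective fun τ => by rw [← h1, h F h2, map_zero, Pi.zero_apply]

theorem eq_zero_of_neg (hf : HasWeight k f) (hk : k < 0) : f = 0 :=
  hf.eq_zero_of_form_eq_zero fun F _ => ModularFormClass.levelOne_neg_weight_eq_zero hk F

theorem eq_zero_of_odd (hf : HasWeight k f) (hk : Odd k) : f = 0 :=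
  hf.eq_zero_of_form_eq_zero fun F _ => by
    rw [ModularForm.levelOne_odd_weight_eq_zero hk F]; rfl

theorem eq_zero_of_two (hf : HasWeight 2 f) : f = 0 :=
  hf.eq_zero_of_form_eq_zero fun F _ => by
    rw [rank_zero_iff_forall_zero.mp ModularForm.levelOne_weight_two_rank_zero F]; rfl

/-- Below weight 12 the Sturm bound leaves only the constant term to check. -/
theorem eq_zero_of_lt (hf : HasWeight k f) (hk : k < 12) (h0 : coeff 0 (f : ℂ⟦X⟧) = 0) :
    f = 0 :=
  hf.eq_zero_of_form_eq_zero fun F hF => by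
    rw [ModularForm.sturm_bound_levelOne (f := F)]
    · rfl
    · rw [hF]
      have : k.toNat / 12 = 0 := by omega
      rw [this]
      refine lt_of_lt_of_le (b := ((1 : ℕ) : ℕ∞)) (by norm_num) (PowerSeries.nat_le_order _ _ ?_)
      intro i hi
      obtain rfl : i = 0 := by omega
      exact h0

end HasWeight

theorem hasWeight_qExpansion {k : ℤ} (F : ModularForm 𝒮ℒ k) :
    HasWeight k ⟨qExpansion 1 F, qExpansion_mem_conv F⟩ := by
  intro τ
  rw [ev_qExpansion, ev_qExpansion, modularForm_S_smul]

theorem iteratedDeriv_discSum {f : ℂ⟦X⟧} (hf : f ∈ Conv) (n : ℕ) :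
    iteratedDeriv n (discSum f) 0 = n.factorial * coeff n f := by
  have h := congrArg (FormalMultilinearSeries.coeff · n)
    ((hasFPowerSeriesOnBall_discSum hf).hasFPowerSeriesAt.eq_formalMultilinearSeries
      (hasFPowerSeriesOnBall_discSum hf).analyticAt.hasFPowerSeriesAt)
  simp only [FormalMultilinearSeries.coeff_ofScalars] at h
  rw [h, mul_div_cancel₀]
  exact_mod_cast n.factorial_ne_zero

theorem hasSum_deriv_discSum {f : ℂ⟦X⟧} (hf : f ∈ Conv) {q : ℂ} (hq : ‖q‖ < 1) :
    HasSum (fun n => coeff n (derivative ℂ f) * q ^ n) (deriv (discSum f) q) := by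
  have hF := (differentiableOn_discSum hf).deriv Metric.isOpen_ball
  have := Complex.hasSum_taylorSeries_on_ball hF (z := q) (by simpa using hq)
  refine this.congr_fun fun n => ?_
  rw [← iteratedDeriv_succ', iteratedDeriv_discSum hf, coeff_derivative, sub_zero, smul_eq_mul,
    smul_eq_mul, Nat.factorial_succ]
  have : (n.factorial : ℂ) ≠ 0 := by exact_mod_cast n.factorial_ne_zero
  push_cast
  field_simp

theorem hasSum_theta {f : ℂ⟦X⟧} (hf : f ∈ Conv) {q : ℂ} (hq : ‖q‖ < 1) :
    HasSum (fun n => coeff n (X * derivative ℂ f) * q ^ n) (q * deriv (discSum f) q) := by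
  rw [← hasSum_nat_add_iff' 1]
  refine Eq.mpr ?_ ((hasSum_deriv_discSum hf hq).mul_left q)
  congr 1
  · ext n
    rw [coeff_succ_X_mul, pow_succ]
    ring
  · simp

/-- The derivation `q d/dq` of convergent series. -/
noncomputable def theta (f : Conv) : Conv :=
  ⟨X * derivative ℂ (f : ℂ⟦X⟧),
    mem_conv_of_summable fun τ => (hasSum_theta f.2 (norm_qParam_lt_one τ)).summable⟩

theorem ev_theta (τ : ℍ) (f : Conv) :
    ev τ (theta f) = Periodic.qParam 1 (τ : ℂ) * deriv (discSum f) (Periodic.qParam 1 (τ : ℂ)) :=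
  (hasSum_theta f.2 (norm_qParam_lt_one τ)).tsum_eq

theorem hasDerivAt_ev (τ : ℍ) (f : Conv) :
    HasDerivAt (fun w : ℂ => discSum f (Periodic.qParam 1 w))
      (2 * Real.pi * Complex.I * ev τ (theta f)) τ := by
  have h1 : HasDerivAt (discSum f) (deriv (discSum f) (Periodic.qParam 1 (τ : ℂ)))
      (Periodic.qParam 1 (τ : ℂ)) :=
    ((differentiableOn_discSum f.2).differentiableAt
      (Metric.isOpen_ball.mem_nhds (by simpa using norm_qParam_lt_one τ))).hasDerivAt
  have h2 : HasDerivAt (Periodic.qParam 1)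
      (2 * Real.pi * Complex.I * Periodic.qParam 1 (τ : ℂ)) (τ : ℂ) := by
    have := ((hasDerivAt_id (τ : ℂ)).const_mul (2 * Real.pi * Complex.I)).cexp
    simp only [id, mul_one] at this
    convert! this using 1
    · ext w; simp [Periodic.qParam]
    · simp [Periodic.qParam]; ring
  have := h1.comp (τ : ℂ) h2
  rw [ev_theta]
  convert! this using 1
  ring

/-- The transformation law of the derivative of a quasimodular form. -/
theorem ev_S_smul_theta {f : Conv} {k j : ℕ} {c : ℂ}
    (h : ∀ τ : ℍ, ev (ModularGroup.S • τ) f = (τ : ℂ) ^ k * ev τ f + c * (τ : ℂ) ^ j) (τ : ℍ) :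
    2 * Real.pi * Complex.I * ev (ModularGroup.S • τ) (theta f) =
      k * (τ : ℂ) ^ (k + 1) * ev τ f
        + 2 * Real.pi * Complex.I * (τ : ℂ) ^ (k + 2) * ev τ (theta f)
        + c * j * (τ : ℂ) ^ (j + 1) := by
  have hτ := UpperHalfPlane.ne_zero τ
  have h1 : HasDerivAt (fun w : ℂ => -1 / w) (1 / (τ : ℂ) ^ 2) τ := by
    convert! (hasDerivAt_inv hτ).neg using 1
    · ext w; simp [neg_div]
    · simp
  -- Both sides of the law are differentiated in τ. The monomial cτʲ is there for E₂.
  have h2 := hasDerivAt_ev (ModularGroup.S • τ) f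
  rw [coe_S_smul] at h2
  have h3 := h2.comp (τ : ℂ) h1
  have h4 := (((hasDerivAt_id (τ : ℂ)).pow k).mul (hasDerivAt_ev τ f)).add
    (((hasDerivAt_id (τ : ℂ)).pow j).const_mul c)
  have h5 := h3.unique (h4.congr_of_eventuallyEq ?_)
  -- The truncated exponent n - 1 is harmless at n = 0 because of the factor n.
  · have e1 : ∀ n : ℕ, (n : ℂ) * (τ : ℂ) ^ (n - 1) * (τ : ℂ) ^ 2 = n * (τ : ℂ) ^ (n + 1) := by
      intro n
      cases n with
      | zero => simp
      | succ n => simp; ring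
    simp only [id, mul_one] at h5
    have e2 := e1 k
    have e3 := e1 j
    rw [ev_apply τ f]
    field_simp at h5
    simp only [Pi.pow_apply, id] at h5
    linear_combination h5 + discSum f (Periodic.qParam 1 (τ : ℂ)) * e2 + c * e3
  · filter_upwards [UpperHalfPlane.isOpen_upperHalfPlaneSet.mem_nhds τ.im_pos] with w hw
    have := h ⟨w, hw⟩
    rw [ev_apply, ev_apply, coe_S_smul] at this
    simpa using this

end Weight
-- E₂, E₄, E₆ and Ramanujan's identities.
section Eisenstein

open PowerSeries UpperHalfPlane Function
open scoped ArithmeticFunction.sigma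

/-- The series `1 + a ∑ σ_k(n) qⁿ`. -/
noncomputable def eisenstein (R : Type*) [CommRing R] (a : ℤ) (k : ℕ) : R⟦X⟧ :=
  PowerSeries.mk fun n => if n = 0 then 1 else ((a * σ k n : ℤ) : R)

theorem map_eisenstein {R S : Type*} [CommRing R] [CommRing S] (f : R →+* S) (a : ℤ) (k : ℕ) :
    PowerSeries.map f (eisenstein R a k) = eisenstein S a k := by
  ext n
  rw [coeff_map, eisenstein, eisenstein, coeff_mk, coeff_mk]
  split_ifs
  · simp
  · exact map_intCast f _

theorem map_X_mul_derivative {R S : Type*} [CommRing R] [CommRing S] (f : R →+* S) (g : R⟦X⟧) :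
    PowerSeries.map f (X * derivative R g) = X * derivative S (PowerSeries.map f g) := by
  rw [map_mul, PowerSeries.map_X]
  congr 1
  ext n
  simp [coeff_derivative]

theorem constantCoeff_eisenstein (R : Type*) [CommRing R] (a : ℤ) (k : ℕ) :
    constantCoeff (eisenstein R a k) = 1 := by
  rw [← coeff_zero_eq_constantCoeff_apply, eisenstein, coeff_mk, if_pos rfl]

theorem eisenstein_four : qExpansion 1 ModularForm.E₄ = eisenstein ℂ 240 3 := by
  ext n
  have hb : bernoulli 4 = -1 / 30 := by decide +kernel
  rw [EisensteinSeries.E_qExpansion_coeff (k := 4) _ ⟨2, rfl⟩, eisenstein, coeff_mk, hb]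
  split_ifs
  · rfl
  · push_cast; norm_num

theorem eisenstein_six : qExpansion 1 ModularForm.E₆ = eisenstein ℂ (-504) 5 := by
  ext n
  have hb : bernoulli 6 = 1 / 42 := by decide +kernel
  rw [EisensteinSeries.E_qExpansion_coeff (k := 6) _ ⟨3, rfl⟩, eisenstein, coeff_mk, hb]
  split_ifs
  · rfl
  · push_cast; norm_num

theorem hasSum_eisenstein_two (τ : ℍ) : 
    HasSum (fun n => coeff n (eisenstein ℂ (-24) 1) * Periodic.qParam 1 (τ : ℂ) ^ n) 
      (EisensteinSeries.E2 τ) := by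
  have := EisensteinSeries.hasSum_qExpansion_E2 τ
  convert! this using 1
  ext n
  rw [eisenstein, coeff_mk]
  simp [Periodic.qParam]

/-- `E₂`. -/
noncomputable def convE2 : Conv :=
  ⟨eisenstein ℂ (-24) 1, mem_conv_of_summable fun τ => (hasSum_eisenstein_two τ).summable⟩

/-- `E₄`. -/
noncomputable def convE4 : Conv :=
  ⟨eisenstein ℂ 240 3, eisenstein_four.symm ▸ qExpansion_mem_conv ModularForm.E₄⟩

/-- `E₆`. -/
noncomputable def convE6 : Conv :=
  ⟨eisenstein ℂ (-504) 5, eisenstein_six.symm ▸ qExpansion_mem_conv ModularForm.E₆⟩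

theorem convE4_eq : convE4 = ⟨qExpansion 1 ModularForm.E₄, qExpansion_mem_conv _⟩ :=
  Subtype.ext eisenstein_four.symm

theorem convE6_eq : convE6 = ⟨qExpansion 1 ModularForm.E₆, qExpansion_mem_conv _⟩ :=
  Subtype.ext eisenstein_six.symm

theorem hasWeight_convE4 : HasWeight 4 convE4 :=
  convE4_eq ▸ hasWeight_qExpansion ModularForm.E₄

theorem hasWeight_convE6 : HasWeight 6 convE6 :=
  convE6_eq ▸ hasWeight_qExpansion ModularForm.E₆

theorem ev_S_smul_convE2 (τ : ℍ) : ev (ModularGroup.S • τ) convE2 =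
    (τ : ℂ) ^ 2 * ev τ convE2 + 6 / (Real.pi * Complex.I) * (τ : ℂ) ^ 1 := by
  have h : ∀ τ : ℍ, ev τ convE2 = EisensteinSeries.E2 τ :=
    fun τ => (hasSum_eisenstein_two τ).tsum_eq
  have h1 := congrFun (EisensteinSeries.E2_slash_action ModularGroup.S) τ
  rw [ModularForm.SL_slash_apply, ModularGroup.denom_S] at h1
  simp only [Pi.sub_apply, Pi.smul_apply, EisensteinSeries.D2_S, riemannZeta_two, smul_eq_mul] at h1
  have hτ := UpperHalfPlane.ne_zero τ
  have hpi : (Real.pi : ℂ) ≠ 0 := by exact_mod_cast Real.pi_ne_zero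
  rw [h, h]
  field_simp at h1 ⊢
  rw [h1]
  linear_combination (-6 * (τ:ℂ)) * Complex.I_sq

/-- The non-modular terms of E₂² and 12θE₂ under S cancel, so the difference has weight 4; its
constant term is that of E₄. -/
theorem ramanujan_two : 12 * theta convE2 = convE2 ^ 2 - convE4 := by
  have hpi : (Real.pi : ℂ) ≠ 0 := by exact_mod_cast Real.pi_ne_zero
  suffices h : convE2 ^ 2 - 12 * theta convE2 - convE4 = 0 by linear_combination -h
  refine HasWeight.eq_zero_of_lt (k := 4) (HasWeight.sub ?_ hasWeight_convE4) (by norm_num) ?_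
  · intro τ
    have h1 := ev_S_smul_theta ev_S_smul_convE2 τ
    have hI := Complex.I_ne_zero
    have h2 : ev (ModularGroup.S • τ) (theta convE2) = (τ : ℂ) ^ 4 * ev τ (theta convE2) +
        (2 * (τ : ℂ) ^ 3 * ev τ convE2 + 6 / (Real.pi * Complex.I) * (τ : ℂ) ^ 2) /
          (2 * Real.pi * Complex.I) := by
      field_simp at h1 ⊢
      push_cast at h1
      linear_combination h1
    simp only [map_sub, map_pow, map_mul, map_ofNat]
    rw [h2, ev_S_smul_convE2, zpow_ofNat]
    field_simp
    ring
  · simp [theta, convE2, convE4, constantCoeff_eisenstein]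

/-- Differentiating the automorphy factor produces a term kτᵏ⁺¹f, which the anomaly of E₂ cancels.
-/
theorem hasWeight_serre {k : ℕ} {f : Conv} (hf : HasWeight k f) :
    HasWeight (k + 2) (k * (convE2 * f) - 12 * theta f) := by
  intro τ
  have hpi : (Real.pi : ℂ) ≠ 0 := by exact_mod_cast Real.pi_ne_zero
  have h0 : ∀ τ : ℍ, ev (ModularGroup.S • τ) f = (τ : ℂ) ^ k * ev τ f := fun τ => by
    rw [hf, zpow_natCast]
  have h1 := ev_S_smul_theta (f := f) (k := k) (j := 0) (c := 0) (by simpa using h0) τ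
  have hI := Complex.I_ne_zero
  have h2 : ev (ModularGroup.S • τ) (theta f) = (τ : ℂ) ^ (k + 2) * ev τ (theta f) +
      k * (τ : ℂ) ^ (k + 1) * ev τ f / (2 * Real.pi * Complex.I) := by
    field_simp at h1 ⊢
    push_cast at h1
    linear_combination h1
  simp only [map_sub, map_mul, map_ofNat, map_natCast]
  rw [h2, ev_S_smul_convE2, h0]
  have : (τ : ℂ) ^ ((k : ℤ) + 2) = (τ : ℂ) ^ (k + 2) := by
      exact_mod_cast zpow_natCast (τ : ℂ) (k + 2)
  rw [this]
  field_simp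
  ring

theorem ramanujan_four : 12 * theta convE4 = 4 * (convE2 * convE4 - convE6) := by
  suffices h : (4 : ℕ) * (convE2 * convE4) - 12 * theta convE4 - 4 * convE6 = 0 by
    push_cast at h; linear_combination -h
  refine HasWeight.eq_zero_of_lt (k := 6) (HasWeight.sub ?_ ?_) (by norm_num) ?_
  · exact hasWeight_serre (k := 4) hasWeight_convE4
  · intro τ; rw [map_mul, map_mul, hasWeight_convE6 τ, map_ofNat, map_ofNat]; ring
  · simp [theta, convE2, convE4, convE6, constantCoeff_eisenstein]

theorem ramanujan_six : 12 * theta convE6 = 6 * (convE2 * convE6 - convE4 ^ 2) := by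
  suffices h : (6 : ℕ) * (convE2 * convE6) - 12 * theta convE6 - 6 * convE4 ^ 2 = 0 by
    push_cast at h; linear_combination -h
  refine HasWeight.eq_zero_of_lt (k := 8) (HasWeight.sub ?_ ?_) (by norm_num) ?_
  · exact hasWeight_serre (k := 6) hasWeight_convE6
  · intro τ
    rw [map_mul, map_mul, hasWeight_convE4.pow 2 τ, map_ofNat, map_ofNat]
    norm_num
    ring
  · simp [theta, convE2, convE4, convE6, constantCoeff_eisenstein]

theorem map_injective_complex :
    Injective (PowerSeries.map (Int.castRingHom ℂ)) := 
  PowerSeries.map_injective _ Int.cast_injective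

/-- Ramanujan's identities over any ring. -/
theorem ramanujan (R : Type*) [CommRing R] :
    (12 * (X * derivative R (eisenstein R (-24) 1)) =
      eisenstein R (-24) 1 ^ 2 - eisenstein R 240 3) ∧
    (12 * (X * derivative R (eisenstein R 240 3)) =
      4 * (eisenstein R (-24) 1 * eisenstein R 240 3 - eisenstein R (-504) 5)) ∧
    12 * (X * derivative R (eisenstein R (-504) 5)) =
      6 * (eisenstein R (-24) 1 * eisenstein R (-504) 5 - eisenstein R 240 3 ^ 2) := by
  -- The coefficients are integers, so an identity over ℂ descends to ℤ and passes from there to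
  -- every ring.
  have key : ∀ (a : ℕ) (f g : ℤ⟦X⟧), 
      12 * (X * derivative ℂ (PowerSeries.map (Int.castRingHom ℂ) f)) =
        (a : _⟦X⟧) * PowerSeries.map (Int.castRingHom ℂ) g →
      12 * (X * derivative R (PowerSeries.map (Int.castRingHom R) f)) =
        (a : _⟦X⟧) * PowerSeries.map (Int.castRingHom R) g := by
    intro a f g h
    have h1 : 12 * (X * derivative ℤ f) = (a : ℤ⟦X⟧) * g := by
      apply map_injective_complex
      rw [map_mul, map_X_mul_derivative, map_mul, map_ofNat, map_natCast]
      exact h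
    have h2 := congrArg (PowerSeries.map (Int.castRingHom R)) h1
    rwa [map_mul, map_X_mul_derivative, map_mul, map_ofNat, map_natCast] at h2
  refine ⟨?_, ?_, ?_⟩
  · have := key 1 (eisenstein ℤ (-24) 1) (eisenstein ℤ (-24) 1 ^ 2 - eisenstein ℤ 240 3)
    simp only [map_sub, map_pow, map_eisenstein, Nat.cast_one, one_mul] at this
    exact this (congrArg Subtype.val ramanujan_two)
  · have := key 4 (eisenstein ℤ 240 3)
      (eisenstein ℤ (-24) 1 * eisenstein ℤ 240 3 - eisenstein ℤ (-504) 5)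
    simp only [map_sub, map_mul, map_eisenstein, Nat.cast_ofNat] at this
    exact this (congrArg Subtype.val ramanujan_four)
  · have := key 6 (eisenstein ℤ (-504) 5)
      (eisenstein ℤ (-24) 1 * eisenstein ℤ (-504) 5 - eisenstein ℤ 240 3 ^ 2)
    simp only [map_sub, map_mul, map_pow, map_eisenstein, Nat.cast_ofNat] at this
    exact this (congrArg Subtype.val ramanujan_six)

theorem coeff_one_eisenstein (R : Type*) [CommRing R] (a : ℤ) (k : ℕ) :
    coeff 1 (eisenstein R a k) = a := by
  rw [eisenstein, coeff_mk, if_neg one_ne_zero]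
  simp

theorem coeff_zero_disc (R : Type*) [CommRing R] :
    coeff 0 (eisenstein R 240 3 ^ 3 - eisenstein R (-504) 5 ^ 2) = 0 := by
  simp [constantCoeff_eisenstein]

theorem coeff_one_disc (R : Type*) [CommRing R] :
    coeff 1 (eisenstein R 240 3 ^ 3 - eisenstein R (-504) 5 ^ 2) = 1728 := by
  simp [pow_succ, coeff_one_mul, coeff_one_eisenstein, constantCoeff_eisenstein]
  norm_num

end Eisenstein
-- Integral modular forms as polynomials in E₄ and E₆.
section Integral

open PowerSeries UpperHalfPlane Function

variable {p : ℕ} [hp : Fact p.Prime]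

theorem C_mem_conv (a : ℂ) : (C a : ℂ⟦X⟧) ∈ Conv := by
  intro r _ _
  refine summable_of_ne_finset_zero (s := {0}) fun n hn => ?_
  simp only [Finset.mem_singleton] at hn
  simp [coeff_C, hn]

/-- The constant series. -/
noncomputable def convC : ℂ →+* Conv := (C (R := ℂ)).codRestrict Conv C_mem_conv

@[simp] theorem coe_convC (a : ℂ) : (convC a : ℂ⟦X⟧) = C a := rfl

@[simp] theorem ev_convC (τ : ℍ) (a : ℂ) : ev τ (convC a) = a := by
  rw [ev_apply, discSum, tsum_eq_single 0]
  · simp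
  · intro n hn
    simp [coeff_C, hn]

theorem HasWeight.const (a : ℂ) : HasWeight 0 (convC a) := fun τ => by simp

theorem HasWeight.convC_mul {k : ℤ} {f : Conv} (hf : HasWeight k f) (a : ℂ) :
    HasWeight k (convC a * f) := by
  simpa using (HasWeight.const a).mul hf

/-- The inclusion of the `p`-integral series in the complex ones. -/
noncomputable def toC (p : ℕ) [Fact p.Prime] : (integers p)⟦X⟧ →+* ℂ⟦X⟧ :=
  PowerSeries.map (integers p).subtype

theorem toC_injective : Injective (toC p) :=
  PowerSeries.map_injective _ Subtype.val_injective

@[simp] theorem toC_C (a : integers p) : toC p (C a) = C (a : ℂ) := PowerSeries.map_C _ _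

theorem toC_eisenstein_three : toC p (eisenstein (integers p) 240 3) = convE4 :=
  map_eisenstein _ _ _

theorem toC_eisenstein_five : toC p (eisenstein (integers p) (-504) 5) = convE6 :=
  map_eisenstein _ _ _

/-- Division of a cusp form by Δ = (E₄³ - E₆²)/1728; the factor 1/1728 is absorbed into g. -/
theorem HasWeight.exists_disc_mul {k : ℤ} {f : Conv} (hf : HasWeight k f)
    (h0 : coeff 0 (f : ℂ⟦X⟧) = 0) : 
    ∃ g : Conv, HasWeight (k - 12) g ∧ f = (convE4 ^ 3 - convE6 ^ 2) * g := by
  obtain ⟨F, hF, hF'⟩ := hf.exists_form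
  have hcusp : coeff 0 (qExpansion 1 F) = 0 := by rw [hF', h0]
  obtain ⟨G, hG⟩ : ∃ G : ModularForm 𝒮ℒ (k - 12), ∀ τ, ModularForm.discriminant τ * G τ = F τ :=
    ⟨_, ModularForm.discriminant_mul_discriminantEquiv_apply (F.toCuspForm hcusp)⟩
  obtain ⟨g, hg, hgG⟩ : ∃ g : Conv, HasWeight (k - 12) g ∧ ∀ τ, ev τ g = G τ :=
    ⟨_, hasWeight_qExpansion G, ev_qExpansion G⟩
  refine ⟨convC (1 / 1728) * g, hg.convC_mul _, ev_injective fun τ => ?_⟩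
  have h1 := hG τ
  have h2 := ModularForm.discriminant_eq_E₄_cube_sub_E₆_sq τ
  have h3 := hgG τ
  have h4 := ev_qExpansion ModularForm.E₄ τ
  have h6 := ev_qExpansion ModularForm.E₆ τ
  rw [← convE4_eq] at h4
  rw [← convE6_eq] at h6
  rw [h2, hF, ← h4, ← h6] at h1
  rw [map_mul, map_mul, h3, map_sub, map_pow, map_pow, ev_convC, ← h1]
  ring

/-- Integral modular forms are integral polynomials in `E₄` and `E₆`. -/
theorem exists_isHomog (hp5 : 5 ≤ p) {k : ℕ} {f : (integers p)⟦X⟧} {F : Conv}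
    (hf : toC p f = F) (hF : HasWeight k F) :
    ∃ P : MvPolynomial (Fin 2) (ZMod p), IsHomog k P ∧
      MvPolynomial.aeval ![eisenstein (ZMod p) 240 3, eisenstein (ZMod p) (-504) 5] P =
        PowerSeries.map (red p) f := by
  induction k using Nat.strong_induction_on generalizing f F with
  | _ k ih =>
  have hzero : ∀ {f : (integers p)⟦X⟧} {F : Conv}, toC p f = F → F = 0 → f = 0 := by
    rintro f F h rfl
    exact toC_injective (by simpa using h)
  by_cases hodd : Odd k
  · rw [hzero hf (hF.eq_zero_of_odd (by exact_mod_cast hodd))]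
    exact ⟨0, isHomog_zero _, by simp⟩
  by_cases h2 : k = 2
  · subst h2
    rw [hzero hf hF.eq_zero_of_two]
    exact ⟨0, isHomog_zero _, by simp⟩
  -- Every even weight other than 2 carries a monomial E₄ᵃE₆ᵇ, whose constant term 1 is used to
  -- clear that of f.
  obtain ⟨a, b, hab⟩ : ∃ a b : ℕ, a * 4 + b * 6 = k := by
    rw [Nat.not_odd_iff_even] at hodd
    obtain ⟨l, rfl⟩ := hodd
    rcases Nat.even_or_odd' l with ⟨c, rfl | rfl⟩
    · exact ⟨c, 0, by ring⟩
    · exact ⟨c - 1, 1, by omega⟩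
  let M : (integers p)⟦X⟧ := C (constantCoeff f) * (eisenstein (integers p) 240 3 ^ a *
      eisenstein (integers p) (-504) 5 ^ b)
  let N : Conv := convC ((constantCoeff f : integers p) : ℂ) * (convE4 ^ a * convE6 ^ b)
  have hMN : toC p M = N := by
    simp only [M, N, map_mul, map_pow, toC_eisenstein_three, toC_eisenstein_five, toC_C,
      Subring.coe_mul, Subring.coe_pow, coe_convC]
  have hN : HasWeight k N := by
    refine HasWeight.convC_mul ?_ _
    rw [← hab]
    exact_mod_cast (hasWeight_convE4.pow a).mul (hasWeight_convE6.pow b)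
  let Q : MvPolynomial (Fin 2) (ZMod p) :=
    MvPolynomial.C (red p (constantCoeff f)) * (MvPolynomial.X 0 ^ a * MvPolynomial.X 1 ^ b)
  have hQ : IsHomog k Q := hab ▸ ((isHomog_X0.pow a).mul (isHomog_X1.pow b)).C_mul _
  have hQM : MvPolynomial.aeval ![eisenstein (ZMod p) 240 3, eisenstein (ZMod p) (-504) 5] Q =
      PowerSeries.map (red p) M := by
    simp only [M, Q, map_mul, map_pow, map_eisenstein, PowerSeries.map_C, MvPolynomial.aeval_X,
      MvPolynomial.aeval_C]
    simp
  have hf0 : constantCoeff (f - M) = 0 := by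
    simp [M, constantCoeff_eisenstein]
  have hfM : toC p (f - M) = (F - N : Conv) := by
    rw [map_sub, hf, hMN]; rfl
  have hFM0 : coeff 0 ((F - N : Conv) : ℂ⟦X⟧) = 0 := by
    rw [← hfM, toC, coeff_map, coeff_zero_eq_constantCoeff_apply, hf0, map_zero]
  by_cases hk : k < 12
  · have h1 := hzero hfM ((hF.sub hN).eq_zero_of_lt (by exact_mod_cast hk) hFM0)
    rw [sub_eq_zero.mp h1]
    exact ⟨Q, hQ, hQM⟩
  obtain ⟨G, hG, hFG⟩ := (hF.sub hN).exists_disc_mul hFM0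
  obtain ⟨j, rfl⟩ := Nat.exists_eq_add_of_le (not_lt.mp hk)
  have hG' : HasWeight j G := by convert hG using 1; push_cast; ring
  let D : (integers p)⟦X⟧ := eisenstein (integers p) 240 3 ^ 3 -
      eisenstein (integers p) (-504) 5 ^ 2
  have hD : toC p D = (convE4 ^ 3 - convE6 ^ 2 : Conv) := by
    simp only [D, map_sub, map_pow, toC_eisenstein_three, toC_eisenstein_five,
        AddSubgroupClass.coe_sub,
      Subring.coe_pow]
  obtain ⟨U, hU⟩ : X ∣ D := X_dvd_iff.mpr (by simpa using coeff_zero_disc _)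
  -- The q-coefficient 1728 = 2⁶·3³ of E₄³ - E₆² is prime to p, so dividing by this series preserves
  -- p-integrality.
  have hUu : IsUnit U := by
    rw [PowerSeries.isUnit_iff_constantCoeff]
    have h3 := coeff_one_disc (integers p)
    change coeff 1 D = _ at h3
    rw [hU, show (1 : ℕ) = 0 + 1 from rfl, coeff_succ_X_mul,
        coeff_zero_eq_constantCoeff_apply] at h3
    rw [h3]
    have : ¬ ((p : ℤ) ∣ 1728) := by
      intro h
      have h4 : p ∣ 2 ^ 6 * 3 ^ 3 := by exact_mod_cast h
      rcases (Nat.Prime.dvd_mul hp.out).mp h4 with h5 | h5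
      · have := Nat.le_of_dvd (by norm_num) (hp.out.dvd_of_dvd_pow h5); omega
      · have := Nat.le_of_dvd (by norm_num) (hp.out.dvd_of_dvd_pow h5); omega
    exact_mod_cast isUnit_integers_intCast this
  obtain ⟨f2, hf2⟩ := X_dvd_iff.mpr hf0
  obtain ⟨V, hV⟩ := hUu.exists_right_inv
  have hDg : f - M = D * (V * f2) := by
    rw [hU, hf2]
    linear_combination (-X * f2) * hV
  have hD0 : toC p D ≠ 0 := by
    rw [Ne, map_eq_zero_iff _ toC_injective, hU]
    exact mul_ne_zero X_ne_zero hUu.ne_zero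
  have hg : toC p (V * f2) = G := by
    refine mul_left_cancel₀ hD0 ?_
    rw [← map_mul, ← hDg, hfM, hFG, hD]
    rfl
  obtain ⟨P, hP, hPe⟩ := ih j (by omega) hg hG'
  refine ⟨Q + (MvPolynomial.X 0 ^ 3 - MvPolynomial.X 1 ^ 2) * P, hQ.add ?_, ?_⟩
  · refine IsHomog.mul ?_ hP
    rw [sub_eq_add_neg]
    refine (isHomog_X0.pow 3).add ?_
    have := (isHomog_X1 (F := ZMod p).pow 2).C_mul (-1)
    simpa using this
  · rw [map_add, hQM, map_mul (MvPolynomial.aeval _) _ P, hPe, ← sub_add_cancel f M, hDg,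
        map_add, map_mul, add_comm]
    congr 2
    simp [D, map_eisenstein]

end Integral
-- The Hasse invariant, and the grading for integral modular forms.
section Hasse

open PowerSeries UpperHalfPlane Function
open HermitianJacobi (IsPIntegral)
open scoped ArithmeticFunction.sigma

variable {p : ℕ} [hp : Fact p.Prime]

theorem inv_mem_integers {x : integers p} (hx : red p x ≠ 0) : (x : ℂ)⁻¹ ∈ integers p := by
  obtain ⟨a, b, hb, h⟩ := exists_fraction x
  rw [red_apply _ hb h] at hx
  refine ⟨b, a, fun ha => hx ?_, by rw [h, inv_div]⟩
  rw [(ZMod.intCast_zmod_eq_zero_iff_dvd a p).mpr ha, zero_div]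

theorem natCast_div_mem_integers (n : ℕ) {q : ℕ} (hq : q.Prime) (hqp : q ≠ p) : 
    (n : ℂ) / q ∈ integers p :=
  ⟨n, q, fun h => hqp ((Nat.prime_dvd_prime_iff_eq hp.out hq).mp (by exact_mod_cast h)).symm,
    by push_cast; rfl⟩

/-- `p B_{p-1}` is `p`-integral and congruent to `-1` modulo `p`. -/
theorem exists_mul_bernoulli (hp5 : 5 ≤ p) :
    ∃ x : integers p, (x : ℂ) = p * (bernoulli (p - 1) : ℂ) ∧ red p x ≠ 0 := by
  obtain ⟨k, hk⟩ : ∃ k, p - 1 = 2 * k := by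
    obtain ⟨k, hk⟩ := hp.out.odd_of_ne_two (by omega)
    exact ⟨k, by omega⟩
  obtain ⟨N, hN⟩ := Bernoulli.vonStaudt_clausen k
  -- In the von Staudt-Clausen sum of the 1/q only the term with q = p fails to be p-integral.
  let s : Finset ℕ := {q ∈ Finset.range (2 * k + 2) | q.Prime ∧ (q - 1) ∣ 2 * k}
  have hps : p ∈ s := by
    simp only [s, Finset.mem_filter, Finset.mem_range]
    exact ⟨by omega, hp.out, by rw [hk]⟩
  let y : integers p := ∑ q ∈ (s.erase p).attach, ⟨(1 : ℕ) / (q : ℕ), natCast_div_mem_integers 1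
    (Finset.mem_filter.mp (Finset.mem_of_mem_erase q.2)).2.1 (Finset.ne_of_mem_erase q.2)⟩
  have hy : (y : ℂ) = ∑ q ∈ s.erase p, (1 : ℂ) / q := by
    simp only [y, AddSubmonoidClass.coe_finsetSum]
    rw [Finset.sum_attach (s.erase p) (fun q => ((1 : ℕ) : ℂ) / (q : ℂ))]
    simp
  have hp0 : (p : ℂ) ≠ 0 := by exact_mod_cast hp.out.ne_zero
  have hB : (bernoulli (p - 1) : ℂ) = N - (1 / p + y) := by
    rw [hy, Finset.add_sum_erase s (fun q : ℕ => (1 : ℂ) / q) hps, hk]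
    have := congrArg (Rat.cast : ℚ → ℂ) hN
    push_cast at this
    rw [this]
    ring
  refine ⟨(p : integers p) * (N - y) - 1, ?_, ?_⟩
  · rw [hB]
    push_cast
    field_simp
    ring
  · rw [map_sub, map_mul, map_natCast, map_one]
    simp

/-- The Eisenstein series of weight `p - 1` is congruent to `1`. -/
theorem exists_hasse (hp5 : 5 ≤ p) :
    ∃ P : MvPolynomial (Fin 2) (ZMod p), IsHomog (p - 1) P ∧
      MvPolynomial.aeval ![eisenstein (ZMod p) 240 3, eisenstein (ZMod p) (-504) 5] P = 1 := by
  obtain ⟨x, hx, hx0⟩ := exists_mul_bernoulli hp5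
  have heven : Even (p - 1) := by
    obtain ⟨k, hk⟩ := hp.out.odd_of_ne_two (by omega)
    exact ⟨k, by omega⟩
  let E := ModularForm.E (k := p - 1) (by omega)
  -- The factor -2(p-1)/B_{p-1} of the nonconstant terms is p·c, where c has the p-adic unit
  -- pB_{p-1} as denominator; hence E_{p-1} ≡ 1.
  let c : integers p := -((2 * (p - 1) : ℕ) : integers p) * ⟨_, inv_mem_integers hx0⟩
  let f : (integers p)⟦X⟧ := PowerSeries.mk fun n =>
    if n = 0 then 1 else (p : integers p) * c * ((σ (p - 1 - 1) n : ℕ) : integers p)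
  have hf : toC p f = (⟨qExpansion 1 E, qExpansion_mem_conv E⟩ : Conv) := by
    ext n
    have hp0 : (p : ℂ) ≠ 0 := by exact_mod_cast hp.out.ne_zero
    rw [EisensteinSeries.E_qExpansion_coeff _ heven, toC, coeff_map, coeff_mk]
    split_ifs
    · simp
    · simp only [c, Subring.subtype_apply, Subring.coe_mul, Subring.coe_natCast, hx,
        NegMemClass.coe_neg]
      push_cast
      rw [mul_inv]
      field_simp
  obtain ⟨P, hP, hPe⟩ := exists_isHomog hp5 hf (hasWeight_qExpansion E)
  refine ⟨P, hP, hPe.trans ?_⟩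
  ext n
  rw [coeff_map, coeff_mk, coeff_one]
  split_ifs
  · simp
  · simp

/-- The Eisenstein series modulo `p`. -/
theorem exists_eisensteinData (hp5 : 5 ≤ p) : ∃ E : EisensteinData p,
    E.e4 = eisenstein (ZMod p) 240 3 ∧ E.e6 = eisenstein (ZMod p) (-504) 5 := by
  obtain ⟨P, hP, hPe⟩ := exists_hasse hp5
  refine ⟨⟨eisenstein (ZMod p) (-24) 1, eisenstein (ZMod p) 240 3, eisenstein (ZMod p) (-504) 5,
    constantCoeff_eisenstein _ _ _, constantCoeff_eisenstein _ _ _, ?_, (ramanujan _).1,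
    (ramanujan _).2.1, (ramanujan _).2.2, P, hP, hPe⟩, rfl, rfl⟩
  intro h
  have h1 := coeff_one_disc (ZMod p)
  rw [h, map_zero] at h1
  have h2 : ((1728 : ℕ) : ZMod p) = 0 := by exact_mod_cast h1.symm
  rw [ZMod.natCast_eq_zero_iff, show 1728 = 2 ^ 6 * 3 ^ 3 by norm_num, hp.out.dvd_mul] at h2
  rcases h2 with h2 | h2
  · have := Nat.le_of_dvd (by norm_num) (hp.out.dvd_of_dvd_pow h2); omega
  · have := Nat.le_of_dvd (by norm_num) (hp.out.dvd_of_dvd_pow h2); omega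

/-- The relations modulo `p` between integral modular forms of level one are graded by weights
modulo `p - 1`. -/
theorem sum_map_red_filter_eq_zero (hp5 : 5 ≤ p) {ι : Type*} (s : Finset ι)
    (f : ι → (integers p)⟦X⟧) (F : ι → Conv) (w : ι → ℤ) (hf : ∀ i ∈ s, toC p (f i) = F i)
    (hw : ∀ i ∈ s, HasWeight (w i) (F i)) (h0 : ∑ i ∈ s, PowerSeries.map (red p) (f i) = 0)
    (a : ZMod (p - 1)) :
    ∑ i ∈ s with ((w i : ℤ) : ZMod (p - 1)) = a, PowerSeries.map (red p) (f i) = 0 := by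
  classical
  obtain ⟨E, h4, h6⟩ := exists_eisensteinData hp5
  have : NeZero (p - 1) := ⟨by omega⟩
  have key : ∀ i ∈ s, ∃ (P : MvPolynomial (Fin 2) (ZMod p)) (n : ℕ),
      E.qexp P = PowerSeries.map (red p) (f i) ∧ IsHomog n P ∧
        (n : ZMod (p - 1)) = (w i : ZMod (p - 1)) := by
    intro i hi
    rcases lt_or_ge (w i) 0 with h | h
    · have h1 : f i = 0 := by
        apply toC_injective
        rw [hf i hi, (hw i hi).eq_zero_of_neg h, map_zero]
        rfl
      -- A form of negative weight is zero, and the zero polynomial may be given any natural degree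
      -- in the class of the weight.
      exact ⟨0, _, by simp [h1], isHomog_zero _, ZMod.natCast_zmod_val _⟩
    · obtain ⟨n, hn⟩ := Int.eq_ofNat_of_zero_le h
      have h1 := hw i hi
      rw [hn] at h1
      obtain ⟨P, hP, hPe⟩ := exists_isHomog hp5 (hf i hi) h1
      refine ⟨P, n, ?_, hP, by rw [hn, Int.cast_natCast]⟩
      rw [← hPe, EisensteinData.qexp, h4, h6]
  choose! P n hP hn hnw using key
  have h1 := E.sum_filter_eq_zero hp5 s P n hn (by rw [← h0]; exact Finset.sum_congr rfl hP) a
  rw [← h1]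
  refine Finset.sum_congr (Finset.filter_congr fun i hi => by rw [hnw i hi]) fun i hi => ?_
  exact (hP i (Finset.mem_filter.mp hi).1).symm

end Hasse
-- Taylor series of entire functions.
section Taylor

open PowerSeries

/-- `P` is the Taylor series at `0` of the entire function `g`. -/
def IsTaylor (g : ℂ → ℂ) (P : ℂ⟦X⟧) : Prop :=
  ∀ z, HasSum (fun j => coeff j P * z ^ j) (g z)

namespace IsTaylor

variable {g h : ℂ → ℂ} {P Q : ℂ⟦X⟧}

theorem mem_conv (hP : IsTaylor g P) : P ∈ Conv :=
  mem_conv_of_summable fun _ => (hP _).summable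

theorem unique (hP : IsTaylor g P) (hQ : IsTaylor g Q) : P = Q :=
  conv_ext hP.mem_conv hQ.mem_conv fun q _ _ => (hP q).tsum_eq.trans (hQ q).tsum_eq.symm

theorem mul (hP : IsTaylor g P) (hQ : IsTaylor h Q) : IsTaylor (g * h) (P * Q) := by
  intro z
  have h1 := (hP z).summable.norm
  have h2 := (hQ z).summable.norm
  have h3 := summable_norm_sum_mul_antidiagonal_of_summable_norm h1 h2
  have h4 := tsum_mul_tsum_eq_tsum_sum_antidiagonal_of_summable_norm h1 h2
  rw [(hP z).tsum_eq, (hQ z).tsum_eq] at h4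
  rw [Pi.mul_apply, h4]
  convert! h3.of_norm.hasSum using 1
  ext n
  rw [coeff_mul, Finset.sum_mul]
  refine Finset.sum_congr rfl fun x hx => ?_
  rw [← Finset.HasAntidiagonal.mem_antidiagonal.mp hx, pow_add]
  ring

theorem rescale (hP : IsTaylor g P) (c : ℂ) :
    IsTaylor (fun z => g (c * z)) (PowerSeries.rescale c P) := by
  intro z
  convert! hP (c * z) using 1
  ext n
  rw [coeff_rescale, mul_pow]
  ring

end IsTaylor

/-- The Taylor series at `0`. -/
noncomputable def taylor (g : ℂ → ℂ) : ℂ⟦X⟧ :=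
  PowerSeries.mk fun n => (n.factorial : ℂ)⁻¹ * iteratedDeriv n g 0

theorem isTaylor_taylor {g : ℂ → ℂ} (hg : Differentiable ℂ g) : IsTaylor g (taylor g) := by
  intro z
  have := Complex.hasSum_taylorSeries_of_entire hg 0 z
  refine this.congr_fun fun n => ?_
  simp only [taylor, coeff_mk, smul_eq_mul, sub_zero]
  ring

theorem taylor_mul {g h : ℂ → ℂ} (hg : Differentiable ℂ g) (hh : Differentiable ℂ h) :
    taylor (g * h) = taylor g * taylor h :=
  (isTaylor_taylor (hg.mul hh)).unique ((isTaylor_taylor hg).mul (isTaylor_taylor hh))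

theorem taylor_const (c : ℂ) : taylor (fun _ => c) = C c := by
  refine (isTaylor_taylor (differentiable_const c)).unique fun z => ?_
  convert! hasSum_ite_eq 0 c using 1
  ext n
  rw [coeff_C]
  split_ifs with h <;> simp [h]

theorem taylor_pow {g : ℂ → ℂ} (hg : Differentiable ℂ g) (n : ℕ) :
    taylor (g ^ n) = taylor g ^ n := by
  induction n with
  | zero => rw [pow_zero, pow_zero]; exact (taylor_const 1).trans (map_one _)
  | succ n ih => rw [pow_succ, taylor_mul (hg.pow n) hg, ih, pow_succ]

theorem taylor_ne_zero {g : ℂ → ℂ} (hg : Differentiable ℂ g) {z : ℂ} (hz : g z ≠ 0) :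
    taylor g ≠ 0 := by
  intro h
  have := isTaylor_taylor hg z
  rw [h] at this
  exact hz (this.unique (by simp [hasSum_zero]))

end Taylor

/-! ### The substitution u = exp(2πiz) - 1. -/

section Exponential

open PowerSeries

theorem isUnit_one_add_X (R : Type*) [CommRing R] : IsUnit (1 + X : R⟦X⟧) := by
  rw [PowerSeries.isUnit_iff_constantCoeff]
  simp

/-- The power series `(1 + X)ˡ` for an integer `l`. -/
noncomputable def binom (R : Type*) [CommRing R] (l : ℤ) : R⟦X⟧ :=
  ((isUnit_one_add_X R).unit ^ l : R⟦X⟧ˣ)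

theorem binom_add (R : Type*) [CommRing R] (l m : ℤ) :
    binom R (l + m) = binom R l * binom R m := by
  rw [binom, zpow_add, Units.val_mul]; rfl

theorem binom_natCast (R : Type*) [CommRing R] (n : ℕ) : binom R n = (1 + X) ^ n := by
  rw [binom, zpow_natCast, Units.val_pow_eq_pow_val, IsUnit.unit_spec]

theorem map_binom {R S : Type*} [CommRing R] [CommRing S] (f : R →+* S) (l : ℤ) :
    PowerSeries.map f (binom R l) = binom S l := by
  have : Units.map (PowerSeries.map f : R⟦X⟧ →* S⟦X⟧) (isUnit_one_add_X R).unit =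
      (isUnit_one_add_X S).unit := by
    ext1; simp
  rw [binom, binom, ← this, ← map_zpow]
  rfl

theorem constantCoeff_binom (R : Type*) [CommRing R] (l : ℤ) :
    constantCoeff (binom R l) = 1 := by
  have : Units.map (constantCoeff (R := R)).toMonoidHom (isUnit_one_add_X R).unit = 1 := by
    ext1; simp
  have h : ((Units.map (constantCoeff (R := R)).toMonoidHom
      ((isUnit_one_add_X R).unit ^ l) : Rˣ) : R) = 1 := by
    rw [map_zpow, this, one_zpow, Units.val_one]
  exact h

/-- Substitution of a series without constant term. -/
noncomputable def substHom {A : Type*} [CommRing A] (b : A⟦X⟧) (hb : constantCoeff b = 0) :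
    A⟦X⟧ →+* A⟦X⟧ :=
  (PowerSeries.substAlgHom (R := A) (HasSubst.of_constantCoeff_zero' hb)).toRingHom

theorem coeff_substHom {A : Type*} [CommRing A] {b : A⟦X⟧} (hb : constantCoeff b = 0)
    (f : A⟦X⟧) (j : ℕ) :
    coeff j (substHom b hb f) = ∑ k ∈ Finset.range (j + 1), coeff k f * coeff j (b ^ k) := by
  have hs := HasSubst.of_constantCoeff_zero' hb
  have h1 : substHom b hb f = f.subst b := by
    rw [← PowerSeries.coe_substAlgHom hs]; rfl
  rw [h1, PowerSeries.coeff_subst' hs, finsum_eq_sum_of_support_subset]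
  · rfl
  · intro k hk
    simp only [Finset.coe_range, Set.mem_Iio]
    by_contra hcon
    refine hk ?_
    have : coeff j (b ^ k) = 0 := by
      refine coeff_of_lt_order _ (lt_of_lt_of_le ?_ (le_order_pow_of_constantCoeff_eq_zero k hb))
      exact_mod_cast (by omega : j < k)
    simp [this]

theorem substHom_X {A : Type*} [CommRing A] {b : A⟦X⟧} (hb : constantCoeff b = 0) :
    substHom b hb X = b := by
  have hs := HasSubst.of_constantCoeff_zero' hb
  have h1 : substHom b hb X = (X : A⟦X⟧).subst b := by
    rw [← PowerSeries.coe_substAlgHom hs]; rfl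
  rw [h1, PowerSeries.subst_X hs]

theorem constantCoeff_substHom {A : Type*} [CommRing A] {b : A⟦X⟧} (hb : constantCoeff b = 0)
    (f : A⟦X⟧) : constantCoeff (substHom b hb f) = constantCoeff f := by
  rw [← coeff_zero_eq_constantCoeff_apply, coeff_substHom]
  simp

theorem substHom_C {A : Type*} [CommRing A] {b : A⟦X⟧} (hb : constantCoeff b = 0) (a : A) :
    substHom b hb (C a) = C a := by
  ext j
  rw [coeff_substHom, Finset.sum_eq_single 0]
  · simp [coeff_C, coeff_one]
  · intro k _ hk
    simp [coeff_C, hk]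
  · simp

/-- `exp(2πiz) - 1`. -/
noncomputable def expSubOne : ℂ⟦X⟧ := PowerSeries.rescale (2 * Real.pi * Complex.I) (exp ℂ) - 1

theorem constantCoeff_expSubOne : constantCoeff expSubOne = 0 := by
  rw [← coeff_zero_eq_constantCoeff_apply, expSubOne, map_sub, coeff_rescale]
  simp

theorem coeff_one_expSubOne : coeff 1 expSubOne = 2 * Real.pi * Complex.I := by
  simp [expSubOne, coeff_rescale, coeff_exp, coeff_one]

theorem substHom_binom (l : ℤ) :
    substHom expSubOne constantCoeff_expSubOne (binom ℂ l) =
      PowerSeries.rescale (2 * Real.pi * Complex.I * l) (exp ℂ) := by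
  have hnat : ∀ n : ℕ, substHom expSubOne constantCoeff_expSubOne (binom ℂ n) =
      PowerSeries.rescale (2 * Real.pi * Complex.I * n) (exp ℂ) := by
    intro n
    rw [binom_natCast, map_pow, map_add, map_one, substHom_X, expSubOne, add_sub_cancel,
      ← map_pow, exp_pow_eq_rescale_exp, rescale_rescale]
    congr 2
    ring
  obtain ⟨n, rfl | rfl⟩ := l.eq_nat_or_neg
  · simpa using hnat n
  · have h1 := congrArg (substHom expSubOne constantCoeff_expSubOne) (binom_add ℂ n (-n))
    rw [add_neg_cancel, map_mul, hnat] at h1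
    have h0 : binom ℂ 0 = 1 := by simpa using binom_natCast ℂ 0
    rw [h0, map_one] at h1
    have h2 : PowerSeries.rescale (2 * Real.pi * Complex.I * n) (exp ℂ) *
        PowerSeries.rescale (2 * Real.pi * Complex.I * (-n : ℤ)) (exp ℂ) = 1 := by
      rw [exp_mul_exp_eq_exp_add]
      simp
    exact mul_left_cancel₀ (left_ne_zero_of_mul_eq_one h2) (h1.symm.trans h2.symm)

/-- `exp(2πiz) - 1`, over the ring of `q`-series. -/
noncomputable def expSubOneQ : ℂ⟦X⟧⟦X⟧ := PowerSeries.map (C (R := ℂ)) expSubOne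

theorem constantCoeff_expSubOneQ : constantCoeff expSubOneQ = 0 := by
  rw [← coeff_zero_eq_constantCoeff_apply, expSubOneQ, coeff_map,
    coeff_zero_eq_constantCoeff_apply, constantCoeff_expSubOne, map_zero]

/-- The substitution `u = exp(2πiz) - 1`, over the ring of `q`-series. -/
noncomputable def expSubst : ℂ⟦X⟧⟦X⟧ →+* ℂ⟦X⟧⟦X⟧ := substHom expSubOneQ constantCoeff_expSubOneQ

/-- The substituted series does not involve q, so one power of q can be treated at a time. -/
theorem coeff_coeff_expSubst (f : ℂ⟦X⟧⟦X⟧) (n j : ℕ) :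
    coeff n (coeff j (expSubst f)) = coeff j (substHom expSubOne constantCoeff_expSubOne
      (PowerSeries.mk fun k => coeff n (coeff k f))) := by
  rw [expSubst, coeff_substHom, coeff_substHom, map_sum]
  refine Finset.sum_congr rfl fun k _ => ?_
  rw [expSubOneQ, ← map_pow, coeff_map, coeff_mul_C, coeff_mk]

end Exponential
-- Series of Jacobi type, and the grading in index zero.
section JacobiType

open PowerSeries UpperHalfPlane

variable {p : ℕ} [hp : Fact p.Prime]

variable (p) in
/-- The expansion in `z` of a `p`-integral series in `u = exp(2πiz) - 1` and `q`. -/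
noncomputable def zExp : (integers p)⟦X⟧⟦X⟧ →+* ℂ⟦X⟧⟦X⟧ :=
  expSubst.comp (PowerSeries.map (toC p))

/-- The inclusion of convergent series. -/
noncomputable def convToC : Conv⟦X⟧ →+* ℂ⟦X⟧⟦X⟧ := PowerSeries.map Conv.subtype

theorem convToC_injective : Function.Injective convToC :=
  PowerSeries.map_injective _ Subtype.val_injective

/-- `F` is the expansion of a function `φ(τ, z)` on `ℍ × ℂ` that satisfies
`φ(-1/τ, z/τ) = a(τ, z) φ(τ, z)`. -/
def IsJacobiType (a : ℍ → ℂ⟦X⟧) (F : (integers p)⟦X⟧⟦X⟧) : Prop :=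
  ∃ Φ : Conv⟦X⟧, convToC Φ = zExp p F ∧ ∀ τ : ℍ,
    rescale (τ : ℂ)⁻¹ (PowerSeries.map (ev (ModularGroup.S • τ)) Φ) =
      a τ * PowerSeries.map (ev τ) Φ

theorem zExp_C (f : (integers p)⟦X⟧) : zExp p (C f) = C (toC p f) := by
  rw [zExp, RingHom.comp_apply, PowerSeries.map_C, expSubst, substHom_C]

theorem zExp_X : zExp p X = expSubOneQ := by
  rw [zExp, RingHom.comp_apply, PowerSeries.map_X, expSubst, substHom_X]

theorem constantCoeff_zExp (F : (integers p)⟦X⟧⟦X⟧) :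
    constantCoeff (zExp p F) = toC p (constantCoeff F) := by
  rw [zExp, RingHom.comp_apply, expSubst, constantCoeff_substHom,
    ← coeff_zero_eq_constantCoeff_apply, coeff_map, coeff_zero_eq_constantCoeff_apply]

theorem exists_convToC_of_X_pow_mul {Φ : Conv⟦X⟧} {W : ℂ⟦X⟧⟦X⟧} {r : ℕ}
    (h : convToC Φ = X ^ r * W) : ∃ U : Conv⟦X⟧, convToC U = W := by
  refine ⟨PowerSeries.mk fun j => coeff (j + r) Φ, ?_⟩
  ext1 j
  rw [convToC, coeff_map, coeff_mk, ← coeff_X_pow_mul W r j, ← h, convToC, coeff_map]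

theorem exists_expSubOneQ_eq :
    ∃ E : ℂ⟦X⟧⟦X⟧, expSubOneQ = X * E ∧ constantCoeff E = C (2 * Real.pi * Complex.I) := by
  obtain ⟨E, hE⟩ := X_dvd_iff.mpr constantCoeff_expSubOneQ
  refine ⟨E, hE, ?_⟩
  rw [← coeff_zero_eq_constantCoeff_apply, ← coeff_succ_X_mul 0 E, ← hE, expSubOneQ, coeff_map,
    coeff_one_expSubOne]

namespace IsJacobiType

variable {a b c : ℍ → ℂ⟦X⟧} {F G H : (integers p)⟦X⟧⟦X⟧}

theorem mul (hF : IsJacobiType a F) (hG : IsJacobiType b G) :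
    IsJacobiType (a * b) (F * G) := by
  obtain ⟨Φ, h1, h2⟩ := hF
  obtain ⟨Ψ, h3, h4⟩ := hG
  refine ⟨Φ * Ψ, by rw [map_mul, map_mul, h1, h3], fun τ => ?_⟩
  rw [map_mul, map_mul, map_mul, h2, h4, Pi.mul_apply]
  ring

theorem sub (hF : IsJacobiType a F) (hG : IsJacobiType a G) : IsJacobiType a (F - G) := by
  obtain ⟨Φ, h1, h2⟩ := hF
  obtain ⟨Ψ, h3, h4⟩ := hG
  refine ⟨Φ - Ψ, by rw [map_sub, map_sub, h1, h3], fun τ => ?_⟩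
  rw [map_sub, map_sub, map_sub, h2, h4]
  ring

theorem one : IsJacobiType (p := p) 1 1 := ⟨1, by simp, fun τ => by simp⟩

theorem pow (hF : IsJacobiType a F) : ∀ n : ℕ, IsJacobiType (a ^ n) (F ^ n)
  | 0 => by simpa using one
  | n + 1 => by
    rw [pow_succ, pow_succ]
    exact (hF.pow n).mul hF

theorem const {f : (integers p)⟦X⟧} {g : Conv} {w : ℍ → ℂ} (h : toC p f = g)
    (hg : ∀ τ : ℍ, ev (ModularGroup.S • τ) g = w τ * ev τ g) :
    IsJacobiType (fun τ => C (w τ)) (C f) := by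
  refine ⟨C g, ?_, fun τ => ?_⟩
  · rw [zExp_C, h, convToC, PowerSeries.map_C]
    rfl
  · rw [PowerSeries.map_C, PowerSeries.map_C, hg τ, map_mul]
    ext j
    rw [coeff_rescale, ← map_mul, coeff_C]
    split_ifs with hj <;> simp [hj]

theorem hasWeight_constantCoeff {w : ℤ} (hF : IsJacobiType (fun τ => C ((τ : ℂ) ^ w)) F) :
    ∃ g : Conv, toC p (constantCoeff F) = g ∧ HasWeight w g := by
  obtain ⟨Φ, h1, h2⟩ := hF
  refine ⟨constantCoeff Φ, ?_, fun τ => ?_⟩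
  · rw [← constantCoeff_zExp, ← h1, convToC, ← coeff_zero_eq_constantCoeff_apply, coeff_map,
      coeff_zero_eq_constantCoeff_apply]
    rfl
  · have := congrArg (coeff 0) (h2 τ)
    rw [coeff_rescale, coeff_C_mul, coeff_map, coeff_map] at this
    simpa using this

/-- Division of Jacobi-type series. After removal of the zero zʳ the divisor has constant term
(2πi)ʳv, a unit among convergent series, so the quotient has convergent coefficients; its law
follows by cancellation. -/
theorem of_mul (hF : IsJacobiType a (G * H)) (hH : IsJacobiType b H)
    {r : ℕ} {V : (integers p)⟦X⟧⟦X⟧} (hV : H = X ^ r * V)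
    (hv : ∃ v : Conv, IsUnit v ∧ toC p (constantCoeff V) = v)
    (habc : ∀ τ, a τ = c τ * b τ) (hb : ∀ τ, b τ ≠ 0) : IsJacobiType c G := by
  obtain ⟨Φ, h1, h2⟩ := hF
  obtain ⟨Ψ, h3, h4⟩ := hH
  obtain ⟨v, hvu, hv⟩ := hv
  obtain ⟨E, hE, hE0⟩ := exists_expSubOneQ_eq
  have hW : zExp p H = X ^ r * (E ^ r * zExp p V) := by
    rw [hV, map_mul, map_pow, zExp_X, hE]
    ring
  obtain ⟨U, hU⟩ := exists_convToC_of_X_pow_mul (h3.trans hW)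
  obtain ⟨U', hU'⟩ := exists_convToC_of_X_pow_mul (Φ := Φ) (r := r)
    (W := E ^ r * zExp p V * zExp p G) (by rw [h1, map_mul, hW]; ring)
  have hUu : IsUnit U := by
    rw [PowerSeries.isUnit_iff_constantCoeff]
    have h5 : constantCoeff U = convC (2 * Real.pi * Complex.I) ^ r * v := by
      apply Subtype.ext
      have h6 := congrArg constantCoeff hU
      rw [map_mul, map_pow, hE0, constantCoeff_zExp, hv, convToC,
        ← coeff_zero_eq_constantCoeff_apply, coeff_map, coeff_zero_eq_constantCoeff_apply] at h6
      rw [Subring.coe_mul, Subring.coe_pow, coe_convC]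
      exact h6
    rw [h5]
    refine (((Ne.isUnit ?_).map convC).pow r).mul hvu
    simp [Real.pi_ne_zero]
  obtain ⟨U₁, hU₁⟩ := hUu.exists_right_inv
  have hG : convToC (U₁ * U') = zExp p G := by
    have h5 : convToC U * convToC U₁ = 1 := by rw [← map_mul, hU₁, map_one]
    rw [map_mul, hU', ← hU]
    linear_combination zExp p G * h5
  have hΦ : Φ = (U₁ * U') * Ψ := by
    apply convToC_injective
    rw [map_mul, hG, h1, h3, map_mul]
  refine ⟨U₁ * U', hG, fun τ => ?_⟩
  have h5 := h2 τ
  have hΨ : Ψ = X ^ r * U := by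
    apply convToC_injective
    rw [h3, hW, map_mul, map_pow, hU, convToC, PowerSeries.map_X]
  have h6 : PowerSeries.map (ev τ) Ψ ≠ 0 := by
    rw [hΨ, map_mul, map_pow, PowerSeries.map_X]
    exact mul_ne_zero (pow_ne_zero _ X_ne_zero) (hUu.map _).ne_zero
  rw [hΦ, map_mul _ (U₁ * U') Ψ, map_mul _ (U₁ * U') Ψ, map_mul (rescale _), h4, habc] at h5
  refine mul_right_cancel₀ (mul_ne_zero (hb τ) h6) ?_
  linear_combination h5

end IsJacobiType

variable (p) in
/-- Reduction modulo `p` of the coefficients. -/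
noncomputable def redd : (integers p)⟦X⟧⟦X⟧ →+* (ZMod p)⟦X⟧⟦X⟧ :=
  PowerSeries.map (PowerSeries.map (red p))

/-- The relations modulo `p` between series of Jacobi type of index zero are graded by weights
modulo `p - 1`. -/
theorem coeff_sum_redd_filter_eq_zero (hp5 : 5 ≤ p) {t U : (integers p)⟦X⟧⟦X⟧}
    (ht : IsJacobiType (fun τ => C ((τ : ℂ) ^ (-1 : ℤ))) t) (htU : t = X * U) (hU : IsUnit U)
    (hv : ∃ v : Conv, IsUnit v ∧ toC p (constantCoeff U) = v) {ι : Type*} (s : Finset ι) (k : ℕ)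
    (F : ι → (integers p)⟦X⟧⟦X⟧) (w : ι → ℤ)
    (hF : ∀ i ∈ s, IsJacobiType (fun τ => C ((τ : ℂ) ^ w i)) (F i))
    (h0 : ∑ i ∈ s, redd p (F i) = 0) (a : ZMod (p - 1)) :
    coeff k (∑ i ∈ s with ((w i : ℤ) : ZMod (p - 1)) = a, redd p (F i)) = 0 := by
  obtain ⟨U₁, hU₁⟩ := hU.exists_right_inv
  induction k using Nat.strong_induction_on generalizing F w a with
  | _ k ih =>
  have hcoeff : ∀ G : (integers p)⟦X⟧⟦X⟧,
      constantCoeff (redd p G) = PowerSeries.map (red p) (constantCoeff G) := fun G => by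
    rw [redd, ← coeff_zero_eq_constantCoeff_apply, coeff_map, coeff_zero_eq_constantCoeff_apply]
  have hconst : ∀ a : ZMod (p - 1), ∑ i ∈ s with ((w i : ℤ) : ZMod (p - 1)) = a,
      PowerSeries.map (red p) (constantCoeff (F i)) = 0 := by
    have h1 := fun i hi => (hF i hi).hasWeight_constantCoeff
    choose! g hg hgw using h1
    refine sum_map_red_filter_eq_zero hp5 s _ g w hg hgw ?_
    have h2 := congrArg constantCoeff h0
    simpa only [map_sum, map_zero, hcoeff] using h2
  -- The constant term obeys the same law as F, so the difference may be divided by t; as t has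
  -- weight -1, the quotient has weight w + 1.
  have hdiv : ∀ i ∈ s, ∃ G, F i = C (constantCoeff (F i)) + G * t ∧
      IsJacobiType (fun τ => C ((τ : ℂ) ^ (w i + 1))) G := by
    intro i hi
    obtain ⟨H, hH⟩ : X ∣ F i - C (constantCoeff (F i)) := X_dvd_iff.mpr (by simp)
    have h1 : H * U₁ * t = F i - C (constantCoeff (F i)) := by
      rw [hH, htU]
      linear_combination X * H * hU₁
    refine ⟨H * U₁, by rw [h1]; ring, ?_⟩
    obtain ⟨g, hg, hgw⟩ := (hF i hi).hasWeight_constantCoeff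
    refine IsJacobiType.of_mul (a := fun τ => C ((τ : ℂ) ^ w i)) (H := t) (r := 1) (V := U)
      ?_ ht (by rw [pow_one, htU]) hv (fun τ => ?_) fun τ => ?_
    · rw [h1]
      exact (hF i hi).sub (.const hg hgw)
    · rw [← map_mul, ← zpow_add₀ (UpperHalfPlane.ne_zero τ)]
      congr 2
      ring
    · rw [Ne, map_eq_zero_iff _ C_injective]
      exact zpow_ne_zero _ (UpperHalfPlane.ne_zero τ)
  choose! G hFG hG using hdiv
  have hred : ∀ i ∈ s, redd p (F i) =
      C (PowerSeries.map (red p) (constantCoeff (F i))) + redd p (G i) * redd p t := by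
    intro i hi
    conv_lhs => rw [hFG i hi]
    rw [map_add, map_mul, redd, PowerSeries.map_C]
  have hsum : ∀ s' ⊆ s, ∑ i ∈ s', redd p (F i) =
      C (∑ i ∈ s', PowerSeries.map (red p) (constantCoeff (F i))) +
        (∑ i ∈ s', redd p (G i)) * redd p t := by
    intro s' hs'
    rw [map_sum, Finset.sum_mul, ← Finset.sum_add_distrib]
    exact Finset.sum_congr rfl fun i hi => hred i (hs' hi)
  have ht' : redd p t = X * redd p U := by
    rw [htU, map_mul, redd, PowerSeries.map_X]
  have htne : redd p t ≠ 0 := by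
    rw [ht']
    exact mul_ne_zero X_ne_zero (hU.map _).ne_zero
  -- The constant terms sum to zero modulo p and t does not vanish modulo p, so the quotients
  -- satisfy the same kind of relation.
  have hG0 : ∑ i ∈ s, redd p (G i) = 0 := by
    have h1 := hsum s subset_rfl
    have h2 : ∑ i ∈ s, PowerSeries.map (red p) (constantCoeff (F i)) = 0 := by
      have h2 := congrArg constantCoeff h0
      simpa only [map_sum, map_zero, hcoeff] using h2
    rw [h0, h2, map_zero, zero_add] at h1
    exact (mul_eq_zero.mp h1.symm).resolve_right htne
  rw [hsum _ (Finset.filter_subset _ _), hconst a, map_zero, zero_add, ht']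
  cases k with
  | zero => simp
  | succ k =>
    rw [mul_left_comm, coeff_succ_X_mul, coeff_mul]
    refine Finset.sum_eq_zero fun x hx => ?_
    have hx' := Finset.HasAntidiagonal.mem_antidiagonal.mp hx
    -- All weights have moved up by one, so the class a + 1 selects the same indices.
    have h3 := ih x.1 (by omega) G (fun i => w i + 1) hG hG0 (a + 1)
    simp only [Int.cast_add, Int.cast_one, add_left_inj] at h3
    rw [h3, zero_mul]

end JacobiType
-- From exponential sums to Taylor series with convergent q-series as coefficients.
section ExponentialSums

open PowerSeries UpperHalfPlane Function

/-- The series `∑ c_i q^{N_i} (1 + u)^{l_i}`. -/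
noncomputable def qzSeries {A : Type*} [CommRing A] {I : Type*} (N : I → ℕ) (l : I → ℤ)
    (hfin : ∀ n, (N ⁻¹' {n}).Finite) (c : I → A) : A⟦X⟧⟦X⟧ :=
  PowerSeries.mk fun k => PowerSeries.mk fun n =>
    ∑ i ∈ (hfin n).toFinset, c i * coeff k (binom A (l i))

theorem coeff_coeff_qzSeries {A : Type*} [CommRing A] {I : Type*} (N : I → ℕ) (l : I → ℤ)
    (hfin : ∀ n, (N ⁻¹' {n}).Finite) (c : I → A) (k n : ℕ) :
    coeff n (coeff k (qzSeries N l hfin c)) =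
      ∑ i ∈ (hfin n).toFinset, c i * coeff k (binom A (l i)) := by
  rw [qzSeries, coeff_mk, coeff_mk]

theorem map_qzSeries {A B : Type*} [CommRing A] [CommRing B] (f : A →+* B) {I : Type*}
    (N : I → ℕ) (l : I → ℤ) (hfin : ∀ n, (N ⁻¹' {n}).Finite) (c : I → A) :
    PowerSeries.map (PowerSeries.map f) (qzSeries N l hfin c) =
      qzSeries N l hfin (fun i => f (c i)) := by
  ext k n
  rw [coeff_map, coeff_map, coeff_coeff_qzSeries, coeff_coeff_qzSeries, map_sum]
  refine Finset.sum_congr rfl fun i _ => ?_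
  rw [map_mul, ← coeff_map, map_binom]

variable {p : ℕ} [hp : Fact p.Prime] {I : Type*} {N : I → ℕ} {l : I → ℤ}
  (hfin : ∀ n, (N ⁻¹' {n}).Finite) {c : I → integers p} {g : ℍ → ℂ → ℂ}

theorem coeff_coeff_zExp_qzSeries (n j : ℕ) :
    coeff n (coeff j (zExp p (qzSeries N l hfin c))) =
      ∑ i ∈ (hfin n).toFinset,
        (c i : ℂ) * coeff j (rescale (2 * Real.pi * Complex.I * l i) (exp ℂ)) := by
  rw [zExp, RingHom.comp_apply, coeff_coeff_expSubst, toC, map_qzSeries]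
  have : (PowerSeries.mk fun k => coeff n (coeff k
      (qzSeries N l hfin fun i => (integers p).subtype (c i)))) =
        ∑ i ∈ (hfin n).toFinset, C (c i : ℂ) * binom ℂ (l i) := by
    ext k
    rw [coeff_mk, coeff_coeff_qzSeries, map_sum]
    exact Finset.sum_congr rfl fun i _ => by rw [coeff_C_mul]; rfl
  rw [this, map_sum, map_sum]
  refine Finset.sum_congr rfl fun i _ => ?_
  rw [map_mul, substHom_C, coeff_C_mul, substHom_binom]

theorem hasSum_coeff_rescale_exp (a z : ℂ) :
    HasSum (fun j => coeff j (rescale a (exp ℂ)) * z ^ j) (Complex.exp (a * z)) := by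
  have := NormedSpace.expSeries_div_hasSum_exp (𝔸 := ℂ) (a * z)
  rw [← Complex.exp_eq_exp_ℂ] at this
  convert! this using 1
  ext j
  rw [coeff_rescale, coeff_exp, mul_pow]
  simp
  ring

theorem norm_coeff_rescale_exp (a : ℂ) (j : ℕ) :
    ‖coeff j (rescale a (exp ℂ))‖ = ‖a‖ ^ j / j.factorial := by
  rw [coeff_rescale, coeff_exp]
  simp [div_eq_mul_inv]

/-- Expanding each exponential absolutely costs exp(2π|l||z|) ≤ exp(2πl|z|) + exp(-2πl|z|). Both
bounds come from absolute convergence of the given series, at the points -i|z| and i|z|. -/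
theorem summable_expSum (h : ∀ (τ : ℍ) (z : ℂ), HasSum (fun i => (c i : ℂ) *
      Complex.exp (2 * Real.pi * Complex.I * (N i * (τ : ℂ) + l i * z))) (g τ z)) (τ : ℍ) (z : ℂ) :
    Summable fun x : I × ℕ => (c x.1 : ℂ) * Complex.exp (2 * Real.pi * Complex.I * (N x.1 *
        (τ : ℂ)))
      * coeff x.2 (rescale (2 * Real.pi * Complex.I * l x.1) (exp ℂ)) * z ^ x.2 := by
  have hexp : ∀ i, HasSum (fun j : ℕ => ‖coeff j (rescale (2 * Real.pi * Complex.I * l i) (exp ℂ))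
      * z ^ j‖) (Real.exp (2 * Real.pi * |(l i : ℝ)| * ‖z‖)) := by
    intro i
    have := NormedSpace.expSeries_div_hasSum_exp (𝔸 := ℝ) (2 * Real.pi * |(l i : ℝ)| * ‖z‖)
    rw [← Real.exp_eq_exp_ℝ] at this
    convert! this using 1
    ext j
    rw [norm_mul, norm_coeff_rescale_exp, norm_pow, mul_pow _ ‖z‖]
    simp [abs_of_pos Real.pi_pos]
    ring
  have hs : ∀ ε : ℝ, Summable fun i => ‖(c i : ℂ) * Complex.exp (2 * Real.pi * Complex.I *
      (N i * (τ : ℂ)))‖ * Real.exp (2 * Real.pi * (l i * ε)) := by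
    intro ε
    refine (h τ (-Complex.I * ε)).summable.norm.congr fun i => ?_
    rw [mul_add, Complex.exp_add, ← mul_assoc, norm_mul]
    congr 1
    rw [Complex.norm_exp]
    congr 1
    have : 2 * (Real.pi : ℂ) * Complex.I * (l i * (-Complex.I * ε)) =
        ((2 * Real.pi * (l i * ε) : ℝ) : ℂ) := by
      push_cast
      linear_combination (-2 * (Real.pi : ℂ) * l i * ε) * Complex.I_sq
    rw [this, Complex.ofReal_re]
  refine Summable.of_norm ?_
  rw [summable_prod_of_nonneg fun _ => norm_nonneg _]
  constructor
  · intro i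
    refine ((hexp i).summable.mul_left ‖(c i : ℂ) *
      Complex.exp (2 * Real.pi * Complex.I * (N i * (τ : ℂ)))‖).congr fun j => ?_
    rw [← norm_mul, mul_assoc _ _ (z ^ j)]
  · refine Summable.of_nonneg_of_le (fun i => tsum_nonneg fun _ => norm_nonneg _) (fun i => ?_)
      ((hs ‖z‖).add (hs (-‖z‖)))
    have : ∀ j, ‖(c i : ℂ) * Complex.exp (2 * Real.pi * Complex.I * (N i * (τ : ℂ)))
      * coeff j (rescale (2 * Real.pi * Complex.I * l i) (exp ℂ)) * z ^ j‖ =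
        ‖(c i : ℂ) * Complex.exp (2 * Real.pi * Complex.I * (N i * (τ : ℂ)))‖ *
        ‖coeff j (rescale (2 * Real.pi * Complex.I * l i) (exp ℂ)) * z ^ j‖ := fun j => by
      rw [← norm_mul, mul_assoc _ _ (z ^ j)]
    simp only [this]
    rw [tsum_mul_left, (hexp i).tsum_eq, ← mul_add]
    gcongr
    rcases abs_choice (l i : ℝ) with h | h
    · rw [h, mul_assoc]
      exact le_add_of_nonneg_right (Real.exp_nonneg _)
    · rw [h, mul_assoc]
      refine le_trans (le_of_eq ?_) (le_add_of_nonneg_left (Real.exp_nonneg _))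
      congr 1
      ring

/-- The doubly indexed family is absolutely summable. For fixed j, grouping by `N` gives the
q-series of the coefficient of zʲ; summing in the two orders identifies the resulting Taylor series
with g. -/
theorem exists_isTaylor_qzSeries (h : ∀ (τ : ℍ) (z : ℂ), HasSum (fun i => (c i : ℂ) *
      Complex.exp (2 * Real.pi * Complex.I * (N i * (τ : ℂ) + l i * z))) (g τ z)) :
    ∃ Φ : Conv⟦X⟧, convToC Φ = zExp p (qzSeries N l hfin c) ∧
      ∀ τ : ℍ, IsTaylor (g τ) (PowerSeries.map (ev τ) Φ) := by
  let T : ℍ → ℕ → I → ℂ := fun τ j i => 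
    (c i : ℂ) * Complex.exp (2 * Real.pi * Complex.I * (N i * (τ : ℂ))) *
      coeff j (rescale (2 * Real.pi * Complex.I * l i) (exp ℂ))
  have hT : ∀ (τ : ℍ) (j : ℕ), Summable (T τ j) := by
    intro τ j
    have := ((summable_expSum h τ 1).comp_injective (Prod.mk_left_injective j))
    refine this.congr fun i => ?_
    simp only [comp_apply, one_pow, mul_one, T]
  have hfib : ∀ (τ : ℍ) (j : ℕ), HasSum (fun n => coeff n (coeff j (zExp p (qzSeries N l hfin c))) *
      Periodic.qParam 1 (τ : ℂ) ^ n) (∑' i, T τ j i) := by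
    intro τ j
    have := (hT τ j).hasSum.tsum_fiberwise N
    refine this.congr_fun fun n => ?_
    rw [coeff_coeff_zExp_qzSeries, Finset.sum_mul, ← Finset.tsum_subtype' (hfin n).toFinset]
    rw [Set.Finite.coe_toFinset]
    refine tsum_congr fun i => ?_
    have hi : N i = n := i.2
    simp only [T]
    rw [hi, Periodic.qParam, ← Complex.exp_nat_mul]
    rw [show 2 * (Real.pi : ℂ) * Complex.I * (n * (τ : ℂ)) =
      n * (2 * Real.pi * Complex.I * τ / (1 : ℝ)) by push_cast; ring]
    ring
  let Φ : Conv⟦X⟧ := PowerSeries.mk fun j => ⟨coeff j (zExp p (qzSeries N l hfin c)),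
    mem_conv_of_summable fun τ => (hfib τ j).summable⟩
  have hev : ∀ (τ : ℍ) (j : ℕ), coeff j (PowerSeries.map (ev τ) Φ) = ∑' i, T τ j i := by
    intro τ j
    rw [coeff_map, coeff_mk]
    exact (hfib τ j).tsum_eq
  refine ⟨Φ, ?_, fun τ z => ?_⟩
  · ext1 j
    rw [convToC, coeff_map, coeff_mk]
    rfl
  · have hs := summable_expSum h τ z
    have h1 : HasSum _ _ := hs.hasSum.prod_fiberwise (fun i => by
      have := (hasSum_coeff_rescale_exp (2 * Real.pi * Complex.I * l i) z).mul_left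
        ((c i : ℂ) * Complex.exp (2 * Real.pi * Complex.I * (N i * (τ : ℂ))))
      exact this.congr_fun fun j => by rw [mul_assoc _ _ (z ^ j)])
    have h2 : HasSum _ _ := h τ z
    have h3 := h1.unique (h2.congr_fun fun i => by
      rw [mul_assoc, ← Complex.exp_add]
      congr 2
      ring)
    have h4 : HasSum _ _ := ((Equiv.prodComm ℕ I).hasSum_iff.mpr hs.hasSum).prod_fiberwise
      (fun j => (hT τ j).hasSum.mul_right (z ^ j))
    rw [h3] at h4
    exact h4.congr_fun fun j => by rw [hev]

theorem isJacobiType_qzSeries (h : ∀ (τ : ℍ) (z : ℂ), HasSum (fun i => (c i : ℂ) *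
      Complex.exp (2 * Real.pi * Complex.I * (N i * (τ : ℂ) + l i * z))) (g τ z))
    {A : ℍ → ℂ → ℂ} (hA : ∀ τ, Differentiable ℂ (A τ))
    (hlaw : ∀ (τ : ℍ) (z : ℂ), g (ModularGroup.S • τ) ((τ : ℂ)⁻¹ * z) = A τ z * g τ z) :
    IsJacobiType (fun τ => taylor (A τ)) (qzSeries N l hfin c) := by
  obtain ⟨Φ, h1, h2⟩ := exists_isTaylor_qzSeries hfin h
  refine ⟨Φ, h1, fun τ => ?_⟩
  refine ((h2 (ModularGroup.S • τ)).rescale (τ : ℂ)⁻¹).unique ?_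
  convert (isTaylor_taylor (hA τ)).mul (h2 τ) using 1
  ext z
  exact hlaw τ z

end ExponentialSums
-- Jacobi's theta series and its transformation law.
section ThetaSeries

open PowerSeries UpperHalfPlane Function

/-- The exponent `n(n+1)/2`. -/
def triangle (n : ℤ) : ℕ := (n * (n + 1) / 2).toNat

theorem two_mul_triangle (n : ℤ) : 2 * (triangle n : ℤ) = n * (n + 1) := by
  have h1 : 0 ≤ n * (n + 1) := by
    rcases le_or_gt 0 n with h | h
    · positivity
    · exact mul_nonneg_of_nonpos_of_nonpos h.le (by omega)
  have h2 := Int.even_mul_succ_self n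
  rw [triangle, Int.toNat_of_nonneg (by omega)]
  exact Int.two_mul_ediv_two_of_even h2

theorem triangle_neg (n : ℤ) : triangle (-1 - n) = triangle n := by
  have h1 := two_mul_triangle n
  have h2 := two_mul_triangle (-1 - n)
  have : (-1 - n) * (-1 - n + 1) = n * (n + 1) := by ring
  omega

theorem finite_triangle (m : ℕ) : (triangle ⁻¹' {m}).Finite := by
  refine (Set.finite_Icc (-(2 * m + 1 : ℤ)) (2 * m + 1)).subset fun n hn => ?_
  have h1 := two_mul_triangle n
  rw [Set.mem_preimage, Set.mem_singleton_iff] at hn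
  rw [hn] at h1
  constructor <;> nlinarith

theorem coeff_one_binom (A : Type*) [CommRing A] (l : ℤ) : coeff 1 (binom A l) = l := by
  have hadd : ∀ l m : ℤ, coeff 1 (binom A (l + m)) = coeff 1 (binom A l) + coeff 1 (binom A m) := by
    intro l m
    rw [binom_add, coeff_one_mul, constantCoeff_binom, constantCoeff_binom]
    ring
  have h := map_zsmul (AddMonoidHom.mk' (fun l : ℤ => coeff 1 (binom A l)) hadd) l 1
  have h1 : binom A 1 = 1 + X := by simpa using binom_natCast A 1
  simpa [h1, coeff_one] using h

/-- The series `∑ (-1)ⁿ q^{n(n+1)/2} ζ^{r(2n+1)}` in `q` and `u = ζ - 1`. -/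
noncomputable def thetaSeries (A : Type*) [CommRing A] (r : ℤ) : A⟦X⟧⟦X⟧ :=
  qzSeries triangle (fun n => r * (2 * n + 1)) finite_triangle fun n => (-1) ^ n.natAbs

/-- The series `∑ (-1)ⁿ (2n+1) q^{n(n+1)/2}` over all integers `n`. -/
noncomputable def etaSeries (A : Type*) [CommRing A] : A⟦X⟧ :=
  PowerSeries.mk fun m => ∑ n ∈ (finite_triangle m).toFinset, (-1) ^ n.natAbs * ((2 * n +
      1 : ℤ) : A)

theorem constantCoeff_thetaSeries (A : Type*) [CommRing A] (r : ℤ) :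
    constantCoeff (thetaSeries A r) = 0 := by
  rw [← coeff_zero_eq_constantCoeff_apply]
  ext m
  rw [thetaSeries, coeff_coeff_qzSeries, map_zero]
  simp only [coeff_zero_eq_constantCoeff_apply, constantCoeff_binom, mul_one]
  -- The involution preserves n(n+1)/2 and flips the sign.
  refine Finset.sum_involution (fun n _ => -1 - n) ?_ ?_ ?_ ?_
  · intro n _
    have : (-1 - n).natAbs + n.natAbs = 2 * n.natAbs + 1 ∨ 
        (-1 - n).natAbs + 1 = n.natAbs := by omega
    rcases this with h | h
    · rw [show (-1 - n).natAbs = n.natAbs + 1 by omega, pow_succ]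
      ring
    · rw [← h, pow_succ]
      ring
  · intro n _ _ h
    omega
  · intro n hn
    simpa [triangle_neg] using hn
  · intro n _
    ring

theorem coeff_one_thetaSeries (A : Type*) [CommRing A] (r : ℤ) :
    coeff 1 (thetaSeries A r) = C (r : A) * etaSeries A := by
  ext m
  rw [thetaSeries, coeff_coeff_qzSeries, coeff_C_mul, etaSeries, coeff_mk, Finset.mul_sum]
  refine Finset.sum_congr rfl fun n _ => ?_
  rw [coeff_one_binom]
  push_cast
  ring

theorem constantCoeff_etaSeries (A : Type*) [CommRing A] : constantCoeff (etaSeries A) = 2 := by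
  have h : (finite_triangle 0).toFinset = {0, -1} := by
    ext n
    have := two_mul_triangle n
    simp only [Set.Finite.mem_toFinset, Set.mem_preimage, Set.mem_singleton_iff,
      Finset.mem_insert, Finset.mem_singleton]
    constructor
    · intro h
      rw [h] at this
      rcases mul_eq_zero.mp this.symm with h | h <;> omega
    · rintro (rfl | rfl) <;> rfl
  rw [← coeff_zero_eq_constantCoeff_apply, etaSeries, coeff_mk, h]
  rw [Finset.sum_pair (by norm_num)]
  norm_num

/-- The function with expansion `thetaSeries`. -/
noncomputable def thetaFun (r : ℤ) (τ : ℍ) (z : ℂ) : ℂ :=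
  Complex.exp (2 * Real.pi * Complex.I * (r * z)) *
    jacobiTheta₂ (2 * (r * z) + 1 / 2 + τ / 2) τ

theorem neg_one_pow_natAbs (n : ℤ) : ((-1 : ℂ)) ^ n.natAbs = Complex.exp (Real.pi * Complex.I *
    n) := by
  have h : ∀ n : ℕ, ((-1 : ℂ)) ^ n = Complex.exp (Real.pi * Complex.I * n) := by
    intro n
    rw [← Complex.exp_pi_mul_I, ← Complex.exp_nat_mul]
    congr 1
    ring
  obtain ⟨m, rfl | rfl⟩ := n.eq_nat_or_neg
  · simpa using h m
  · rw [Int.natAbs_neg, Int.natAbs_natCast]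
    have h1 := h m
    have h2 : ((-1 : ℂ)) ^ m * (-1) ^ m = 1 := by rw [← mul_pow]; simp
    have h3 : Complex.exp (Real.pi * Complex.I * m) * 
        Complex.exp (Real.pi * Complex.I * (-m : ℤ)) = 1 := by
      rw [← Complex.exp_add]; simp
    rw [← h1] at h3
    exact mul_left_cancel₀ (left_ne_zero_of_mul_eq_one h2) (h2.trans h3.symm)

theorem triangle_cast (n : ℤ) : (triangle n : ℂ) = n * (n + 1) / 2 := by
  have h : ((2 * (triangle n : ℤ) : ℤ) : ℂ) = ((n * (n + 1) : ℤ) : ℂ) := by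
    rw [two_mul_triangle]
  push_cast at h
  linear_combination h / 2

theorem hasSum_thetaFun (r : ℤ) (τ : ℍ) (z : ℂ) : HasSum (fun n : ℤ => (-1 : ℂ) ^ n.natAbs *
      Complex.exp (2 * Real.pi * Complex.I *
        (triangle n * (τ : ℂ) + ((r * (2 * n + 1) : ℤ) : ℂ) * z))) (thetaFun r τ z) := by
  have := (hasSum_jacobiTheta₂_term (2 * (r * z) + 1 / 2 + τ / 2) τ.im_pos).mul_left
    (Complex.exp (2 * Real.pi * Complex.I * (r * z)))
  refine this.congr_fun fun n => ?_
  rw [neg_one_pow_natAbs, jacobiTheta₂_term, ← Complex.exp_add, ← Complex.exp_add, triangle_cast]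
  congr 1
  push_cast
  ring

/-- The factor of automorphy of `thetaFun`. -/
noncomputable def thetaFactor (τ : ℍ) : ℂ :=
  (-Complex.I * τ) ^ (1 / 2 : ℂ) *
    Complex.exp (Real.pi * Complex.I * (τ / 4 + 1 / (4 * τ) - 1 / 2))

theorem thetaFactor_ne_zero (τ : ℍ) : thetaFactor τ ≠ 0 :=
  mul_ne_zero (by simp [Complex.cpow_eq_zero_iff, UpperHalfPlane.ne_zero])
    (Complex.exp_ne_zero _)

/-- The eighth power removes the branch of the square root and the root of unity. The exponential
that remains is due to the factor q^(1/8) left out of the theta series to keep integral exponents.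
-/
theorem thetaFactor_pow_eight (τ : ℍ) : thetaFactor τ ^ 8 =
    (τ : ℂ) ^ 4 * Complex.exp (2 * Real.pi * Complex.I * (τ + 1 / τ)) := by
  have h1 : ((-Complex.I * (τ : ℂ)) ^ (1 / 2 : ℂ)) ^ 8 = (τ : ℂ) ^ 4 := by
    rw [← Complex.cpow_nat_mul, show ((8 : ℕ) : ℂ) * (1 / 2) = (4 : ℕ) by norm_num,
      Complex.cpow_natCast, mul_pow]
    rw [show (-Complex.I) ^ 4 = (Complex.I ^ 2) ^ 2 by ring, Complex.I_sq]
    ring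
  rw [thetaFactor, mul_pow, h1, ← Complex.exp_nat_mul]
  congr 1
  have : ((8 : ℕ) : ℂ) * (Real.pi * Complex.I * (τ / 4 + 1 / (4 * τ) - 1 / 2)) =
      2 * Real.pi * Complex.I * (τ + 1 / τ) + (-2 : ℤ) * (2 * Real.pi * Complex.I) := by
    have := UpperHalfPlane.ne_zero τ
    push_cast
    field_simp
    ring
  rw [this, Complex.exp_add, Complex.exp_int_mul_two_pi_mul_I, mul_one]

/-- Jacobi's functional equation is used at 2rz + τ/2 - 1/2, a period away from the argument in
`thetaFun`; divided by τ, this point becomes the argument belonging to -1/τ. -/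
theorem thetaFun_S_smul (r : ℕ) (τ : ℍ) (z : ℂ) :
    thetaFun r (ModularGroup.S • τ) ((τ : ℂ)⁻¹ * z) =
      thetaFactor τ * Complex.exp (4 * Real.pi * Complex.I * z ^ 2 / τ) ^ (r ^ 2) *
        thetaFun r τ z := by
  have hτ := UpperHalfPlane.ne_zero τ
  have hf := jacobiTheta₂_functional_equation (2 * (r * z) + τ / 2 - 1 / 2) τ
  have hp := jacobiTheta₂_add_left (2 * (r * z) + τ / 2 - 1 / 2) τ
  rw [show 2 * (r * z) + (τ : ℂ) / 2 - 1 / 2 + 1 = 2 * (r * z) + 1 / 2 + τ / 2 by ring] at hp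
  have hc : (-Complex.I * (τ : ℂ)) ^ (1 / 2 : ℂ) ≠ 0 := by
    simp [Complex.cpow_eq_zero_iff, UpperHalfPlane.ne_zero]
  rw [thetaFun, thetaFun, coe_S_smul, Int.cast_natCast, hp, hf, thetaFactor, ← Complex.exp_nat_mul,
    Nat.cast_pow]
  rw [show 2 * (r * ((τ : ℂ)⁻¹ * z)) + 1 / 2 + -1 / (τ : ℂ) / 2 =
    (2 * (r * z) + τ / 2 - 1 / 2) / τ by field_simp; ring]
  set θ := jacobiTheta₂ ((2 * (r * z) + τ / 2 - 1 / 2) / τ) (-1 / τ)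
  set s := (-Complex.I * (τ : ℂ)) ^ (1 / 2 : ℂ)
  have key : Complex.exp (2 * Real.pi * Complex.I * (r * ((τ : ℂ)⁻¹ * z))) =
      Complex.exp (Real.pi * Complex.I * (τ / 4 + 1 / (4 * τ) - 1 / 2)) *
      Complex.exp ((r : ℂ) ^ 2 * (4 * Real.pi * Complex.I * z ^ 2 / τ)) *
      Complex.exp (2 * Real.pi * Complex.I * (r * z)) *
      Complex.exp (-Real.pi * Complex.I * (2 * (r * z) + τ / 2 - 1 / 2) ^ 2 / τ) := by
    rw [← Complex.exp_add, ← Complex.exp_add, ← Complex.exp_add]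
    congr 1
    field_simp
    ring
  rw [key]
  field_simp

end ThetaSeries
-- Theta blocks of weights 0 and -1.
section ThetaBlocks

open PowerSeries UpperHalfPlane Function

variable {p : ℕ} [hp : Fact p.Prime]

/-- The Taylor series of `exp(4πiz²/τ)`. -/
noncomputable def gaussian (τ : ℍ) : ℂ⟦X⟧ :=
  taylor fun z => Complex.exp (4 * Real.pi * Complex.I * z ^ 2 / τ)

theorem differentiable_gaussian (τ : ℍ) :
    Differentiable ℂ fun z : ℂ => Complex.exp (4 * Real.pi * Complex.I * z ^ 2 / τ) := by
  fun_prop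

theorem gaussian_ne_zero (τ : ℍ) : gaussian τ ≠ 0 :=
  taylor_ne_zero (differentiable_gaussian τ) (z := 0) (Complex.exp_ne_zero _)

theorem taylor_thetaLaw (c : ℂ) (τ : ℍ) (n : ℕ) :
    taylor (fun z => c * Complex.exp (4 * Real.pi * Complex.I * z ^ 2 / τ) ^ n) =
      C c * gaussian τ ^ n := by
  rw [gaussian, ← taylor_pow (differentiable_gaussian τ), ← taylor_const,
    ← taylor_mul (differentiable_const c) ((differentiable_gaussian τ).pow n)]
  rfl

theorem isJacobiType_thetaSeries (r : ℕ) :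
    IsJacobiType (fun τ => C (thetaFactor τ) * gaussian τ ^ (r ^ 2))
      (thetaSeries (integers p) r) := by
  simp only [← taylor_thetaLaw]
  refine isJacobiType_qzSeries finite_triangle (g := thetaFun r) (fun τ z => ?_) (fun τ => ?_)
    (thetaFun_S_smul r)
  · refine (hasSum_thetaFun r τ z).congr_fun fun n => ?_
    simp
  · exact ((differentiable_gaussian τ).pow _).const_mul _

theorem X_mem_conv : (X : ℂ⟦X⟧) ∈ Conv := by
  intro r _ _
  refine summable_of_ne_finset_zero (s := {1}) fun n hn => ?_
  simp only [Finset.mem_singleton] at hn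
  simp [coeff_X, hn]

theorem ev_X (τ : ℍ) : ev τ ⟨X, X_mem_conv⟩ = Periodic.qParam 1 (τ : ℂ) := by
  rw [ev_apply, discSum, tsum_eq_single 1]
  · simp
  · intro n hn
    simp [coeff_X, hn]

theorem toC_etaSeries : toC p (etaSeries (integers p)) = etaSeries ℂ := by
  ext m
  rw [toC, coeff_map, etaSeries, etaSeries, coeff_mk, coeff_mk, map_sum]
  exact Finset.sum_congr rfl fun n _ => by
    rw [map_mul, map_pow, map_neg, map_one, map_intCast]

theorem coeff_one_X_mul {A : Type*} [CommRing A] (f : A⟦X⟧) :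
    coeff 1 (X * f) = constantCoeff f := by
  rw [← coeff_zero_eq_constantCoeff_apply]
  exact coeff_succ_X_mul 0 f

-- The coefficient of z in θ₁ is 2πi times `etaSeries`. As θ₁ vanishes at z = 0, the Gaussian does
-- not affect this coefficient, and the rescaling of z contributes the factor τ.
variable (p) in
theorem exists_convEta : ∃ H : Conv, toC p (etaSeries (integers p)) = H ∧
    ∀ τ : ℍ, ev (ModularGroup.S • τ) H = τ * thetaFactor τ * ev τ H := by
  obtain ⟨Φ, h1, h2⟩ := isJacobiType_thetaSeries (p := p) 1
  have hcoeff : ∀ j, ((coeff j Φ : Conv) : ℂ⟦X⟧) =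
      coeff j (zExp p (thetaSeries _ ((1 : ℕ) : ℤ))) := fun j => by
    rw [← h1, convToC, coeff_map]; rfl
  have hpi : (2 * Real.pi * Complex.I : ℂ) ≠ 0 := by simp [Real.pi_ne_zero]
  have h3 : ((coeff 1 Φ : Conv) : ℂ⟦X⟧) = C (2 * Real.pi * Complex.I) *
      toC p (etaSeries (integers p)) := by
    obtain ⟨V, hV⟩ := X_dvd_iff.mpr (constantCoeff_thetaSeries (integers p) ((1 : ℕ) : ℤ))
    obtain ⟨E, hE, hE0⟩ := exists_expSubOneQ_eq
    have h4 : etaSeries (integers p) = constantCoeff V := by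
      have := coeff_one_thetaSeries (integers p) ((1 : ℕ) : ℤ)
      rw [hV, coeff_one_X_mul] at this
      simpa using this.symm
    rw [hcoeff, hV, map_mul, zExp_X, hE, mul_assoc, coeff_one_X_mul, map_mul, hE0,
        constantCoeff_zExp, h4]
  have h0 : coeff 0 Φ = 0 := by
    apply Subtype.ext
    rw [hcoeff, coeff_zero_eq_constantCoeff_apply, constantCoeff_zExp, constantCoeff_thetaSeries,
      map_zero]
    rfl
  refine ⟨convC (2 * Real.pi * Complex.I)⁻¹ * coeff 1 Φ, ?_, fun τ => ?_⟩
  · rw [Subring.coe_mul, h3, coe_convC, ← mul_assoc, ← map_mul, inv_mul_cancel₀ hpi, map_one,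
      one_mul]
  · have h4 := congrArg (coeff 1) (h2 τ)
    have hg0 : constantCoeff (gaussian τ) = 1 := by
      have := isTaylor_taylor (differentiable_gaussian τ) 0
      have h5 := this.unique (hasSum_single 0 fun j hj => by simp [hj])
      simpa [gaussian] using h5.symm
    simp only [one_pow, pow_one] at h4
    rw [coeff_rescale, coeff_map, mul_assoc, coeff_C_mul, coeff_one_mul, coeff_map, hg0,
      ← coeff_zero_eq_constantCoeff_apply (PowerSeries.map (ev τ) Φ), coeff_map, h0, map_zero] at h4
    have hτ := UpperHalfPlane.ne_zero τ
    rw [map_mul, map_mul, ev_convC, ev_convC]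
    simp only [mul_one, mul_zero, zero_add, pow_one] at h4
    field_simp at h4 ⊢
    linear_combination h4

/-- The series qH⁸ is a cusp form of weight 12, hence a multiple of Δ, and a nonzero one since its
q-coefficient is 2⁸. So H has no zeros on ℍ. -/
theorem isUnit_convEta {H : Conv} (h : toC p (etaSeries (integers p)) = H)
    (hS : ∀ τ : ℍ, ev (ModularGroup.S • τ) H = τ * thetaFactor τ * ev τ H) : IsUnit H := by
  have h0 : constantCoeff (H : ℂ⟦X⟧) = 2 := by
    rw [← h, toC_etaSeries, constantCoeff_etaSeries]
  have hw : HasWeight 12 (⟨X, X_mem_conv⟩ * H ^ 8) := by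
    intro τ
    have hτ := UpperHalfPlane.ne_zero τ
    rw [map_mul, map_mul, map_pow, map_pow, hS, ev_X, ev_X, coe_S_smul, mul_pow, mul_pow,
      thetaFactor_pow_eight]
    have : Periodic.qParam 1 (-1 / (τ : ℂ)) * Complex.exp (2 * Real.pi * Complex.I * (τ + 1 / τ)) =
        Periodic.qParam 1 (τ : ℂ) := by
      rw [Periodic.qParam, Periodic.qParam, ← Complex.exp_add]
      congr 1
      push_cast
      field_simp
      ring
    rw [← this]
    norm_cast
    ring
  obtain ⟨g, hg, hgX⟩ := hw.exists_disc_mul (by simp)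
  have hconst : g = convC (constantCoeff (g : ℂ⟦X⟧)) := by
    refine sub_eq_zero.mp (HasWeight.eq_zero_of_lt (k := 0) (HasWeight.sub hg (.const _))
      (by norm_num) ?_)
    simp
  set γ := constantCoeff (g : ℂ⟦X⟧)
  have h1 : 2 ^ 8 = 1728 * γ := by
    have h2 := congrArg (fun f : Conv => coeff 1 (f : ℂ⟦X⟧)) hgX
    rw [hconst] at h2
    have h3 := coeff_one_disc ℂ
    have h4 : ((convE4 ^ 3 - convE6 ^ 2 : Conv) : ℂ⟦X⟧) =
      eisenstein ℂ 240 3 ^ 3 - eisenstein ℂ (-504) 5 ^ 2 := rfl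
    simp only [Subring.coe_mul, Subring.coe_pow, coe_convC, coeff_mul_C, h4, h3] at h2
    rw [coeff_one_X_mul, map_pow, h0] at h2
    exact h2
  refine isUnit_conv (by rw [coeff_zero_eq_constantCoeff_apply, h0]; norm_num) fun τ hτ => ?_
  have h2 := congrArg (ev τ) hgX
  have h4 := ev_qExpansion ModularForm.E₄ τ
  have h6 := ev_qExpansion ModularForm.E₆ τ
  rw [← convE4_eq] at h4
  rw [← convE6_eq] at h6
  have hΔ := ModularForm.discriminant_ne_zero τ
  rw [ModularForm.discriminant_eq_E₄_cube_sub_E₆_sq] at hΔ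
  rw [hconst, map_mul, map_pow, hτ, map_mul, map_sub, map_pow, map_pow, h4, h6, ev_convC,
    zero_pow (by norm_num), mul_zero, eq_comm, mul_eq_zero] at h2
  rcases h2 with h2 | h2
  · rw [h2, zero_div] at hΔ
    exact hΔ rfl
  · rw [h2] at h1
    norm_num at h1

theorem not_dvd_natCast {m n : ℕ} (h0 : n ≠ 0) (h : n < m) : ¬ (m : ℤ) ∣ n := fun h' =>
  absurd (Nat.le_of_dvd (Nat.pos_of_ne_zero h0) (by exact_mod_cast h')) (not_le.mpr h)

/-- The theta blocks: `N` has weight `0` and index law `exp(4πiz²/τ)`, and `t` has weight `-1` and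
index `0`. -/
theorem exists_thetaBlocks (hp5 : 5 ≤ p) : ∃ N t U : (integers p)⟦X⟧⟦X⟧,
    (IsUnit N ∧ IsJacobiType gaussian N ∧
      ∃ v : Conv, IsUnit v ∧ toC p (constantCoeff N) = v) ∧
    IsJacobiType (fun τ => C ((τ : ℂ) ^ (-1 : ℤ))) t ∧ t = X * U ∧ IsUnit U ∧
      ∃ v : Conv, IsUnit v ∧ toC p (constantCoeff U) = v := by
  obtain ⟨H, hH, hHS⟩ := exists_convEta p
  have hHu := isUnit_convEta hH hHS
  have hunit : ∀ n : ℕ, n ≠ 0 → n < p → IsUnit (n : integers p) := fun n h0 h => by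
    exact_mod_cast isUnit_integers_intCast (not_dvd_natCast h0 h)
  have hη : IsUnit (etaSeries (integers p)) := by
    rw [PowerSeries.isUnit_iff_constantCoeff, constantCoeff_etaSeries]
    exact_mod_cast hunit 2 (by norm_num) (by omega)
  have hV : ∀ r : ℕ, r ≠ 0 → r < p → ∃ V : (integers p)⟦X⟧⟦X⟧, thetaSeries _ (r : ℤ) = X * V ∧
      constantCoeff V = C (r : integers p) * etaSeries _ ∧ IsUnit V := by
    intro r hr0 hr
    obtain ⟨V, hV⟩ := X_dvd_iff.mpr (constantCoeff_thetaSeries (integers p) r)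
    have h1 := coeff_one_thetaSeries (integers p) r
    rw [hV, coeff_one_X_mul, Int.cast_natCast] at h1
    refine ⟨V, hV, h1, ?_⟩
    rw [PowerSeries.isUnit_iff_constantCoeff, h1]
    exact ((hunit r hr0 hr).map C).mul hη
  obtain ⟨V1, hD1, hV1, hV1u⟩ := hV 1 (by norm_num) (by omega)
  obtain ⟨V2, hD2, hV2, hV2u⟩ := hV 2 (by norm_num) (by omega)
  obtain ⟨V3, hD3, hV3, hV3u⟩ := hV 3 (by norm_num) (by omega)
  obtain ⟨W, hW⟩ := (hV3u.mul (hV1u.pow 2)).exists_right_inv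
  have h3u := hunit 3 (by norm_num) (by omega)
  obtain ⟨b, hb⟩ := h3u.exists_right_inv
  obtain ⟨η', hη'⟩ := hη.exists_right_inv
  -- This is θ₂³/(θ₃θ₁²): the zeros at z = 0 and the powers of `thetaFactor` cancel, and the
  -- Gaussian exponent is 3·4 - 9 - 2·1 = 1. The constant term is 8/3, a p-adic unit.
  let N := V2 ^ 3 * W
  have hNV : N * (V3 * V1 ^ 2) = V2 ^ 3 := by
    simp only [N]
    linear_combination V2 ^ 3 * hW
  have hN0 : constantCoeff N = C (8 * b) := by
    have h1 := congrArg constantCoeff hNV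
    simp only [map_mul, map_pow, hV1, hV2, hV3] at h1 ⊢
    have hC3 : (C ((3 : ℕ) : integers p) : (integers p)⟦X⟧) * C b = 1 := by rw [← map_mul, hb,
        map_one]
    have hC8 : (C (8 : integers p) : (integers p)⟦X⟧) = 8 := map_ofNat _ 8
    have hC1 : (C ((1 : ℕ) : integers p) : (integers p)⟦X⟧) = 1 := by simp
    have hC2 : (C ((2 : ℕ) : integers p) : (integers p)⟦X⟧) = 2 := by
      rw [map_natCast]; norm_num
    rw [hC1, hC2] at h1
    rw [hC8]
    have hηC : etaSeries (integers p) ^ 3 * η' ^ 3 = 1 := by rw [← mul_pow, hη', one_pow]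
    linear_combination (C b * η' ^ 3) * h1 - constantCoeff N * hC3 -
      (constantCoeff N * C b * C ((3 : ℕ) : integers p) - 8 * C b) * hηC
  have h8b : IsUnit (8 * b : integers p) := by
    have h2 := (hunit 2 (by norm_num) (by omega)).pow 3
    have h3 : IsUnit b := IsUnit.of_mul_eq_one _ (by rw [mul_comm]; exact hb)
    have e : (8 : integers p) = ((2 : ℕ) : integers p) ^ 3 := by norm_num
    rw [e]
    exact h2.mul h3
  have hNu : IsUnit N := (hV2u.pow 3).mul (IsUnit.of_mul_eq_one _ (by rw [mul_comm]; exact hW))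
  have hCunit : ∀ x : integers p, IsUnit x → IsUnit (convC (x : ℂ)) := fun x hx =>
    (hx.map (integers p).subtype).map convC
  have hJN : IsJacobiType gaussian N := by
    refine IsJacobiType.of_mul (H := X ^ 3 * (V3 * V1 ^ 2)) (r := 3) (V := V3 * V1 ^ 2)
      (a := fun τ => (C (thetaFactor τ) * gaussian τ ^ 4) ^ 3)
      (b := fun τ => (C (thetaFactor τ) * gaussian τ ^ 9) * (C (thetaFactor τ) *
          gaussian τ ^ 1) ^ 2)
      ?_ ?_ rfl ?_ (fun τ => by ring) fun τ => ?_
    · have := (isJacobiType_thetaSeries (p := p) 2).pow 3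
      rw [hD2] at this
      convert this using 1
      · funext τ
        norm_num [Pi.pow_apply]
      · rw [mul_pow, ← hNV]
        ring
    · have := (isJacobiType_thetaSeries (p := p) 3).mul
        ((isJacobiType_thetaSeries (p := p) 1).pow 2)
      rw [hD3, hD1] at this
      convert this using 1
      · funext τ
        norm_num [Pi.pow_apply]
      · ring
    · refine ⟨convC ((3 : ℕ) : integers p) * H ^ 3, (hCunit _ h3u).mul (hHu.pow 3), ?_⟩
      rw [map_mul, map_pow, hV3, hV1, map_mul, map_pow, map_mul, map_mul, hH, toC_C, toC_C]
      simp only [Subring.coe_mul, Subring.coe_pow, coe_convC]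
      simp
      ring
    · have h1 := gaussian_ne_zero τ
      have h2 : C (thetaFactor τ) ≠ 0 := by
        rw [Ne, map_eq_zero_iff _ C_injective]
        exact thetaFactor_ne_zero τ
      positivity
  obtain ⟨N', hN'⟩ := hNu.exists_right_inv
  -- The second block is θ₁/(N·`etaSeries`): the Gaussians cancel, and the factors leave 1/τ.
  refine ⟨N, X * (V1 * N' * C η'), V1 * N' * C η', ⟨hNu, hJN, convC (8 * b : integers p),
    hCunit _ h8b, by rw [hN0, toC_C]; rfl⟩, ?_, rfl, ?_, ?_⟩
  · have hC1 : (C (etaSeries (integers p)) : (integers p)⟦X⟧⟦X⟧) * C η' = 1 := by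
      rw [← map_mul, hη', map_one]
    refine IsJacobiType.of_mul (H := N * C (etaSeries _)) (r := 0)
      (V := N * C (etaSeries _)) (a := fun τ => C (thetaFactor τ) * gaussian τ ^ 1)
      (b := fun τ => gaussian τ * C (τ * thetaFactor τ)) ?_ (hJN.mul (.const hH hHS))
      (by rw [pow_zero, one_mul]) ?_ (fun τ => ?_) fun τ => ?_
    · have := isJacobiType_thetaSeries (p := p) 1
      rw [hD1] at this
      convert this using 1
      · funext τ
        norm_num
      linear_combination X * V1 * N * N' * hC1 + X * V1 * hN'
    · refine ⟨convC (8 * b : integers p) * H, (hCunit _ h8b).mul hHu, ?_⟩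
      rw [map_mul, map_mul, hN0, constantCoeff_C, hH, toC_C]
      rfl
    · have hτ := UpperHalfPlane.ne_zero τ
      have : C ((τ : ℂ) ^ (-1 : ℤ)) * (C (τ * thetaFactor τ) : ℂ⟦X⟧) = C (thetaFactor τ) := by
        rw [← map_mul]
        congr 1
        rw [zpow_neg_one]
        field_simp
      linear_combination -gaussian τ * this
    · refine mul_ne_zero (gaussian_ne_zero τ) ?_
      rw [Ne, map_eq_zero_iff _ C_injective]
      exact mul_ne_zero (UpperHalfPlane.ne_zero τ) (thetaFactor_ne_zero τ)
  · have h1 : IsUnit N' := IsUnit.of_mul_eq_one _ (by rw [mul_comm]; exact hN')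
    have h2 : IsUnit η' := IsUnit.of_mul_eq_one _ (by rw [mul_comm]; exact hη')
    exact (hV1u.mul h1).mul (h2.map C)
  · obtain ⟨d, hd⟩ := h8b.exists_right_inv
    refine ⟨convC d, hCunit _ (IsUnit.of_mul_eq_one _ (by rw [mul_comm]; exact hd)), ?_⟩
    have h1 : constantCoeff (V1 * N' * C η') = C d := by
      have h2 := congrArg constantCoeff hN'
      rw [map_mul, hN0, map_one] at h2
      have h3 : (C (8 * b) : (integers p)⟦X⟧) * C d = 1 := by rw [← map_mul, hd, map_one]
      rw [map_mul, map_mul, hV1, constantCoeff_C]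
      simp only [Nat.cast_one, map_one, one_mul]
      linear_combination constantCoeff N' * hη' + C d * h2 - constantCoeff N' * h3
    rw [h1, toC_C]
    rfl

end ThetaBlocks
-- Linear independence of integral powers of 1 + u.
section LinearIndependence

open PowerSeries

/-- After a common shift the exponents are natural, and X ↦ X - 1 turns the relation into one
between distinct monomials. -/
theorem eq_zero_of_sum_binom {K : Type*} [Field K] {I : Type*} (s : Finset I) (d : I → K)
    (l : I → ℤ) (hl : Set.InjOn l s) (h : ∑ i ∈ s, C (d i) * binom K (l i) = 0) {i : I}
    (hi : i ∈ s) : d i = 0 := by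
  obtain ⟨L, hL⟩ : ∃ L : ℤ, ∀ i ∈ s, 0 ≤ l i + L := by
    refine ⟨∑ i ∈ s, |l i|, fun i hi => ?_⟩
    have h1 := Finset.single_le_sum (f := fun i => |l i|) (fun _ _ => abs_nonneg _) hi
    have h2 := neg_abs_le (l i)
    linarith
  have h1 : ∑ i ∈ s, C (d i) * (1 + X : K⟦X⟧) ^ (l i + L).toNat = 0 := by
    rw [← zero_mul (binom K L), ← h, Finset.sum_mul]
    refine Finset.sum_congr rfl fun i hi => ?_
    rw [mul_assoc, ← binom_add, ← binom_natCast, Int.toNat_of_nonneg (hL i hi)]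
  have h2 : ∑ i ∈ s, Polynomial.C (d i) * (1 + Polynomial.X) ^ (l i + L).toNat = 0 := by
    apply Polynomial.coe_injective K
    rw [Polynomial.coe_zero, ← h1, ← Polynomial.coeToPowerSeries.ringHom_apply, map_sum]
    simp
  have h3 := congrArg (fun P => Polynomial.coeff (P.comp (Polynomial.X - 1)) (l i + L).toNat) h2
  simp only [Polynomial.sum_comp, Polynomial.mul_comp, Polynomial.C_comp, Polynomial.pow_comp,
    Polynomial.add_comp, Polynomial.one_comp, Polynomial.X_comp, add_sub_cancel,
    Polynomial.finsetSum_coeff, Polynomial.coeff_C_mul, Polynomial.coeff_X_pow,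
    Polynomial.zero_comp, Polynomial.coeff_zero] at h3
  rw [Finset.sum_eq_single_of_mem i hi] at h3
  · simpa using h3
  · intro j hj hji
    have : (l i + L).toNat ≠ (l j + L).toNat := by
      intro h
      have h4 := hL i hi
      have h5 := hL j hj
      exact hji (hl hj hi (by omega))
    simp [this]

end LinearIndependence

/-! ### Fourier coefficients of Hermitian Jacobi forms. -/

section HermitianForms

open HermitianJacobi

theorem normSq_dualPt (s : GaussianInt) :
    Complex.normSq (dualPt s) = ((s.re ^ 2 + s.im ^ 2 : ℤ) : ℝ) / 4 := by
  rw [dualPt, GaussianInt.toComplex_def]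
  simp [Complex.normSq_apply]
  ring

theorem hasFourierExpansion_sum {ι : Type*} (K : Finset ι) {φ : ι → ℍ → ℂ → ℂ → ℂ}
    {c : ι → ℤ → GaussianInt → ℂ} (h : ∀ i ∈ K, HasFourierExpansion (φ i) (c i)) :
    HasFourierExpansion (∑ i ∈ K, φ i) (∑ i ∈ K, c i) := by
  intro τ z₁ z₂
  simp only [Finset.sum_apply, Finset.sum_mul]
  exact hasSum_sum fun i hi => h i hi τ z₁ z₂

theorem coeff_zero_fun (n : ℤ) (s : GaussianInt) : coeff 0 n s = 0 := by
  have : HasFourierExpansion 0 0 := fun τ z₁ z₂ => by simp [hasSum_zero]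
  rw [this.coeff_eq]
  rfl

variable {p : ℕ} [hp : Fact p.Prime]

open Classical in
variable (p) in
/-- The Fourier coefficients as `p`-integral numbers. -/
noncomputable def intCoeff (φ : ℍ → ℂ → ℂ → ℂ) (n : ℤ) (s : GaussianInt) : integers p :=
  if h : coeff φ n s ∈ integers p then ⟨coeff φ n s, h⟩ else 0

section Form

variable {k m : ℤ} {δ : Parity} {φ : ℍ → ℂ → ℂ → ℂ}

theorem hasFourierExpansion_coeff (hφ : IsHermitianJacobiForm k m δ φ) :
    HasFourierExpansion φ (coeff φ) := by
  obtain ⟨c, hc, _⟩ := hφ.fourier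
  rwa [hc.coeff_eq]

theorem coeff_ne_zero_imp (hφ : IsHermitianJacobiForm k m δ φ) {n : ℤ} {s : GaussianInt}
    (h : coeff φ n s ≠ 0) : 0 ≤ n ∧ s.re ^ 2 + s.im ^ 2 ≤ 4 * m * n := by
  obtain ⟨c, hc, hs⟩ := hφ.fourier
  rw [hc.coeff_eq] at h
  obtain ⟨h1, h2⟩ := hs n s h
  refine ⟨h1, ?_⟩
  rw [normSq_dualPt, div_le_iff₀ (by norm_num)] at h2
  have : ((s.re ^ 2 + s.im ^ 2 : ℤ) : ℝ) ≤ ((4 * m * n : ℤ) : ℝ) := by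
    push_cast at h2 ⊢
    linarith
  exact_mod_cast this

theorem coe_intCoeff (hφ : IsPIntegralForm p k m δ φ) (n : ℤ) (s : GaussianInt) :
    (intCoeff p φ n s : ℂ) = coeff φ n s := by
  rw [intCoeff, dif_pos (show coeff φ n s ∈ integers p from hφ.integral n s)]

theorem intCoeff_ne_zero_imp (hφ : IsPIntegralForm p k m δ φ) {n : ℤ} {s : GaussianInt}
    (h : intCoeff p φ n s ≠ 0) : 0 ≤ n ∧ s.re ^ 2 + s.im ^ 2 ≤ 4 * m * n := by
  refine coeff_ne_zero_imp hφ.isForm fun h0 => h ?_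
  rw [← coe_intCoeff hφ] at h0
  exact Subtype.ext h0

theorem modEq_zero_iff (hφ : IsPIntegralForm p k m δ φ) :
    ModEq p φ 0 ↔ ∀ n s, red p (intCoeff p φ n s) = 0 := by
  simp only [ModEq, coeff_zero_fun, sub_zero, red_eq_zero_iff, coe_intCoeff hφ]

theorem coeff_neg_fun (hφ : IsHermitianJacobiForm k m δ φ) (n : ℤ) (s : GaussianInt) :
    coeff (-φ) n s = -coeff φ n s := by
  have : HasFourierExpansion (-φ) (-coeff φ) := fun τ z₁ z₂ => by
    simpa using (hasFourierExpansion_coeff hφ τ z₁ z₂).neg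
  rw [this.coeff_eq]
  rfl

theorem isPIntegralForm_neg (hφ : IsPIntegralForm p k m δ φ) :
    IsPIntegralForm p k m δ (-φ) where
  isForm :=
    { holomorphic := hφ.isForm.holomorphic.neg
      modular := fun M ε τ z₁ z₂ => by
        simpa using hφ.isForm.modular M ε τ z₁ z₂
      elliptic := fun l μ τ z₁ z₂ => by
        simpa using hφ.isForm.elliptic l μ τ z₁ z₂
      fourier := by
        obtain ⟨c, hc, hs⟩ := hφ.isForm.fourier
        refine ⟨-c, fun τ z₁ z₂ => by simpa using (hc τ z₁ z₂).neg, fun n s h => hs n s ?_⟩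
        simpa using h }
  integral := fun n s => by
    rw [coeff_neg_fun hφ.isForm]
    exact (integers p).neg_mem (hφ.integral n s)

theorem coeff_eq_zero_of_neg (hφ : IsHermitianJacobiForm k m δ φ) (hm : m < 0) (n : ℤ)
    (s : GaussianInt) : coeff φ n s = 0 := by
  have hsupp : ∀ n s, coeff φ n s ≠ 0 → n = 0 ∧ s = 0 := by
    intro n s h
    obtain ⟨h1, h2⟩ := coeff_ne_zero_imp hφ h
    have hn : n = 0 := by
      by_contra h3
      have : 0 < n := by omega
      nlinarith [sq_nonneg s.re, sq_nonneg s.im]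
    subst hn
    have h3 : s.re = 0 := by nlinarith [sq_nonneg s.re, sq_nonneg s.im]
    have h4 : s.im = 0 := by nlinarith [sq_nonneg s.re, sq_nonneg s.im]
    exact ⟨rfl, Zsqrtd.ext h3 h4⟩
  by_contra hne
  obtain ⟨rfl, rfl⟩ := hsupp n s hne
  have hconst : ∀ τ z₁ z₂, φ τ z₁ z₂ = coeff φ 0 0 := by
    intro τ z₁ z₂
    refine (hasFourierExpansion_coeff hφ τ z₁ z₂).unique ?_
    rw [show coeff φ 0 0 = coeff φ 0 0 * e ((0 : ℤ) * (τ : ℂ) + dualPt 0 * z₁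
      + conj (dualPt 0) * z₂) by simp [e, dualPt]]
    refine hasSum_single (f := fun x : ℤ × GaussianInt => coeff φ x.1 x.2 *
      e (x.1 * (τ : ℂ) + dualPt x.2 * z₁ + conj (dualPt x.2) * z₂)) (0, 0) ?_
    · rintro ⟨n, s⟩ h
      have : coeff φ n s = 0 := by
        by_contra h1
        obtain ⟨rfl, rfl⟩ := hsupp n s h1
        exact h rfl
      simp [this]
  -- The form is constant, and this point makes the elliptic factor exp(πi/2) = i, which differs
  -- from 1.
  have h := hφ.elliptic 1 0 UpperHalfPlane.I (1 / (4 * m) - UpperHalfPlane.I) 0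
  rw [hconst, hconst, mul_left_eq_self₀, or_iff_left hne] at h
  have hm' : (m : ℂ) ≠ 0 := by exact_mod_cast hm.ne
  have h2 : 2 * (Real.pi : ℂ) * Complex.I * m * (GaussianInt.toComplex 1 *
      conj (GaussianInt.toComplex 1) * (UpperHalfPlane.I : ℍ) + conj (GaussianInt.toComplex 1) *
      (1 / (4 * m) - (UpperHalfPlane.I : ℍ)) + GaussianInt.toComplex 1 * 0) =
        Real.pi / 2 * Complex.I := by
    simp only [map_one]
    field_simp
    ring
  rw [h2, Complex.exp_pi_div_two_mul_I] at h
  exact absurd (congrArg Complex.re h) (by simp)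

/-- The effect of the translation `[N, 0]` on the Fourier coefficients. -/
theorem coeff_translate (hφ : IsHermitianJacobiForm k m δ φ) (N : ℤ) (n : ℤ) (s : GaussianInt) :
    coeff φ (n - N * s.im + m * N ^ 2) ⟨s.re, s.im - 2 * m * N⟩ = coeff φ n s := by
  -- The elliptic law with λ = N, μ = 0 reindexes the expansion by `T`; in terms of r = (i/2)s it
  -- moves r to r + mN. Uniqueness of Fourier coefficients concludes.
  let T : ℤ × GaussianInt ≃ ℤ × GaussianInt :=
    { toFun := fun x => (x.1 - N * x.2.im + m * N ^ 2, ⟨x.2.re, x.2.im - 2 * m * N⟩)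
      invFun := fun y => (y.1 + N * (y.2.im + 2 * m * N) - m * N ^ 2, ⟨y.2.re, y.2.im + 2 * m * N⟩)
      left_inv := fun x => by
        refine Prod.ext ?_ (Zsqrtd.ext rfl ?_)
        · simp
          ring
        · simp
      right_inv := fun x => by
        refine Prod.ext ?_ (Zsqrtd.ext rfl ?_)
        · simp
          ring
        · simp }
  have h : HasFourierExpansion φ fun n s => coeff φ (T.symm (n, s)).1 (T.symm (n, s)).2 := by
    intro τ z₁ z₂
    rw [← T.hasSum_iff]
    have h1 := (hasFourierExpansion_coeff hφ τ (z₁ + N * τ) (z₂ + N * τ)).mul_left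
      (Complex.exp (2 * Real.pi * Complex.I * m * (N * N * τ + N * z₁ + N * z₂)))
    have h2 := hφ.elliptic N 0 τ z₁ z₂
    simp only [map_intCast, map_zero, add_zero] at h2
    rw [h2] at h1
    refine h1.congr_fun fun x => ?_
    simp only [Function.comp_apply, Prod.mk.eta, Equiv.symm_apply_apply]
    rw [mul_left_comm, e, e, ← Complex.exp_add]
    congr 2
    simp only [T, Equiv.coe_fn_mk, dualPt, GaussianInt.toComplex_def, map_mul, map_add,
      map_div₀, Complex.conj_I, map_ofNat, map_intCast]
    push_cast
    linear_combination (-Real.pi * Complex.I * 2 * (x.2.im * N * τ + m * N * z₁ + m * N * z₂)) *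
        Complex.I_sq
  have h1 := congrFun (congrFun h.coeff_eq (T (n, s)).1) (T (n, s)).2
  rw [Prod.mk.eta, Equiv.symm_apply_apply] at h1
  exact h1

end Form

end HermitianForms
-- Restriction to lines, and recovery of the coefficients.
section Pullback

open HermitianJacobi PowerSeries

/-- The support of the Fourier expansion of a Hermitian Jacobi form of index `m`. -/
abbrev FourierSupport (m : ℤ) : Type :=
  {x : ℤ × GaussianInt // 0 ≤ x.1 ∧ x.2.re ^ 2 + x.2.im ^ 2 ≤ 4 * m * x.1}

theorem abs_le_of_sq_add_sq_le {a b T : ℤ} (h : a ^ 2 + b ^ 2 ≤ T) : |a| ≤ T ∧ |b| ≤ T := by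
  have h1 := Int.le_self_sq a
  have h2 := Int.le_self_sq (-a)
  have h3 := Int.le_self_sq b
  have h4 := Int.le_self_sq (-b)
  rw [neg_sq] at h2 h4
  constructor <;> rw [abs_le] <;> constructor <;> nlinarith [sq_nonneg a, sq_nonneg b]

theorem finite_fourierSupport (m : ℤ) (n : ℕ) :
    ((fun x : FourierSupport m => x.1.1.toNat) ⁻¹' {n}).Finite := by
  refine Set.Finite.of_injOn (f := fun x : FourierSupport m => (x.1.2.re, x.1.2.im))
    (t := Set.Icc (-(4 * m * n)) (4 * m * n) ×ˢ Set.Icc (-(4 * m * n)) (4 * m * n)) ?_ ?_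
    ((Set.finite_Icc _ _).prod (Set.finite_Icc _ _))
  · rintro ⟨⟨n', s⟩, h1, h2⟩ h
    simp only [Set.mem_preimage, Set.mem_singleton_iff] at h h1 h2
    obtain rfl : n' = n := by omega
    obtain ⟨h3, h4⟩ := abs_le_of_sq_add_sq_le h2
    exact ⟨abs_le.mp h3, abs_le.mp h4⟩
  · rintro ⟨⟨n', s⟩, h1, h2⟩ h ⟨⟨n'', s'⟩, h1', h2'⟩ h' heq
    simp only [Set.mem_preimage, Set.mem_singleton_iff, Prod.mk.injEq] at h h' h1 h1' heq
    obtain rfl : n' = n'' := by omega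
    obtain rfl : s = s' := Zsqrtd.ext heq.1 heq.2
    rfl

/-- The exponents of the pullback along `z ↦ (2(B + i)z, 2(B - i)z)`. -/
def pullbackExponent (B : ℤ) {m : ℤ} (x : FourierSupport m) : ℤ :=
  -2 * (x.1.2.re + B * x.1.2.im)

variable {p : ℕ} [hp : Fact p.Prime]

variable (p) in
/-- The `q`-expansion of the pullback of `φ` along `z ↦ (2(B + i)z, 2(B - i)z)`. -/
noncomputable def pullbackSeries (m B : ℤ) (φ : ℍ → ℂ → ℂ → ℂ) : (integers p)⟦X⟧⟦X⟧ :=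
  qzSeries (fun x : FourierSupport m => x.1.1.toNat) (pullbackExponent B) (finite_fourierSupport m)
    fun x => intCoeff p φ x.1.1 x.1.2

variable {k m : ℤ} {δ : Parity} {φ : ℍ → ℂ → ℂ → ℂ}

theorem hasSum_pullback (hφ : IsPIntegralForm p k m δ φ) (B : ℤ) (τ : ℍ) (z : ℂ) :
    HasSum (fun x : FourierSupport m => (intCoeff p φ x.1.1 x.1.2 : ℂ) *
      Complex.exp (2 * Real.pi * Complex.I *
        (x.1.1.toNat * (τ : ℂ) + pullbackExponent B x * z)))
      (φ τ (2 * (B + Complex.I) * z) (2 * (B - Complex.I) * z)) := by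
  have h := hasFourierExpansion_coeff hφ.isForm τ (2 * (B + Complex.I) * z)
    (2 * (B - Complex.I) * z)
  rw [← hasSum_subtype_iff_of_support_subset (s := {x : ℤ × GaussianInt |
    0 ≤ x.1 ∧ x.2.re ^ 2 + x.2.im ^ 2 ≤ 4 * m * x.1})] at h
  · refine h.congr_fun ?_
    rintro ⟨⟨n, s⟩, h1, h2⟩
    have h3 : ((n.toNat : ℕ) : ℂ) = (n : ℂ) := by
      rw [← Int.cast_natCast, Int.toNat_of_nonneg h1]
    simp only [Function.comp_apply, coe_intCoeff hφ, h3, e]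
    congr 2
    simp only [pullbackExponent, dualPt, GaussianInt.toComplex_def, map_mul, map_add,
      map_div₀, Complex.conj_I, map_ofNat, map_intCast]
    push_cast
    linear_combination (-2 * Real.pi * Complex.I * z * (2 * s.re + 2 * B * s.im)) * Complex.I_sq
  · intro x hx
    have : coeff φ x.1 x.2 ≠ 0 := fun h0 => hx (by simp [h0])
    exact coeff_ne_zero_imp hφ.isForm this

/-- On the line z₁z₂ = 4(B² + 1)z². The factor 2 in its parametrization makes the index factor an
integral power of `gaussian` for every B. -/
theorem isJacobiType_pullbackSeries (hφ : IsPIntegralForm p k m δ φ) (B : ℤ) {j : ℕ}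
    (hj : (j : ℤ) = 2 * m * (B ^ 2 + 1)) :
    IsJacobiType (fun τ => C ((τ : ℂ) ^ k) * gaussian τ ^ j) (pullbackSeries p m B φ) := by
  have h := isJacobiType_qzSeries (finite_fourierSupport m) (hasSum_pullback hφ B)
    (A := fun τ z => (τ : ℂ) ^ k * Complex.exp (4 * Real.pi * Complex.I * z ^ 2 / τ) ^ j)
    (fun τ => by fun_prop (disch := exact τ.ne_zero)) fun τ z => ?_
  · simp only [taylor_thetaLaw] at h
    exact h
  · have h1 := hφ.isForm.modular ModularGroup.S 1 τ (2 * (B + Complex.I) * z)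
      (2 * (B - Complex.I) * z)
    have hτ := UpperHalfPlane.ne_zero τ
    have hσ : δ.sigma 1 = 1 := by cases δ <;> simp [Parity.sigma]
    have hj' : (j : ℂ) = 2 * m * (B ^ 2 + 1) := by exact_mod_cast hj
    have hS : ((ModularGroup.S 1 0 : ℤ) : ℂ) = 1 ∧ ((ModularGroup.S 1 1 : ℤ) : ℂ) = 0 := by
      simp [ModularGroup.S]
    simp only [hσ, hS.1, hS.2, Units.val_one, map_one, one_zpow, one_mul, mul_one, add_zero] at h1
    rw [← h1, ← Complex.exp_nat_mul, zpow_neg,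
      show 2 * (B + Complex.I) * ((τ : ℂ)⁻¹ * z) = 2 * (B + Complex.I) * z / τ by ring,
      show 2 * (B - Complex.I) * ((τ : ℂ)⁻¹ * z) = 2 * (B - Complex.I) * z / τ by ring]
    have hexp : Complex.exp (j * (4 * Real.pi * Complex.I * z ^ 2 / τ)) *
        Complex.exp (-2 * Real.pi * Complex.I * m * (2 * (B + Complex.I) * z) *
          (2 * (B - Complex.I) * z) / τ) = 1 := by
      rw [← Complex.exp_add, Complex.exp_eq_one_iff]
      refine ⟨0, ?_⟩
      rw [hj']
      push_cast
      linear_combination (8 * Real.pi * Complex.I * m * z ^ 2 / τ) * Complex.I_sq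
    have hone := congrArg₂ (· * ·) (mul_inv_cancel₀ (zpow_ne_zero k hτ)) hexp
    simp only [mul_one] at hone
    linear_combination (-φ (ModularGroup.S • τ) (2 * (B + Complex.I) * z / τ)
      (2 * (B - Complex.I) * z / τ)) * hone

/-- Dividing by Nʲ brings all restrictions to index zero at once; Nʲ is invertible, so it can be
restored after the splitting. -/
theorem sum_map_red_pullback (hp5 : 5 ≤ p) {ι : Type*} (s : Finset ι) (w : ι → ℤ)
    (δ : ι → Parity) (φ : ι → ℍ → ℂ → ℂ → ℂ) (hm : 0 ≤ m)
    (hφ : ∀ i ∈ s, IsPIntegralForm p (w i) m (δ i) (φ i))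
    (h0 : ∀ n x, ∑ i ∈ s, red p (intCoeff p (φ i) n x) = 0) (a : ZMod (p - 1)) (B : ℤ) :
    ∑ i ∈ s with ((w i : ℤ) : ZMod (p - 1)) = a, redd p (pullbackSeries p m B (φ i)) = 0 := by
  obtain ⟨N, t, U, ⟨hN, hJN, v, hv, hNv⟩, ht, htU, hU, hUv⟩ := exists_thetaBlocks (p := p) hp5
  obtain ⟨j, hj⟩ : ∃ j : ℕ, (j : ℤ) = 2 * m * (B ^ 2 + 1) :=
    ⟨(2 * m * (B ^ 2 + 1)).toNat, Int.toNat_of_nonneg (by positivity)⟩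
  obtain ⟨W, hW⟩ := (hN.pow j).exists_right_inv
  have hF : ∀ i ∈ s, IsJacobiType (fun τ => C ((τ : ℂ) ^ w i))
      (pullbackSeries p m B (φ i) * W) := by
    intro i hi
    refine IsJacobiType.of_mul (H := N ^ j) (r := 0) (V := N ^ j) ?_ (hJN.pow j) (by simp)
      ⟨v ^ j, hv.pow j, by rw [map_pow, map_pow, hNv]; rfl⟩ (fun τ => rfl)
      fun τ => pow_ne_zero _ (gaussian_ne_zero τ)
    rw [mul_assoc, mul_comm W, hW, mul_one]
    exact isJacobiType_pullbackSeries (hφ i hi) B hj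
  have hsum : ∑ i ∈ s, redd p (pullbackSeries p m B (φ i) * W) = 0 := by
    have : ∑ i ∈ s, redd p (pullbackSeries p m B (φ i)) = 0 := by
      ext k n
      simp only [redd, pullbackSeries, map_qzSeries, map_sum, coeff_coeff_qzSeries, map_zero]
      rw [Finset.sum_comm]
      refine Finset.sum_eq_zero fun x _ => ?_
      rw [← Finset.sum_mul, h0, zero_mul]
    simp only [map_mul]
    rw [← Finset.sum_mul, this, zero_mul]
  have h := fun k => coeff_sum_redd_filter_eq_zero hp5 ht htU hU hUv s k _ w hF hsum a
  have h1 : ∑ i ∈ s with ((w i : ℤ) : ZMod (p - 1)) = a,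
      redd p (pullbackSeries p m B (φ i) * W) = 0 := by
    ext1 k
    rw [h k, map_zero]
  simp only [map_mul] at h1
  rw [← Finset.sum_mul] at h1
  have h2 : redd p W * redd p (N ^ j) = 1 := by rw [← map_mul, mul_comm, hW, map_one]
  rw [← mul_one (Finset.sum _ _), ← h2, ← mul_assoc, h1, zero_mul]

theorem sum_red_intCoeff_filter_eq_zero (hp5 : 5 ≤ p) {ι : Type*} (s : Finset ι) (w : ι → ℤ)
    (δ : ι → Parity) (φ : ι → ℍ → ℂ → ℂ → ℂ)
    (hφ : ∀ i ∈ s, IsPIntegralForm p (w i) m (δ i) (φ i))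
    (h0 : ∀ n x, ∑ i ∈ s, red p (intCoeff p (φ i) n x) = 0) (a : ZMod (p - 1)) (n : ℤ)
    (x : GaussianInt) :
    ∑ i ∈ s with ((w i : ℤ) : ZMod (p - 1)) = a, red p (intCoeff p (φ i) n x) = 0 := by
  by_cases hx : 0 ≤ n ∧ x.re ^ 2 + x.im ^ 2 ≤ 4 * m * n
  swap
  · refine Finset.sum_eq_zero fun i hi => ?_
    have : intCoeff p (φ i) n x = 0 := by
      by_contra h
      exact hx (intCoeff_ne_zero_imp (hφ i (Finset.mem_filter.mp hi).1) h)
    rw [this, map_zero]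
  rcases lt_or_ge m 0 with hm | hm
  · refine Finset.sum_eq_zero fun i hi => ?_
    have hi := hφ i (Finset.mem_filter.mp hi).1
    have : intCoeff p (φ i) n x = 0 :=
      Subtype.ext ((coe_intCoeff hi n x).trans (coeff_eq_zero_of_neg hi.isForm hm n x))
    rw [this, map_zero]
  obtain ⟨n, rfl⟩ := Int.eq_ofNat_of_zero_le hx.1
  set T : ℤ := 4 * m * n with hT
  -- The support condition gives |re|, |im| ≤ T, so two real parts differ by at most 2T. With B = 2T
  -- + 1 the number re + B·im therefore determines both.
  have h := sum_map_red_pullback hp5 s w δ φ hm hφ h0 a (2 * T + 1)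
  have h1 : ∑ y ∈ (finite_fourierSupport m n).toFinset,
      C (∑ i ∈ s with ((w i : ℤ) : ZMod (p - 1)) = a, red p (intCoeff p (φ i) y.1.1 y.1.2)) *
        binom (ZMod p) (pullbackExponent (2 * T + 1) y) = 0 := by
    ext k
    have h2 := congrArg (fun f => PowerSeries.coeff n (PowerSeries.coeff k f)) h
    simp only [redd, pullbackSeries, map_qzSeries, map_sum, coeff_coeff_qzSeries, map_zero] at h2
    rw [Finset.sum_comm] at h2
    rw [map_sum, map_zero, ← h2]
    refine Finset.sum_congr rfl fun y _ => ?_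
    rw [PowerSeries.coeff_C_mul, Finset.sum_mul]
  refine eq_zero_of_sum_binom _ _ _ ?_ h1 (i := ⟨(n, x), hx⟩) ?_
  · rintro ⟨⟨n₁, y₁⟩, h1, h2⟩ hy₁ ⟨⟨n₂, y₂⟩, h3, h4⟩ hy₂ heq
    simp only [Set.Finite.coe_toFinset, Set.mem_preimage, Set.mem_singleton_iff] at hy₁ hy₂ h1 h3
    obtain rfl : n₁ = n := by omega
    obtain rfl : n₂ = n := by omega
    obtain ⟨h5, h6⟩ := abs_le_of_sq_add_sq_le h2
    obtain ⟨h7, h8⟩ := abs_le_of_sq_add_sq_le h4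
    simp only [pullbackExponent] at heq h5 h6 h7 h8
    rw [← hT, abs_le] at h5 h6 h7 h8
    have h9 : y₁.re - y₂.re = (2 * T + 1) * (y₂.im - y₁.im) := by linarith
    have h10 : y₂.im - y₁.im = 0 := by
      by_contra hne
      rcases lt_or_gt_of_ne hne with hlt | hgt
      · nlinarith
      · nlinarith
    rw [h10, mul_zero] at h9
    obtain rfl : y₁ = y₂ := Zsqrtd.ext (by omega) (by omega)
    rfl
  · simp

end Pullback

/-! ### Comparison of indices and weights. -/

section Congruences

open HermitianJacobi

variable {p : ℕ} [hp : Fact p.Prime] {k k' m m' : ℤ} {δ δ' : Parity} {φ ψ : ℍ → ℂ → ℂ → ℂ}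

theorem ModEq.red_intCoeff_eq (hφ : IsPIntegralForm p k m δ φ) (hψ : IsPIntegralForm p k' m' δ' ψ)
    (h : ModEq p φ ψ) (n : ℤ) (s : GaussianInt) :
    red p (intCoeff p φ n s) = red p (intCoeff p ψ n s) := by
  rw [← sub_eq_zero, ← map_sub, red_eq_zero_iff]
  simpa [coe_intCoeff hφ, coe_intCoeff hψ] using h n s

theorem coeff_finsetSum_fun {ι : Type*} (K : Finset ι) {w : ι → ℤ} {δ : ι → Parity}
    {φ : ι → ℍ → ℂ → ℂ → ℂ} (hφ : ∀ i ∈ K, IsPIntegralForm p (w i) m (δ i) (φ i)) (n : ℤ)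
    (s : GaussianInt) :
    coeff (∑ i ∈ K, φ i) n s = ((∑ i ∈ K, intCoeff p (φ i) n s : integers p) : ℂ) := by
  rw [(hasFourierExpansion_sum K fun i hi => hasFourierExpansion_coeff (hφ i hi).isForm).coeff_eq,
    AddSubmonoidClass.coe_finsetSum, Finset.sum_apply, Finset.sum_apply]
  exact Finset.sum_congr rfl fun i hi => (coe_intCoeff (hφ i hi) n s).symm

theorem modEq_sum_zero_iff {ι : Type*} (K : Finset ι) {w : ι → ℤ} {δ : ι → Parity}
    {φ : ι → ℍ → ℂ → ℂ → ℂ} (hφ : ∀ i ∈ K, IsPIntegralForm p (w i) m (δ i) (φ i)) :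
    ModEq p (∑ i ∈ K, φ i) 0 ↔ ∀ n s, ∑ i ∈ K, red p (intCoeff p (φ i) n s) = 0 := by
  simp only [ModEq, coeff_zero_fun, sub_zero, ← map_sum, red_eq_zero_iff, coeff_finsetSum_fun K hφ]

theorem modEq_sum_filter_zero (hp5 : 5 ≤ p) {ι : Type*} (K : Finset ι) {w : ι → ℤ}
    {δ : ι → Parity} {φ : ι → ℍ → ℂ → ℂ → ℂ}
    (hφ : ∀ i ∈ K, IsPIntegralForm p (w i) m (δ i) (φ i)) (h : ModEq p (∑ i ∈ K, φ i) 0)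
    (a : ZMod (p - 1)) :
    ModEq p (∑ i ∈ K with ((w i : ℤ) : ZMod (p - 1)) = a, φ i) 0 := by
  rw [modEq_sum_zero_iff K hφ] at h
  rw [modEq_sum_zero_iff _ fun i hi => hφ i (Finset.mem_filter.mp hi).1]
  exact sum_red_intCoeff_filter_eq_zero hp5 K w δ φ hφ h a

theorem nonneg_of_red_intCoeff_ne_zero (hφ : IsPIntegralForm p k m δ φ) {n : ℤ} {s : GaussianInt}
    (h : red p (intCoeff p φ n s) ≠ 0) : 0 ≤ m := by
  by_contra! hm
  refine h ?_
  rw [show intCoeff p φ n s = 0 from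
    Subtype.ext ((coe_intCoeff hφ n s).trans (coeff_eq_zero_of_neg hφ.isForm hm n s)), map_zero]

/-- A coefficient of φ nonzero modulo p has translates under [N, 0] that are nonzero too, hence lie
in the support of ψ. Comparing the N² terms as N grows gives the inequality. -/
theorem sq_index_le (hφ : IsPIntegralForm p k m δ φ) (hψ : IsPIntegralForm p k' m' δ' ψ)
    (h : ∀ n s, red p (intCoeff p φ n s) = red p (intCoeff p ψ n s)) {n : ℤ} {s : GaussianInt}
    (hs : red p (intCoeff p φ n s) ≠ 0) : m ^ 2 ≤ m' * m := by
  have key : ∀ N : ℤ, (s.im - 2 * m * N) ^ 2 ≤ 4 * m' * (n - N * s.im + m * N ^ 2) := by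
    intro N
    have h1 : intCoeff p φ (n - N * s.im + m * N ^ 2) ⟨s.re, s.im - 2 * m * N⟩ =
        intCoeff p φ n s := by
      apply Subtype.ext
      rw [coe_intCoeff hφ, coe_intCoeff hφ, coeff_translate hφ.isForm]
    have h2 : intCoeff p ψ (n - N * s.im + m * N ^ 2) ⟨s.re, s.im - 2 * m * N⟩ ≠ 0 := by
      intro h3
      rw [← h1, h, h3, map_zero] at hs
      exact hs rfl
    have h3 := (intCoeff_ne_zero_imp hψ h2).2
    simp only at h3
    nlinarith [sq_nonneg s.re]
  by_contra! hlt
  set b := s.im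
  set D := m ^ 2 - m' * m with hD
  have hD1 : 1 ≤ D := by omega
  set E := |4 * (m - m') * b| + |4 * m' * n| with hE
  have hE0 : 0 ≤ E := by positivity
  -- For N = E + 1 the linear and constant terms total at most E·N, which is less than 4D·N².
  have h1 := key (E + 1)
  have h2 := le_abs_self (4 * (m - m') * b)
  have h3 := le_abs_self (4 * m' * n)
  have h4 := abs_nonneg (4 * (m - m') * b)
  have h5 := abs_nonneg (4 * m' * n)
  have h6 : 4 * D * (E + 1) ^ 2 ≤ (4 * (m - m') * b) * (E + 1) + 4 * m' * n := by
    rw [hD]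
    nlinarith [sq_nonneg b]
  have h7 : (4 * (m - m') * b) * (E + 1) + 4 * m' * n ≤ E * (E + 1) := by
    rw [hE] at hE0 ⊢
    nlinarith
  nlinarith [sq_nonneg (E + 1)]

theorem index_eq_and_weight_modEq (hp5 : 5 ≤ p) (hφ : IsPIntegralForm p k m δ φ)
    (hψ : IsPIntegralForm p k' m' δ' ψ) (h0 : ¬ ModEq p φ 0) (h : ModEq p φ ψ) :
    m = m' ∧ k ≡ k' [ZMOD ((p : ℤ) - 1)] := by
  have hred := ModEq.red_intCoeff_eq hφ hψ h
  rw [modEq_zero_iff hφ] at h0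
  push Not at h0
  obtain ⟨n, s, hs⟩ := h0
  have hs' := hs
  rw [hred] at hs'
  have hm := nonneg_of_red_intCoeff_ne_zero hφ hs
  have hm' := nonneg_of_red_intCoeff_ne_zero hψ hs'
  have h1 := sq_index_le hφ hψ hred hs
  have h2 := sq_index_le hψ hφ (fun n s => (hred n s).symm) hs'
  obtain rfl : m = m' := by nlinarith [sq_nonneg (m - m')]
  refine ⟨rfl, ?_⟩
  rw [show (p : ℤ) - 1 = ((p - 1 : ℕ) : ℤ) by push_cast [show 1 ≤ p by omega]; ring,
    ← ZMod.intCast_eq_intCast_iff]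
  by_contra hne
  have hneg : ∀ n s, intCoeff p (-ψ) n s = -intCoeff p ψ n s := fun n s => by
    apply Subtype.ext
    rw [coe_intCoeff (isPIntegralForm_neg hψ), coeff_neg_fun hψ.isForm, ← coe_intCoeff hψ]
    rfl
  -- The pair φ, -ψ is indexed by `Bool`. If the weights were incongruent, the class of k would
  -- contain φ alone, and its nonzero coefficient would have to vanish.
  have h3 := sum_red_intCoeff_filter_eq_zero hp5 Finset.univ (fun i => cond i k k')
    (fun i => cond i δ δ') (fun i => cond i φ (-ψ)) (m := m)
    (by rintro (_ | _) _; exacts [isPIntegralForm_neg hψ, hφ])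
    (fun n s => by simp [hneg, hred]) (k : ZMod (p - 1)) n s
  rw [Finset.sum_filter] at h3
  simp [Ne.symm hne, hs] at h3

end Congruences

end HJCongruence

theorem mainTheorem7 (p : ℕ) (hp : p.Prime) (hp5 : 5 ≤ p) :
    (∀ (k k' m m' : ℤ) (δ δ' : HermitianJacobi.Parity) (φ ψ : ℍ → ℂ → ℂ → ℂ),
      HermitianJacobi.IsPIntegralForm p k m δ φ →
      HermitianJacobi.IsPIntegralForm p k' m' δ' ψ →
      ¬ HermitianJacobi.ModEq p φ 0 →
      HermitianJacobi.ModEq p φ ψ →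
      m = m' ∧ k ≡ k' [ZMOD ((p : ℤ) - 1)]) ∧
    (∀ (m : ℤ) (K : Finset ℤ) (δ : ℤ → HermitianJacobi.Parity) (φ : ℤ → ℍ → ℂ → ℂ → ℂ),
      (∀ k ∈ K, HermitianJacobi.IsPIntegralForm p k m (δ k) (φ k)) →
      HermitianJacobi.ModEq p (∑ k ∈ K, φ k) 0 →
      ∀ a : ZMod (p - 1),
        HermitianJacobi.ModEq p (∑ k ∈ K with ((k : ℤ) : ZMod (p - 1)) = a, φ k) 0) := by
  have : Fact p.Prime := ⟨hp⟩
  exact ⟨fun k k' m m' δ δ' φ ψ hφ hψ h0 h =>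
      HJCongruence.index_eq_and_weight_modEq hp5 hφ hψ h0 h,
    fun m K δ φ hφ h a => HJCongruence.modEq_sum_filter_zero hp5 K hφ h a⟩
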